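/- Equip $\mathbb{R}^4$, with coordinates $(x_1,y_1,x_2,y_2)$, with the standard primitive $\lambda=\frac12\sum_i (x_i\,dy_i-y_i\,dx_i)$ and the symplectic form $\omega=d\lambda=\sum_i dx_i\wedge dy_i$. A star-shaped domain is a compact set $X\subset\mathbb{R}^4$ with smooth boundary and with $0$ in its interior, such that the radial vector field is transverse to $\partial X$ and each ray from the origin meets $\partial X$ exactly once. Then $\lambda|_{\partial X}$ is a contact form on $\partial X\cong S^3$, with contact structure $\xi=\ker\lambda|_{\partial X}$, Reeb vector field $R$ (determined by $\lambda(R)=1$ and $\omega(R,\cdot)|_{T\partial X}=0$) and volume $\mathrm{Vol}(\partial X,\lambda)=\int_{\partial X}\lambda\wedge d\lambda$. For a global symplectic trivialization $\tau$ of $(\xi,\omega)$, $y\in\partial X$ and $T\ge 0$, let $\rho(y,T,\tau)\in\mathbb{R}$ be the rotation number of the element of the universal cover of $\mathrm{Sp}(2)$ given by the path $t\in[0,T]\mapsto\Phi^\tau_{y,t}$ of the linearized Reeb flow on $\xi$ read in $\tau$, that is, the translation number of the induced lift to $\mathbb{R}$ of a homeomorphism of the circle of directions $\mathbb{R}/\mathbb{Z}$.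 Put $\mathrm{rot}(y)=\lim_{T\to+\infty}\rho(y,T,\tau)/T$, which exists for almost every $y$ and does not depend on $\tau$, and $$\mathrm{Ru}(X)=\int_{\partial X}\mathrm{rot}\;\lambda\wedge d\lambda,\qquad \mathrm{ru}(X)=\frac{\mathrm{Ru}(X)}{\mathrm{Vol}(\partial X,\lambda)^{1/2}},\qquad \mathrm{sys}(X)=\frac{T_{\min}(X)^2}{\mathrm{Vol}(\partial X,\lambda)},$$ where $T_{\min}(X)$ is the minimal period of a closed Reeb orbit on $\partial X$. **Proposition.** Let $X$ and $X'$ be star-shaped domains in $\mathbb{R}^4$. If $X$ and $X'$ are symplectomorphic, i.e. there is a diffeomorphism $\varphi:X\to X'$ of manifolds with boundary such that $\varphi^*\omega=\omega$ (for instance the restriction of a symplectomorphism of $\mathbb{R}^4$ that maps $X$ onto $X'$), then $$\mathrm{ru}(X)=\mathrm{ru}(X')\qquad\text{and}\qquad \mathrm{sys}(X)=\mathrm{sys}(X').$$ -/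

import Mathlib

open scoped ContDiff Topology

noncomputable section

namespace StarShaped

/-- `ℝ⁴` with its Euclidean structure; the coordinates are `(x₁, y₁, x₂, y₂)`. -/
abbrev R4 := EuclideanSpace ℝ (Fin 4)

/-- The standard primitive `λ = ½ ∑ (xᵢ dyᵢ - yᵢ dxᵢ)` at the point `p`, applied to `v`. -/
def lam (p v : R4) : ℝ :=
  (p 0 * v 1 - p 1 * v 0 + (p 2 * v 3 - p 3 * v 2)) / 2

/-- The standard symplectic form `ω = dλ = ∑ dxᵢ ∧ dyᵢ`. -/
def omega (u v : R4) : ℝ :=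
  u 0 * v 1 - u 1 * v 0 + (u 2 * v 3 - u 3 * v 2)

/-- The 3-form `λ ∧ dλ` at the point `p`. -/
def lamWedgeDLam (p a b c : R4) : ℝ :=
  lam p a * omega b c + lam p b * omega c a + lam p c * omega a b

/-- Tangent vectors at `p` to a subset `Y`: velocities at time `0` of curves in `Y` through `p`.
For a smooth hypersurface this is its tangent space at `p`. -/
def tangentVectors (Y : Set R4) (p : R4) : Set R4 :=
  {v | ∃ c : ℝ → R4, (∀ s, c s ∈ Y) ∧ c 0 = p ∧ HasDerivAt c v 0}

/-- Near each boundary point `X` is the sublevel set `{F ≤ 0}` of a smooth function whose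
differential does not vanish at that point. -/
def HasSmoothBoundary (X : Set R4) : Prop :=
  ∀ p ∈ frontier X, ∃ (U : Set R4) (F : R4 → ℝ), IsOpen U ∧ p ∈ U ∧ ContDiffOn ℝ ∞ F U ∧
    fderiv ℝ F p ≠ 0 ∧ X ∩ U = {x | x ∈ U ∧ F x ≤ 0}

/-- Star-shaped domains: compact, with smooth boundary, containing a neighbourhood of the origin,
such that the radial vector field (whose value at `p` is `p`) is transverse to the boundary and
each ray from the origin meets the boundary exactly once. -/
structure IsStarShapedDomain (X : Set R4) : Prop where
  isCompact : IsCompact X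
  zero_mem_interior : (0 : R4) ∈ interior X
  smoothBoundary : HasSmoothBoundary X
  radial_transverse : ∀ p ∈ frontier X, p ∉ tangentVectors (frontier X) p
  ray_meets_once : ∀ v : R4, v ≠ 0 → ∃! t : ℝ, 0 < t ∧ t • v ∈ frontier X

/-- `X` and `X'` are symplectomorphic as symplectic manifolds with boundary: there is a bijection
`X → X'`, smooth up to the boundary together with its inverse, that preserves `ω`. -/
def Symplectomorphic (X X' : Set R4) : Prop :=
  ∃ φ ψ : R4 → R4, Set.MapsTo φ X X' ∧ Set.MapsTo ψ X' X ∧ Set.InvOn ψ φ X X' ∧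
    ContDiffOn ℝ ∞ φ X ∧ ContDiffOn ℝ ∞ ψ X' ∧
    ∀ x ∈ X, ∀ u v : R4,
      omega (fderivWithin ℝ φ X x u) (fderivWithin ℝ φ X x v) = omega u v

/-! ### Reeb dynamics on `(∂X, λ|_∂X)` -/

/-- `v` is the value at `y` of the Reeb vector field of `(∂X, λ)`. -/
def IsReebVector (X : Set R4) (y v : R4) : Prop :=
  v ∈ tangentVectors (frontier X) y ∧ lam y v = 1 ∧
    ∀ w ∈ tangentVectors (frontier X) y, omega v w = 0

/-- Integral curves in `∂X` of the Reeb vector field, defined for all times. -/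
def IsReebTrajectory (X : Set R4) (γ : ℝ → R4) : Prop :=
  ∀ t, γ t ∈ frontier X ∧ ∃ v, IsReebVector X (γ t) v ∧ HasDerivAt γ v t

open Classical in
/-- The Reeb flow: `reebFlow X t y` is the value at time `t` of the Reeb trajectory that starts at
`y ∈ ∂X`. -/
def reebFlow (X : Set R4) (t : ℝ) (y : R4) : R4 :=
  if h : ∃ γ, IsReebTrajectory X γ ∧ γ 0 = y then h.choose t else y

/-- The minimal period of a closed Reeb orbit. -/
def minPeriod (X : Set R4) : ℝ :=
  sInf {T : ℝ | 0 < T ∧ ∃ γ, IsReebTrajectory X γ ∧ Function.Periodic γ T}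

/-- The contact plane `ξ_y = ker λ ∩ T_y ∂X`. -/
def contactPlane (X : Set R4) (y : R4) : Set R4 :=
  {v | v ∈ tangentVectors (frontier X) y ∧ lam y v = 0}

/-- A global trivialization of the symplectic plane bundle `(ξ, ω)` over `∂X`, given by a
continuous symplectic frame. -/
structure IsTrivialization (X : Set R4) (e₁ e₂ : R4 → R4) : Prop where
  continuousOn_fst : ContinuousOn e₁ (frontier X)
  continuousOn_snd : ContinuousOn e₂ (frontier X)
  fst_mem : ∀ y ∈ frontier X, e₁ y ∈ contactPlane X y
  snd_mem : ∀ y ∈ frontier X, e₂ y ∈ contactPlane X y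
  omega_eq_one : ∀ y ∈ frontier X, omega (e₁ y) (e₂ y) = 1

/-- The differential at `y` of the time-`t` Reeb flow `∂X → ∂X`. (The derivative within `∂X` is
uniquely determined on vectors tangent to `∂X`, and it is used only on these.) -/
def dReebFlow (X : Set R4) (t : ℝ) (y v : R4) : R4 :=
  fderivWithin ℝ (reebFlow X t) (frontier X) y v

/-- The linearized Reeb flow `ξ_y → ξ_{φᵗ(y)}` as a matrix with respect to a symplectic frame: a
vector `w ∈ ξ` is `ω(w, e₂) e₁ + ω(e₁, w) e₂`. -/
def linearizedFlow (X : Set R4) (e₁ e₂ : R4 → R4) (y : R4) (t : ℝ) :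
    Matrix (Fin 2) (Fin 2) ℝ :=
  !![omega (dReebFlow X t y (e₁ y)) (e₂ (reebFlow X t y)),
      omega (dReebFlow X t y (e₂ y)) (e₂ (reebFlow X t y));
    omega (e₁ (reebFlow X t y)) (dReebFlow X t y (e₁ y)),
      omega (e₁ (reebFlow X t y)) (dReebFlow X t y (e₂ y))]

/-! ### The rotation number on the universal cover of `Sp(2)` -/

/-- The unit vector at angle `2πs`. -/
def dir (s : ℝ) : Fin 2 → ℝ :=
  ![Real.cos (2 * Real.pi * s), Real.sin (2 * Real.pi * s)]

/-- `f` is the lift to `ℝ` of the action of `A T` on the circle of directions that is determined by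
the path `A` on `[0, T]`: following the direction `dir s` along the path continuously moves the
angle (in turns) from `s` to `f s`. -/
def IsLiftOfPath (A : ℝ → Matrix (Fin 2) (Fin 2) ℝ) (T : ℝ) (f : CircleDeg1Lift) : Prop :=
  ∀ s : ℝ, ∃ θ : ℝ → ℝ, ContinuousOn θ (Set.Icc 0 T) ∧ θ 0 = s ∧ θ T = f s ∧
    ∀ t ∈ Set.Icc 0 T, ∃ r : ℝ, 0 < r ∧ (A t).mulVec (dir s) = r • dir (θ t)

open Classical in
/-- The rotation number of the element of the universal cover of `Sp(2)` represented by the path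
`A` on `[0, T]`: the translation number of the induced lift of a circle homeomorphism. -/
def rotationNumber (A : ℝ → Matrix (Fin 2) (Fin 2) ℝ) (T : ℝ) : ℝ :=
  if h : ∃ f : CircleDeg1Lift, IsLiftOfPath A T f then h.choose.translationNumber else 0

/-- `r = lim ρ(y, T, τ) / T` as `T → ∞`, whatever the global trivialization `τ` of `ξ`. -/
def HasRot (X : Set R4) (y : R4) (r : ℝ) : Prop :=
  (∃ e₁ e₂, IsTrivialization X e₁ e₂) ∧
    ∀ e₁ e₂, IsTrivialization X e₁ e₂ →
      Filter.Tendsto (fun T : ℝ => rotationNumber (linearizedFlow X e₁ e₂ y) T / T)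
        Filter.atTop (𝓝 r)

open Classical in
/-- The function `rot` on `∂X` (the limit that defines it exists almost everywhere; elsewhere the
value is `0`). -/
def rot (X : Set R4) (y : R4) : ℝ :=
  if h : ∃ r, HasRot X y r then h.choose else 0

/-! ### Integration over `∂X` -/

/-- Multiplication by the quaternion units `i`, `j`, `k` on `ℝ⁴ = ℂ² = ℍ`. At a point `u` of the
unit sphere, `(iu, ju, ku)` is a positively oriented orthonormal basis of the tangent space. -/
def quatI (u : R4) : R4 := !₂[-u 1, u 0, -u 3, u 2]

/-- See `quatI`. -/
def quatJ (u : R4) : R4 := !₂[-u 2, u 3, u 0, -u 1]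

/-- See `quatI`. -/
def quatK (u : R4) : R4 := !₂[-u 3, -u 2, u 1, u 0]

/-- The radial projection `ℝ⁴ ∖ 0 → ∂X`; on the unit sphere it is an orientation preserving
diffeomorphism onto `∂X`. -/
def radialProj (X : Set R4) (x : R4) : R4 := (gauge X x)⁻¹ • x

/-- The integral `∫_∂X f λ ∧ dλ`, as the integral over the unit sphere of the pullback of the
3-form `f λ ∧ dλ` under the radial diffeomorphism. -/
def integralBoundary (X : Set R4) (f : R4 → ℝ) : ℝ :=
  ∫ u : Metric.sphere (0 : R4) 1,
    f (radialProj X u) *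
      lamWedgeDLam (radialProj X u)
        (fderiv ℝ (radialProj X) u (quatI u))
        (fderiv ℝ (radialProj X) u (quatJ u))
        (fderiv ℝ (radialProj X) u (quatK u))
    ∂(MeasureTheory.volume : MeasureTheory.Measure R4).toSphere

/-- `Vol(∂X, λ) = ∫_∂X λ ∧ dλ`. -/
def contactVolume (X : Set R4) : ℝ := integralBoundary X fun _ => 1

/-- The Ruelle invariant `Ru(X) = ∫_∂X rot λ ∧ dλ`. -/
def ruelleInvariant (X : Set R4) : ℝ := integralBoundary X (rot X)

/-- The Ruelle ratio `ru(X) = Ru(X) / Vol(∂X, λ)^{1/2}`. -/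
def ruelleRatio (X : Set R4) : ℝ := ruelleInvariant X / √(contactVolume X)

/-- The systolic ratio `sys(X) = (minimal period of a Reeb orbit)² / Vol(∂X, λ)`. -/
def systolicRatio (X : Set R4) : ℝ := minPeriod X ^ 2 / contactVolume X

end StarShaped

end

open scoped ContDiff Topology
open Set Metric

/-! ### Grönwall estimates on a two-sided time interval. -/

section Gronwall

variable {F : Type*} [NormedAddCommGroup F] [NormedSpace ℝ F]

/-! A symplectomorphism `φ : X → X'` need not preserve `λ`, but it can be corrected on the boundary
to a map that does; such a strict contactomorphism transports every quantity in the statement.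

Let `H`, `H'` be the gauges of `X`, `X'`. They are positively homogeneous and smooth off the origin,
`∂X = {H = 1}`, and the Reeb vector field is the restriction of the Hamiltonian vector field of
`H²`, which is homogeneous of degree 1. Strict contactomorphisms `∂X → ∂X'` are thus handled as
homogeneous symplectic maps `Ψ` of `ℝ⁴ ∖ 0` with `H' ∘ Ψ = H` (`IsHomSympl`).

To construct `Ψ`: the form `φ^*λ - λ` is closed on `X`, so by the Poincaré lemma on the cone
(`exists_primitive`) its restriction to `∂X` is `df`, with `f` extended homogeneously of degree 0.
Let `a` be the degree 1 extension of `φ|_∂X`. Since `λ = H² p^*λ` for the radial projection `p`, one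
gets `a^*λ = λ + H² df`, hence `a^*ω + df ∧ d(H²) = ω` (`exists_isTwistedSympl`). Flowing by the
Hamiltonian flow of `H'²` for the time `-f` contributes exactly the term `df ∧ d(H²)`, so `Ψ(x) =
flow'_{-f(x)}(a(x))` is symplectic (`IsTwistedSympl.isHomSympl`); the same construction for `φ⁻¹`
with twist `-f ∘ a⁻¹` inverts it.

Such a `Ψ` conjugates the Reeb flows, so closed orbits and their periods correspond. It carries
symplectic frames of `ξ` to symplectic frames, and in corresponding frames the matrices of the
linearized flows are equal, so `rot` is preserved pointwise. Finally the measure `λ ∧ dλ` of a set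
of directions is twice the Lebesgue volume of the part of `{H < 1}` in these directions; `Ψ`
preserves volume and maps sectors to sectors, so integrals over the boundary agree. Almost
everywhere existence of `rot` plays no role: the default values correspond as well.

The squared gauge is in general only `C^{1,1}` at the origin. The flow theory is therefore developed
for a globally Lipschitz field that is `C¹` on an invariant open set. -/

theorem HasDerivAt.reflect {f : ℝ → F} {f' : F} {s : ℝ} (h : HasDerivAt f f' (-s)) :
    HasDerivAt (fun t => f (-t)) (-f') s := by
  have := h.scomp s (hasDerivAt_neg s)
  rwa [neg_one_smul] at this

theorem norm_le_of_norm_deriv_le_of_nonneg {f f' : ℝ → F} {K δ ε T : ℝ} (hK : 0 ≤ K)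
    (hε : 0 ≤ ε) (hδ : 0 ≤ δ) (hf : ∀ s, HasDerivAt f (f' s) s) (h0 : ‖f 0‖ ≤ δ)
    (bound : ∀ s, |s| ≤ T → ‖f' s‖ ≤ K * ‖f s‖ + ε) {t : ℝ} (ht0 : 0 ≤ t) (ht : t ≤ T) :
    ‖f t‖ ≤ (δ + ε) * Real.exp ((K + 1) * T) := by
  have hcont : Continuous f := continuous_iff_continuousAt.2 fun s => (hf s).continuousAt
  -- Enlarging `K` to `K + 1` makes the constant nonzero, so that `gronwallBound` has its
  -- exponential form, and gives `ε / (K + 1) ≤ ε`.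
  have key := norm_le_gronwallBound_of_norm_deriv_right_le (f := f) (f' := f') (δ := δ)
    (K := K + 1) (ε := ε) (a := 0) (b := T) hcont.continuousOn
    (fun x _ => (hf x).hasDerivWithinAt) h0
    (fun x hx => (bound x (by rw [abs_of_nonneg hx.1]; exact hx.2.le)).trans
      (by nlinarith [norm_nonneg (f x)])) t ⟨ht0, ht⟩
  refine key.trans ?_
  have hmono := gronwallBound_mono hδ hε (by linarith : (0 : ℝ) ≤ K + 1)
    (show t - 0 ≤ T by linarith)
  refine hmono.trans ?_
  rw [gronwallBound_of_K_ne_0 (by linarith)]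
  have h1 : 1 ≤ Real.exp ((K + 1) * T) := Real.one_le_exp (mul_nonneg (by linarith) (by linarith))
  have h2 : ε / (K + 1) ≤ ε := div_le_self hε (by linarith)
  have h3 : ε / (K + 1) * (Real.exp ((K + 1) * T) - 1) ≤ ε * Real.exp ((K + 1) * T) :=
    mul_le_mul h2 (by linarith) (by linarith) hε
  show δ * Real.exp ((K + 1) * T) + _ ≤ _
  linarith

/-- A two-sided Grönwall inequality with a crude constant. -/
theorem norm_le_of_norm_deriv_le {f f' : ℝ → F} {K δ ε T : ℝ} (hK : 0 ≤ K)
    (hε : 0 ≤ ε) (hf : ∀ s, HasDerivAt f (f' s) s) (h0 : ‖f 0‖ ≤ δ)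
    (bound : ∀ s, |s| ≤ T → ‖f' s‖ ≤ K * ‖f s‖ + ε) {t : ℝ} (ht : |t| ≤ T) :
    ‖f t‖ ≤ (δ + ε) * Real.exp ((K + 1) * T) := by
  have hδ : 0 ≤ δ := (norm_nonneg _).trans h0
  rcases le_total 0 t with h | h
  · exact norm_le_of_norm_deriv_le_of_nonneg hK hε hδ hf h0 bound h ((le_abs_self t).trans ht)
  · have := norm_le_of_norm_deriv_le_of_nonneg (f := fun s => f (-s)) (f' := fun s => -f' (-s))
      (T := T) (t := -t) hK hε hδ
      (fun s => (hf (-s)).reflect) (by simpa using h0)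
      (fun s hs => by simpa using bound (-s) (by simpa using hs)) (by linarith)
      ((neg_le_abs t).trans ht)
    simpa using this

end Gronwall

/-! ### Global existence for Lipschitz differential equations. -/

section GlobalExistence

variable {E : Type*} [NormedAddCommGroup E] [NormedSpace ℝ E]

/-- The radial retraction onto the closed ball of radius `R`. -/
noncomputable def radialRetraction (R : ℝ) (x : E) : E := (R / max R ‖x‖) • x

theorem radialRetraction_of_norm_le {R : ℝ} (hR : 0 < R) {x : E} (hx : ‖x‖ ≤ R) :
    radialRetraction R x = x := by
  rw [radialRetraction, max_eq_left hx, div_self hR.ne', one_smul]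

theorem norm_radialRetraction_le {R : ℝ} (hR : 0 < R) (x : E) :
    ‖radialRetraction R x‖ ≤ R := by
  have hm : 0 < max R ‖x‖ := lt_max_of_lt_left hR
  rw [radialRetraction, norm_smul, Real.norm_of_nonneg (by positivity), div_mul_eq_mul_div,
    div_le_iff₀ hm]
  gcongr
  exact le_max_right _ _

theorem norm_radialRetraction_le_norm {R : ℝ} (hR : 0 < R) (x : E) :
    ‖radialRetraction R x‖ ≤ ‖x‖ := by
  have hm : 0 < max R ‖x‖ := lt_max_of_lt_left hR
  rw [radialRetraction, norm_smul, Real.norm_of_nonneg (by positivity)]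
  exact mul_le_of_le_one_left (norm_nonneg _) ((div_le_one hm).2 (le_max_left _ _))

theorem lipschitzWith_radialRetraction {R : ℝ} (hR : 0 < R) :
    LipschitzWith 2 (radialRetraction R : E → E) := by
  refine LipschitzWith.of_dist_le_mul fun x y => ?_
  have hx : 0 < max R ‖x‖ := lt_max_of_lt_left hR
  have hy : 0 < max R ‖y‖ := lt_max_of_lt_left hR
  have e : radialRetraction R x - radialRetraction R y =
      (R / max R ‖x‖) • (x - y) + (R / max R ‖x‖ - R / max R ‖y‖) • y := by
    simp only [radialRetraction, smul_sub, sub_smul]; abel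
  rw [dist_eq_norm, dist_eq_norm, e]
  have h1 : ‖(R / max R ‖x‖) • (x - y)‖ ≤ ‖x - y‖ := by
    rw [norm_smul, Real.norm_of_nonneg (by positivity)]
    exact mul_le_of_le_one_left (norm_nonneg _) ((div_le_one hx).2 (le_max_left _ _))
  have h2 : ‖(R / max R ‖x‖ - R / max R ‖y‖) • y‖ ≤ ‖x - y‖ := by
    have e2 : R / max R ‖x‖ - R / max R ‖y‖ =
        (R / max R ‖x‖) * ((max R ‖y‖ - max R ‖x‖) / max R ‖y‖) := by
      field_simp
    have h3 : |max R ‖y‖ - max R ‖x‖| ≤ ‖x - y‖ := by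
      refine (abs_max_sub_max_le_max R ‖y‖ R ‖x‖).trans ?_
      rw [sub_self, abs_zero, max_eq_right (abs_nonneg _), norm_sub_rev]
      exact abs_norm_sub_norm_le y x
    rw [norm_smul, e2, Real.norm_eq_abs, abs_mul, abs_div _ (max R ‖y‖), abs_of_pos hy,
      abs_of_nonneg (show 0 ≤ R / max R ‖x‖ by positivity)]
    have h4 : R / max R ‖x‖ ≤ 1 := (div_le_one hx).2 (le_max_left _ _)
    have h5 : ‖y‖ / max R ‖y‖ ≤ 1 := (div_le_one hy).2 (le_max_right _ _)
    calc R / max R ‖x‖ * (|max R ‖y‖ - max R ‖x‖| / max R ‖y‖) * ‖y‖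
        = (R / max R ‖x‖) * (|max R ‖y‖ - max R ‖x‖| * (‖y‖ / max R ‖y‖)) := by ring
      _ ≤ 1 * (|max R ‖y‖ - max R ‖x‖| * 1) := by gcongr
      _ ≤ ‖x - y‖ := by simpa using h3
  calc _ ≤ ‖x - y‖ + ‖x - y‖ := (norm_add_le _ _).trans (add_le_add h1 h2)
    _ = _ := by push_cast; ring

variable [CompleteSpace E]

/-- A globally Lipschitz ODE has a solution on every bounded interval. -/
theorem exists_integralCurve_Ioo {v : ℝ → E → E} {K : NNReal}
    (hv : ∀ t, LipschitzWith K (v t)) (hc : ∀ x, Continuous fun t => v t x) (x₀ : E) {T : ℝ}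
    (hT : 0 < T) :
    ∃ γ : ℝ → E, γ 0 = x₀ ∧ ∀ t ∈ Ioo (-T) T, HasDerivAt γ (v t (γ t)) t := by
  obtain ⟨B, hB⟩ : ∃ B, ∀ t ∈ Icc (-T) T, ‖v t 0‖ ≤ B :=
    isCompact_Icc.exists_bound_of_continuousOn (hc 0).continuousOn
  have hB0 : 0 ≤ B := (norm_nonneg _).trans (hB 0 ⟨by linarith, hT.le⟩)
  have hgrow : ∀ t ∈ Icc (-T) T, ∀ x, ‖v t x‖ ≤ K * ‖x‖ + B := fun t ht x => by
    have h1 := (hv t).dist_le_mul x 0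
    rw [dist_eq_norm, dist_zero_right] at h1
    have h2 := norm_le_norm_add_norm_sub (v t 0) (v t x)
    linarith [hB t ht, norm_sub_rev (v t 0) (v t x), h2]
  -- `R` exceeds the a priori Grönwall bound for solutions on `[-T, T]`. Composing the field with
  -- the retraction onto the ball of radius `R` makes it bounded by `L`, so Picard–Lindelöf with
  -- radius `L * T` covers the whole interval at once. By Grönwall the solution stays in that ball,
  -- where the retraction is the identity.
  set R : ℝ := (‖x₀‖ + B) * Real.exp ((K + 1) * T) + 1 with hRdef
  have hR : 0 < R := by positivity
  set L : NNReal := ⟨K * R + B, by positivity⟩ with hL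
  set w : ℝ → E → E := fun t x => v t (radialRetraction R x) with hw
  have hwb : ∀ t ∈ Icc (-T) T, ∀ x, ‖w t x‖ ≤ L := fun t ht x =>
    (hgrow t ht _).trans (by
      show _ ≤ (K : ℝ) * R + B
      gcongr
      exact norm_radialRetraction_le hR x)
  have hPL : IsPicardLindelof w (tmin := -T) (tmax := T) ⟨0, by constructor <;> linarith⟩ x₀
      (L * ⟨T, hT.le⟩) 0 L (K * 2) := by
    refine ⟨fun t _ => ((hv t).comp (lipschitzWith_radialRetraction hR)).lipschitzOnWith,
      fun x _ => (hc _).continuousOn, fun t ht x _ => hwb t ht x, ?_⟩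
    simp only [sub_zero, zero_sub, neg_neg, max_self, NNReal.coe_zero]
    exact le_rfl
  obtain ⟨α, hα0, hα⟩ := hPL.exists_eq_forall_mem_Icc_hasDerivWithinAt₀
  replace hα0 : α 0 = x₀ := hα0
  have hαc : ContinuousOn α (Icc (-T) T) := fun t ht => (hα t ht).continuousWithinAt
  have hα' : ∀ t ∈ Ioo (-T) T, HasDerivAt α (w t (α t)) t := fun t ht =>
    (hα t ⟨ht.1.le, ht.2.le⟩).hasDerivAt (Icc_mem_nhds ht.1 ht.2)
  have hwgrow : ∀ t ∈ Icc (-T) T, ∀ x, ‖w t x‖ ≤ (K + 1) * ‖x‖ + B := fun t ht x =>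
    (hgrow t ht _).trans (by
      have := norm_radialRetraction_le_norm hR x
      have hK := K.2
      have := mul_le_mul_of_nonneg_left this hK
      have := norm_nonneg x
      simp only [NNReal.val_eq_coe] at *
      linarith)
  have hbound : ∀ s : ℝ, 0 ≤ s → s ≤ T →
      gronwallBound ‖x₀‖ (K + 1) B s ≤ (‖x₀‖ + B) * Real.exp ((K + 1) * T) := fun s hs hsT => by
    have hK := K.2
    simp only [NNReal.val_eq_coe] at hK
    refine (gronwallBound_mono (norm_nonneg _) hB0 (by linarith) hsT).trans ?_
    rw [gronwallBound_of_K_ne_0 (by linarith)]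
    have h1 : 1 ≤ Real.exp ((K + 1) * T) := Real.one_le_exp (by positivity)
    have h2 : B / (K + 1) ≤ B := div_le_self hB0 (by linarith)
    have h3 : B / (K + 1) * (Real.exp ((K + 1) * T) - 1) ≤ B * Real.exp ((K + 1) * T) :=
      mul_le_mul h2 (by linarith) (by linarith) hB0
    show ‖x₀‖ * Real.exp ((K + 1) * T) + _ ≤ _
    linarith
  have hpos : ∀ t ∈ Icc 0 T, ‖α t‖ ≤ R := fun t ht => by
    have := norm_le_gronwallBound_of_norm_deriv_right_le (f := α) (f' := fun t => w t (α t))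
      (δ := ‖x₀‖) (K := K + 1) (ε := B) (a := 0) (b := T)
      (hαc.mono (Icc_subset_Icc (by linarith) le_rfl))
      (fun s hs => (hα' s ⟨by linarith [hs.1], hs.2⟩).hasDerivWithinAt) (by rw [hα0])
      (fun s hs => hwgrow s ⟨by linarith [hs.1], hs.2.le⟩ _) t ht
    have h2 := hbound (t - 0) (by linarith [ht.1]) (by linarith [ht.2])
    linarith
  have hneg : ∀ t ∈ Icc 0 T, ‖α (-t)‖ ≤ R := fun t ht => by
    have := norm_le_gronwallBound_of_norm_deriv_right_le (f := fun s => α (-s))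
      (f' := fun t => -w (-t) (α (-t)))
      (δ := ‖x₀‖) (K := K + 1) (ε := B) (a := 0) (b := T)
      (hαc.comp continuous_neg.continuousOn (fun s hs => ⟨by linarith [hs.2], by linarith [hs.1]⟩))
      (fun s hs =>
        (hα' (-s) ⟨by linarith [hs.2], by linarith [hs.1]⟩).reflect.hasDerivWithinAt) (by simp [hα0])
      (fun s hs => by
        rw [norm_neg]; exact hwgrow (-s) ⟨by linarith [hs.2], by linarith [hs.1]⟩ _) t ht
    have h2 := hbound (t - 0) (by linarith [ht.1]) (by linarith [ht.2])
    linarith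
  refine ⟨α, hα0, fun t ht => ?_⟩
  have hn : ‖α t‖ ≤ R := by
    rcases le_total 0 t with h | h
    · exact hpos t ⟨h, ht.2.le⟩
    · simpa using hneg (-t) ⟨by linarith, by linarith [ht.1]⟩
  have := hα' t ht
  simpa only [hw, radialRetraction_of_norm_le hR hn] using this

/-- A globally Lipschitz ODE has a solution for all times. -/
theorem exists_integralCurve {v : ℝ → E → E} {K : NNReal}
    (hv : ∀ t, LipschitzWith K (v t)) (hc : ∀ x, Continuous fun t => v t x) (x₀ : E) :
    ∃ γ : ℝ → E, γ 0 = x₀ ∧ ∀ t, HasDerivAt γ (v t (γ t)) t := by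
  have hpos : ∀ n : ℕ, (0 : ℝ) < n + 1 := fun n => by positivity
  choose γ h0 hγ using fun n : ℕ => exists_integralCurve_Ioo hv hc x₀ (hpos n)
  have hagree : ∀ m n : ℕ, m ≤ n → EqOn (γ m) (γ n) (Ioo (-((m : ℝ) + 1)) (m + 1)) := by
    intro m n hmn
    have hmn' : (m : ℝ) ≤ n := by exact_mod_cast hmn
    refine ODE_solution_unique_of_mem_Ioo (v := v) (s := fun _ => univ) (K := K) (t₀ := 0)
      (fun t _ => (hv t).lipschitzOnWith) ⟨by linarith [hpos m], hpos m⟩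
      (fun t ht => ⟨hγ m t ht, mem_univ _⟩)
      (fun t ht => ⟨hγ n t ⟨by linarith [ht.1], by linarith [ht.2]⟩, mem_univ _⟩)
      ((h0 m).trans (h0 n).symm)
  have hmem : ∀ t : ℝ, t ∈ Ioo (-((⌈|t|⌉₊ : ℝ) + 1)) (⌈|t|⌉₊ + 1) := fun t => by
    have := Nat.le_ceil |t|
    exact ⟨by linarith [neg_abs_le t], by linarith [le_abs_self t]⟩
  have heq : ∀ (n : ℕ) (t : ℝ), t ∈ Ioo (-((n : ℝ) + 1)) (n + 1) → γ ⌈|t|⌉₊ t = γ n t := by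
    intro n t ht
    rcases le_total n ⌈|t|⌉₊ with h | h
    · exact (hagree _ _ h ht).symm
    · exact hagree _ _ h (hmem t)
  -- Solutions on nested intervals agree by uniqueness. The interval of index `⌈|t|⌉₊` has
  -- half-length `⌈|t|⌉₊ + 1`, so it is a neighbourhood of `t`.
  refine ⟨fun t => γ ⌈|t|⌉₊ t, by simpa using h0 0, fun t => ?_⟩
  refine (hγ _ t (hmem t)).congr_of_eventuallyEq ?_
  filter_upwards [Ioo_mem_nhds (hmem t).1 (hmem t).2] with s hs
  exact heq _ s hs

end GlobalExistence

/-! ### Flows of Lipschitz fields and their `C¹` dependence on the initial point. -/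

section Flow

variable {E : Type*} [NormedAddCommGroup E] [NormedSpace ℝ E]

/-- `Φ` is a global flow of the autonomous vector field `v`. -/
structure IsFlowOf (v : E → E) (Φ : ℝ → E → E) : Prop where
  map_zero : ∀ x, Φ 0 x = x
  hasDerivAt : ∀ x t, HasDerivAt (fun s => Φ s x) (v (Φ t x)) t

theorem exists_isFlowOf [CompleteSpace E] {v : E → E} {K : NNReal} (hv : LipschitzWith K v) :
    ∃ Φ, IsFlowOf v Φ := by
  choose γ h0 hγ using fun x : E =>
    exists_integralCurve (v := fun _ => v) (fun _ => hv) (fun _ => continuous_const) x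
  exact ⟨fun t x => γ x t, h0, hγ⟩

namespace IsFlowOf

variable {v : E → E} {Φ : ℝ → E → E} {K : NNReal} {U : Set E}

/-- Uniqueness of solutions. The group law, the homogeneity of the Hamiltonian flow and the
conjugacy of Reeb flows are all obtained by recognizing a curve as an integral curve. -/
theorem eq_of_hasDerivAt (hΦ : IsFlowOf v Φ) (hv : LipschitzWith K v) {γ : ℝ → E}
    (hγ : ∀ t, HasDerivAt γ (v (γ t)) t) (t : ℝ) : γ t = Φ t (γ 0) := by
  have : γ = fun t => Φ t (γ 0) := ODE_solution_unique_univ (v := fun _ => v) (s := fun _ => univ)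
    (t₀ := 0) (fun _ => hv.lipschitzOnWith) (fun t => ⟨hγ t, mem_univ _⟩)
    (fun t => ⟨hΦ.hasDerivAt _ t, mem_univ _⟩) (hΦ.map_zero _).symm
  exact congrFun this t

theorem map_add (hΦ : IsFlowOf v Φ) (hv : LipschitzWith K v) (s t : ℝ) (x : E) :
    Φ (s + t) x = Φ s (Φ t x) := by
  have := hΦ.eq_of_hasDerivAt hv (γ := fun s => Φ (s + t) x)
    (fun s => (hΦ.hasDerivAt x (s + t)).comp_add_const s t) s
  simpa using this

theorem map_neg_map (hΦ : IsFlowOf v Φ) (hv : LipschitzWith K v) (t : ℝ) (x : E) :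
    Φ (-t) (Φ t x) = x := by
  rw [← hΦ.map_add hv, neg_add_cancel, hΦ.map_zero]

theorem map_map_neg (hΦ : IsFlowOf v Φ) (hv : LipschitzWith K v) (t : ℝ) (x : E) :
    Φ t (Φ (-t) x) = x := by
  rw [← hΦ.map_add hv, add_neg_cancel, hΦ.map_zero]

theorem norm_sub_le (hΦ : IsFlowOf v Φ) (hv : LipschitzWith K v) {t T : ℝ} (ht : |t| ≤ T)
    (x y : E) : ‖Φ t x - Φ t y‖ ≤ ‖x - y‖ * Real.exp ((K + 1) * T) := by
  have := norm_le_of_norm_deriv_le (f := fun s => Φ s x - Φ s y)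
    (f' := fun s => v (Φ s x) - v (Φ s y)) (δ := ‖x - y‖) (ε := 0) (T := T) K.2 le_rfl
    (fun s => (hΦ.hasDerivAt x s).sub (hΦ.hasDerivAt y s))
    (by simp [hΦ.map_zero]) (fun s _ => by
      rw [add_zero]; exact hv.norm_sub_le _ _) ht
  simpa using this

theorem continuous_time (hΦ : IsFlowOf v Φ) (x : E) : Continuous fun t => Φ t x :=
  continuous_iff_continuousAt.2 fun t => (hΦ.hasDerivAt x t).continuousAt

theorem continuous (hΦ : IsFlowOf v Φ) (hv : LipschitzWith K v) :
    Continuous fun p : ℝ × E => Φ p.1 p.2 := by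
  rw [continuous_iff_continuousAt]
  rintro ⟨t, x⟩
  rw [ContinuousAt, tendsto_iff_norm_sub_tendsto_zero]
  have h1 : Filter.Tendsto (fun p : ℝ × E => ‖p.2 - x‖ * Real.exp ((K + 1) * (|t| + 1)) +
      ‖Φ p.1 x - Φ t x‖) (𝓝 (t, x)) (𝓝 0) := by
    have hc : Continuous (fun p : ℝ × E => ‖p.2 - x‖ * Real.exp ((K + 1) * (|t| + 1)) +
      ‖Φ p.1 x - Φ t x‖) := by
      have := hΦ.continuous_time x
      fun_prop
    simpa using hc.tendsto (t, x)
  refine squeeze_zero' (.of_forall fun _ => norm_nonneg _) ?_ h1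
  have hn : ∀ᶠ p : ℝ × E in 𝓝 (t, x), |p.1| < |t| + 1 :=
    (continuous_abs.comp continuous_fst).tendsto (t, x) |>.eventually_lt_const
      (by simp)
  filter_upwards [hn] with p hp
  calc ‖Φ p.1 p.2 - Φ t x‖ ≤ ‖Φ p.1 p.2 - Φ p.1 x‖ + ‖Φ p.1 x - Φ t x‖ :=
        norm_sub_le_norm_sub_add_norm_sub _ _ _
    _ ≤ _ := by gcongr; exact hΦ.norm_sub_le hv hp.le _ _

/-- Along a compact set, a `C¹` map is uniformly approximated by its differentials. -/
theorem _root_.IsCompact.exists_norm_sub_sub_fderiv_le {F : Type*} [NormedAddCommGroup F]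
    [NormedSpace ℝ F] {f : E → F} (hU : IsOpen U)
    (hf : ContDiffOn ℝ 1 f U) {C : Set E} (hC : IsCompact C) (hCU : C ⊆ U) {ε : ℝ} (hε : 0 < ε) :
    ∃ δ > 0, ∀ p ∈ C, ∀ q, ‖q - p‖ < δ → q ∈ U ∧ ‖fderiv ℝ f q - fderiv ℝ f p‖ ≤ ε ∧
      ‖f q - f p - fderiv ℝ f p (q - p)‖ ≤ ε * ‖q - p‖ := by
  have hdc : ∀ p ∈ C, ContinuousAt (fderiv ℝ f) p := fun p hp =>
    (hf.continuousOn_fderiv_of_isOpen hU le_rfl).continuousAt (hU.mem_nhds (hCU hp))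
  have h1 := hC.uniformContinuousAt_of_continuousAt (fderiv ℝ f) hdc (Metric.dist_mem_uniformity hε)
  obtain ⟨δ₁, hδ₁, h1⟩ := Metric.mem_uniformity_dist.1 h1
  obtain ⟨δ₂, hδ₂, h2⟩ := hC.exists_thickening_subset_open hU hCU
  have hUq : ∀ p ∈ C, ∀ q, ‖q - p‖ < min δ₁ δ₂ → q ∈ U := fun p hp q hq =>
    h2 (mem_thickening_iff.2 ⟨p, hp, by rw [dist_eq_norm]; exact hq.trans_le (min_le_right _ _)⟩)
  have hd : ∀ p ∈ C, ∀ q, ‖q - p‖ < min δ₁ δ₂ → ‖fderiv ℝ f q - fderiv ℝ f p‖ ≤ ε := by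
    intro p hp q hq
    have := h1 (a := p) (b := q) (by
      rw [dist_comm, dist_eq_norm]; exact hq.trans_le (min_le_left _ _)) hp
    have h3 : dist (fderiv ℝ f p) (fderiv ℝ f q) < ε := this
    rw [dist_comm, dist_eq_norm] at h3
    exact h3.le
  refine ⟨min δ₁ δ₂, lt_min hδ₁ hδ₂, fun p hp q hq => ⟨hUq p hp q hq, hd p hp q hq, ?_⟩⟩
  refine (convex_ball p (min δ₁ δ₂)).norm_image_sub_le_of_norm_hasFDerivWithin_le'
    (f' := fun z => fderiv ℝ f z) (fun z hz => ?_) (fun z hz => ?_)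
    (mem_ball_self (lt_min hδ₁ hδ₂)) (mem_ball_iff_norm.2 hq)
  · have hz' := hUq p hp z (mem_ball_iff_norm.1 hz)
    exact ((hf.differentiableOn one_ne_zero).differentiableAt
      (hU.mem_nhds hz')).hasFDerivAt.hasFDerivWithinAt
  · exact hd p hp z (mem_ball_iff_norm.1 hz)

theorem norm_fderiv_le (hΦ : IsFlowOf v Φ) (hv : LipschitzWith K v) {t T : ℝ} (ht : |t| ≤ T)
    (x : E) : ‖fderiv ℝ (Φ t) x‖ ≤ Real.exp ((K + 1) * T) := by
  have : LipschitzWith ⟨Real.exp ((K + 1) * T), (Real.exp_pos _).le⟩ (Φ t) :=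
    LipschitzWith.of_dist_le_mul fun y z => by
      rw [dist_eq_norm, dist_eq_norm, mul_comm]
      exact hΦ.norm_sub_le hv ht y z
  exact norm_fderiv_le_of_lipschitz ℝ this

/-- The error `Φ s y - Φ s x - M s (y - x)` vanishes at `s = 0` and solves the variational equation
up to the Taylor remainder of `v` along the compact orbit segment, which is at most `ε‖Φ s y - Φ s
x‖`. Grönwall makes the error small relative to `‖y - x‖`. -/
theorem hasFDerivAt_of_variational (hΦ : IsFlowOf v Φ) (hv : LipschitzWith K v) (hU : IsOpen U)
    (hvU : ContDiffOn ℝ 1 v U) (hinv : ∀ t, ∀ x ∈ U, Φ t x ∈ U) {x : E} (hx : x ∈ U)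
    {M : ℝ → E →L[ℝ] E} (hM0 : M 0 = .id ℝ E)
    (hM : ∀ t, HasDerivAt M (fderiv ℝ v (Φ t x) ∘L M t) t) (t : ℝ) :
    HasFDerivAt (Φ t) (M t) x := by
  set T := |t|
  set C := Real.exp ((K + 1) * T)
  have hC : 0 < C := Real.exp_pos _
  rw [hasFDerivAt_iff_isLittleO, Asymptotics.isLittleO_iff]
  intro c hc
  -- One factor `C` bounds the growth of `‖Φ s y - Φ s x‖`, the other comes from Grönwall applied to
  -- the error.
  set ε := c / (C * C)
  have hε : 0 < ε := by positivity
  have hcurve : IsCompact ((fun s => Φ s x) '' Icc (-T) T) :=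
    isCompact_Icc.image (hΦ.continuous_time x)
  obtain ⟨δ, hδ, happ⟩ := hcurve.exists_norm_sub_sub_fderiv_le hU hvU
    (by rintro _ ⟨s, -, rfl⟩; exact hinv s x hx) hε
  have hnear : ∀ᶠ y in 𝓝 x, ‖y - x‖ * C < δ := by
    have : Continuous fun y : E => ‖y - x‖ * C := by fun_prop
    exact this.tendsto x |>.eventually_lt_const (by simpa using hδ)
  filter_upwards [hnear] with y hy
  have key := norm_le_of_norm_deriv_le (f := fun s => Φ s y - Φ s x - M s (y - x))
    (f' := fun s => v (Φ s y) - v (Φ s x) - (fderiv ℝ v (Φ s x) ∘L M s) (y - x))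
    (K := K) (δ := 0) (ε := ε * (‖y - x‖ * C)) (T := T) (t := t) K.2 (by positivity)
    (fun s => ((hΦ.hasDerivAt y s).sub (hΦ.hasDerivAt x s)).sub
      ((hM s).clm_apply (hasDerivAt_const s (y - x)) |>.congr_deriv (by simp)))
    (by simp [hΦ.map_zero, hM0]) (fun s hs => ?_) le_rfl
  · calc _ ≤ _ := key
      _ = c * ‖y - x‖ := by simp only [ε]; field_simp; ring
  · have h1 : ‖Φ s y - Φ s x‖ ≤ ‖y - x‖ * C := hΦ.norm_sub_le hv hs y x
    have h2 := (happ (Φ s x) ⟨s, abs_le.1 hs, rfl⟩ (Φ s y) (h1.trans_lt hy)).2.2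
    have e : v (Φ s y) - v (Φ s x) - (fderiv ℝ v (Φ s x) ∘L M s) (y - x) =
        fderiv ℝ v (Φ s x) (Φ s y - Φ s x - M s (y - x)) +
        (v (Φ s y) - v (Φ s x) - fderiv ℝ v (Φ s x) (Φ s y - Φ s x)) := by
      simp only [map_sub, ContinuousLinearMap.comp_apply]; abel
    rw [e]
    refine (norm_add_le _ _).trans (add_le_add ?_ (h2.trans (by gcongr)))
    refine (ContinuousLinearMap.le_opNorm _ _).trans ?_
    gcongr
    exact norm_fderiv_le_of_lipschitz ℝ hv

variable [CompleteSpace E]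

/-- The variational equation is linear in `M` with coefficients bounded by `K`, hence globally
Lipschitz; invariance of `U` keeps the coefficients continuous in time. -/
theorem exists_variational (hΦ : IsFlowOf v Φ) (hv : LipschitzWith K v) (hU : IsOpen U)
    (hvU : ContDiffOn ℝ 1 v U) (hinv : ∀ t, ∀ x ∈ U, Φ t x ∈ U) :
    ∃ M : ℝ → E → E →L[ℝ] E, ∀ x ∈ U, M 0 x = .id ℝ E ∧
      ∀ t, HasDerivAt (fun s => M s x) (fderiv ℝ v (Φ t x) ∘L M t x) t := by
  have : ∀ x : E, ∃ M : ℝ → E →L[ℝ] E, x ∈ U → M 0 = .id ℝ E ∧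
      ∀ t, HasDerivAt M (fderiv ℝ v (Φ t x) ∘L M t) t := by
    intro x
    by_cases hx : x ∈ U
    · obtain ⟨M, h0, hM⟩ := exists_integralCurve (E := E →L[ℝ] E) (K := K)
        (v := fun t M => fderiv ℝ v (Φ t x) ∘L M)
        (fun t => LipschitzWith.of_dist_le_mul fun A B => by
          rw [dist_eq_norm, dist_eq_norm, ← ContinuousLinearMap.comp_sub]
          refine (ContinuousLinearMap.opNorm_comp_le _ _).trans ?_
          gcongr
          exact norm_fderiv_le_of_lipschitz ℝ hv)
        (fun A => by
          have h1 : Continuous fun t => fderiv ℝ v (Φ t x) :=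
            (hvU.continuousOn_fderiv_of_isOpen hU le_rfl).comp_continuous
              (hΦ.continuous_time x) (fun t => hinv t x hx)
          exact h1.clm_comp continuous_const)
        (.id ℝ E)
      exact ⟨M, fun _ => ⟨h0, hM⟩⟩
    · exact ⟨0, fun h => absurd h hx⟩
  choose M hM using this
  exact ⟨fun t x => M x t, fun x hx => hM x hx⟩

theorem hasFDerivAt (hΦ : IsFlowOf v Φ) (hv : LipschitzWith K v) (hU : IsOpen U)
    (hvU : ContDiffOn ℝ 1 v U) (hinv : ∀ t, ∀ x ∈ U, Φ t x ∈ U) {x : E} (hx : x ∈ U) (t : ℝ) :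
    HasFDerivAt (Φ t) (fderiv ℝ (Φ t) x) x := by
  obtain ⟨M, hM⟩ := hΦ.exists_variational hv hU hvU hinv
  exact (hΦ.hasFDerivAt_of_variational hv hU hvU hinv hx (hM x hx).1
    (hM x hx).2 t).differentiableAt.hasFDerivAt

/-- The differential of the flow solves the variational equation. -/
theorem hasDerivAt_fderiv (hΦ : IsFlowOf v Φ) (hv : LipschitzWith K v) (hU : IsOpen U)
    (hvU : ContDiffOn ℝ 1 v U) (hinv : ∀ t, ∀ x ∈ U, Φ t x ∈ U) {x : E} (hx : x ∈ U) (t : ℝ) :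
    HasDerivAt (fun s => fderiv ℝ (Φ s) x) (fderiv ℝ v (Φ t x) ∘L fderiv ℝ (Φ t) x) t := by
  obtain ⟨M, hM⟩ := hΦ.exists_variational hv hU hvU hinv
  have : (fun s => fderiv ℝ (Φ s) x) = fun s => M s x := funext fun s =>
    (hΦ.hasFDerivAt_of_variational hv hU hvU hinv hx (hM x hx).1 (hM x hx).2 s).fderiv
  rw [this, congrFun this t]
  exact (hM x hx).2 t

/-- The derivatives at two nearby points solve variational equations with nearly equal coefficients,
so Grönwall bounds their difference uniformly in time; continuity in time at the fixed point `x`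
does the rest. -/
theorem continuousAt_fderiv (hΦ : IsFlowOf v Φ) (hv : LipschitzWith K v) (hU : IsOpen U)
    (hvU : ContDiffOn ℝ 1 v U) (hinv : ∀ t, ∀ x ∈ U, Φ t x ∈ U) {x : E} (hx : x ∈ U) (t : ℝ) :
    ContinuousAt (fun p : ℝ × E => fderiv ℝ (Φ p.1) p.2) (t, x) := by
  set T := |t| + 1
  have hT : 0 ≤ T := by positivity
  set C := Real.exp ((K + 1) * T)
  have hC : 0 < C := Real.exp_pos _
  have hD0 : ∀ y : E, fderiv ℝ (Φ 0) y = .id ℝ E := fun y => by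
    have : Φ 0 = id := funext hΦ.map_zero
    rw [this, fderiv_id]
  rw [Metric.continuousAt_iff']
  intro c hc
  set ε := c / (4 * (C * C))
  have hε : 0 < ε := by positivity
  have hcurve : IsCompact ((fun s => Φ s x) '' Icc (-T) T) :=
    isCompact_Icc.image (hΦ.continuous_time x)
  obtain ⟨δ, hδ, happ⟩ := hcurve.exists_norm_sub_sub_fderiv_le hU hvU
    (by rintro _ ⟨s, -, rfl⟩; exact hinv s x hx) hε
  have hnear : ∀ᶠ p : ℝ × E in 𝓝 (t, x), ‖p.2 - x‖ * C < δ := by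
    have : Continuous fun p : ℝ × E => ‖p.2 - x‖ * C := by fun_prop
    exact this.tendsto (t, x) |>.eventually_lt_const (by simpa using hδ)
  have hUn : ∀ᶠ p : ℝ × E in 𝓝 (t, x), p.2 ∈ U :=
    continuous_snd.continuousAt.eventually (hU.mem_nhds hx)
  have htn : ∀ᶠ p : ℝ × E in 𝓝 (t, x), |p.1| < T :=
    (continuous_abs.comp continuous_fst).tendsto (t, x) |>.eventually_lt_const
      (by simp [T])
  have hct : ∀ᶠ p : ℝ × E in 𝓝 (t, x), dist (fderiv ℝ (Φ p.1) x) (fderiv ℝ (Φ t) x) < c / 2 := by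
    have : ContinuousAt (fun p : ℝ × E => fderiv ℝ (Φ p.1) x) (t, x) :=
      (hΦ.hasDerivAt_fderiv hv hU hvU hinv hx t).continuousAt.comp
        (f := fun p : ℝ × E => p.1) (x := (t, x)) continuousAt_fst
    exact Metric.continuousAt_iff'.1 this _ (by positivity)
  filter_upwards [hnear, hUn, htn, hct] with p hy hpU hpT hpc
  have key := norm_le_of_norm_deriv_le (f := fun s => fderiv ℝ (Φ s) p.2 - fderiv ℝ (Φ s) x)
    (f' := fun s => fderiv ℝ v (Φ s p.2) ∘L fderiv ℝ (Φ s) p.2 -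
      fderiv ℝ v (Φ s x) ∘L fderiv ℝ (Φ s) x)
    (K := K) (δ := 0) (ε := ε * C) (T := T) (t := p.1) K.2 (by positivity)
    (fun s => (hΦ.hasDerivAt_fderiv hv hU hvU hinv hpU s).sub
      (hΦ.hasDerivAt_fderiv hv hU hvU hinv hx s))
    (by simp [hD0]) (fun s hs => ?_) hpT.le
  · have h1 : ‖fderiv ℝ (Φ p.1) p.2 - fderiv ℝ (Φ p.1) x‖ ≤ c / 4 := by
      refine key.trans (le_of_eq ?_)
      simp only [ε]; field_simp; ring
    calc _ ≤ dist (fderiv ℝ (Φ p.1) p.2) (fderiv ℝ (Φ p.1) x) +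
          dist (fderiv ℝ (Φ p.1) x) (fderiv ℝ (Φ t) x) := dist_triangle _ _ _
      _ < c / 4 + c / 2 := add_lt_add_of_le_of_lt (by rwa [dist_eq_norm]) hpc
      _ ≤ c := by linarith
  · have h1 : ‖Φ s p.2 - Φ s x‖ ≤ ‖p.2 - x‖ * C := hΦ.norm_sub_le hv hs _ _
    have h2 := (happ (Φ s x) ⟨s, abs_le.1 hs, rfl⟩ (Φ s p.2) (h1.trans_lt hy)).2.1
    have e : fderiv ℝ v (Φ s p.2) ∘L fderiv ℝ (Φ s) p.2 - fderiv ℝ v (Φ s x) ∘L fderiv ℝ (Φ s) x =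
        fderiv ℝ v (Φ s p.2) ∘L (fderiv ℝ (Φ s) p.2 - fderiv ℝ (Φ s) x) +
        (fderiv ℝ v (Φ s p.2) - fderiv ℝ v (Φ s x)) ∘L fderiv ℝ (Φ s) x := by
      rw [ContinuousLinearMap.comp_sub, ContinuousLinearMap.sub_comp]; abel
    rw [e]
    refine (norm_add_le _ _).trans (add_le_add ?_ ?_)
    · refine (ContinuousLinearMap.opNorm_comp_le _ _).trans ?_
      gcongr
      exact norm_fderiv_le_of_lipschitz ℝ hv
    · refine (ContinuousLinearMap.opNorm_comp_le _ _).trans ?_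
      gcongr
      exact hΦ.norm_fderiv_le hv hs x

/-- The derivative of the flow, jointly in time and space. -/
theorem hasStrictFDerivAt (hΦ : IsFlowOf v Φ) (hv : LipschitzWith K v) (hU : IsOpen U)
    (hvU : ContDiffOn ℝ 1 v U) (hinv : ∀ t, ∀ x ∈ U, Φ t x ∈ U) {x : E} (hx : x ∈ U) (t : ℝ) :
    HasStrictFDerivAt (fun p : ℝ × E => Φ p.1 p.2)
      ((ContinuousLinearMap.toSpanSingleton ℝ (v (Φ t x))).coprod (fderiv ℝ (Φ t) x)) (t, x) := by
  refine hasStrictFDerivAt_uncurry_coprod (u := (t, x)) (f := Φ)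
    (f₁ := fun t x => ContinuousLinearMap.toSpanSingleton ℝ (v (Φ t x)))
    (f₂ := fun t x => fderiv ℝ (Φ t) x) ?_ ?_ ?_ ?_
  · exact .of_forall fun p => (hΦ.hasDerivAt p.2 p.1).hasFDerivAt
  · have hUn : ∀ᶠ p : ℝ × E in 𝓝 (t, x), p.2 ∈ U :=
      continuous_snd.continuousAt.eventually (hU.mem_nhds hx)
    filter_upwards [hUn] with p hp
    exact hΦ.hasFDerivAt hv hU hvU hinv hp p.1
  · have : Continuous fun p : ℝ × E => v (Φ p.1 p.2) := hv.continuous.comp (hΦ.continuous hv)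
    exact (ContinuousLinearMap.toSpanSingletonCLE (𝕜 := ℝ) (E := E)).continuous.comp this
      |>.continuousAt
  · exact hΦ.continuousAt_fderiv hv hU hvU hinv hx t

theorem contDiffOn (hΦ : IsFlowOf v Φ) (hv : LipschitzWith K v) (hU : IsOpen U)
    (hvU : ContDiffOn ℝ 1 v U) (hinv : ∀ t, ∀ x ∈ U, Φ t x ∈ U) :
    ContDiffOn ℝ 1 (fun p : ℝ × E => Φ p.1 p.2) (univ ×ˢ U) := by
  have hopen : IsOpen ((univ : Set ℝ) ×ˢ U) := isOpen_univ.prod hU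
  have hd : ∀ p ∈ (univ : Set ℝ) ×ˢ U, HasFDerivAt (fun p : ℝ × E => Φ p.1 p.2)
      ((ContinuousLinearMap.toSpanSingleton ℝ (v (Φ p.1 p.2))).coprod (fderiv ℝ (Φ p.1) p.2)) p :=
    fun p hp => (hΦ.hasStrictFDerivAt hv hU hvU hinv hp.2 p.1).hasFDerivAt
  rw [show (1 : WithTop ℕ∞) = 0 + 1 by norm_num, contDiffOn_succ_iff_fderiv_of_isOpen hopen]
  refine ⟨fun p hp => (hd p hp).differentiableAt.differentiableWithinAt, by simp, ?_⟩
  rw [contDiffOn_zero]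
  refine ContinuousOn.congr (f := fun p : ℝ × E =>
    (ContinuousLinearMap.toSpanSingleton ℝ (v (Φ p.1 p.2))).coprod (fderiv ℝ (Φ p.1) p.2)) ?_
    (fun p hp => (hd p hp).fderiv)
  intro p hp
  have h1 : ContinuousAt (fun p : ℝ × E => ContinuousLinearMap.toSpanSingleton ℝ (v (Φ p.1 p.2))) p
      := (ContinuousLinearMap.toSpanSingletonCLE (𝕜 := ℝ) (E := E)).continuous.comp
        (hv.continuous.comp (hΦ.continuous hv)) |>.continuousAt
  have h2 := hΦ.continuousAt_fderiv hv hU hvU hinv hp.2 p.1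
  exact ((ContinuousLinearMap.coprodEquivL ℝ :
    ((ℝ →L[ℝ] E) × (E →L[ℝ] E)) ≃L[ℝ] (ℝ × E →L[ℝ] E)).continuous.continuousAt.comp
    (f := fun p : ℝ × E => (ContinuousLinearMap.toSpanSingleton ℝ (v (Φ p.1 p.2)),
      fderiv ℝ (Φ p.1) p.2)) (h1.prodMk h2)).continuousWithinAt

end IsFlowOf

end Flow

/-! ### Linear algebra of the symplectic form, and homogeneous functions. -/

namespace StarShaped

/-- Multiplication by `i` as a continuous linear map. -/
noncomputable def quatIL : R4 →L[ℝ] R4 :=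
  LinearMap.toContinuousLinearMap
    { toFun := quatI
      map_add' := fun u v => by ext i; fin_cases i <;> simp [quatI] <;> ring
      map_smul' := fun c u => by ext i; fin_cases i <;> simp [quatI] }

theorem quatIL_apply (u : R4) : quatIL u = quatI u := rfl

theorem quatIL_quatIL (u : R4) : quatIL (quatIL u) = -u := by
  ext i; fin_cases i <;> simp [quatIL_apply, quatI]

theorem omega_eq_inner (u v : R4) : omega u v = inner ℝ (quatIL u) v := by
  simp [omega, quatIL_apply, quatI, PiLp.inner_apply, Fin.sum_univ_four]; ring

/-- The symplectic form as a continuous bilinear map. -/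
noncomputable def omegaL : R4 →L[ℝ] R4 →L[ℝ] ℝ := (innerSL ℝ).comp quatIL

theorem omegaL_apply (u v : R4) : omegaL u v = omega u v := by
  rw [omega_eq_inner]; rfl

theorem omega_swap (u v : R4) : omega u v = -omega v u := by
  simp only [omega]; ring

theorem omega_self (u : R4) : omega u u = 0 := by
  simp only [omega]; ring

theorem lam_eq (p v : R4) : lam p v = omega p v / 2 := rfl

theorem omega_add_left (u v w : R4) : omega (u + v) w = omega u w + omega v w := by
  simp only [← omegaL_apply, map_add, add_apply]

theorem omega_add_right (u v w : R4) : omega u (v + w) = omega u v + omega u w := by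
  simp only [← omegaL_apply, map_add]

theorem omega_sub_left (u v w : R4) : omega (u - v) w = omega u w - omega v w := by
  simp only [← omegaL_apply, map_sub, sub_apply]

theorem omega_sub_right (u v w : R4) : omega u (v - w) = omega u v - omega u w := by
  simp only [← omegaL_apply, map_sub]

theorem omega_smul_left (c : ℝ) (u w : R4) : omega (c • u) w = c * omega u w := by
  simp only [← omegaL_apply, map_smul, smul_apply, smul_eq_mul]

theorem omega_smul_right (c : ℝ) (u w : R4) : omega u (c • w) = c * omega u w := by
  simp only [← omegaL_apply, map_smul, smul_eq_mul]

theorem eq_zero_of_omega_eq_zero {u : R4} (h : ∀ w, omega u w = 0) : u = 0 := by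
  have h1 : quatIL u = 0 := inner_self_eq_zero (𝕜 := ℝ).1 (by rw [← omega_eq_inner]; exact h _)
  have := quatIL_quatIL u
  rw [h1, map_zero] at this
  simpa using this.symm

theorem eq_of_omega_eq {u v : R4} (h : ∀ w, omega u w = omega v w) : u = v :=
  sub_eq_zero.1 (eq_zero_of_omega_eq_zero fun w => by rw [omega_sub_left, h, sub_self])

/-- A positive, positively homogeneous function, smooth away from the origin. -/
structure IsSmoothGauge (H : R4 → ℝ) : Prop where
  pos : ∀ x, x ≠ 0 → 0 < H x
  map_smul : ∀ t : ℝ, 0 < t → ∀ x, H (t • x) = t * H x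
  contDiffAt : ∀ x, x ≠ 0 → ContDiffAt ℝ ∞ H x

/-- If `F` is positively homogeneous of degree `n + 1`, its derivative is of degree `n`. -/
theorem fderiv_homogeneous {E F : Type*} [NormedAddCommGroup E] [NormedSpace ℝ E]
    [NormedAddCommGroup F] [NormedSpace ℝ F] {f : E → F} (n : ℕ)
    (hf : ∀ t : ℝ, 0 < t → ∀ x, f (t • x) = t ^ (n + 1) • f x) {t : ℝ} (ht : 0 < t) (x : E) :
    fderiv ℝ f (t • x) = t ^ n • fderiv ℝ f x := by
  have h1 : (fun y => f (t • y)) = fun y => t ^ (n + 1) • f y := funext fun y => hf t ht y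
  have h2 := fderiv_comp_smul (𝕜 := ℝ) (f := f) (x := x) t
  rw [h1, show (fun y => t ^ (n + 1) • f y) = t ^ (n + 1) • f from rfl,
    fderiv_const_smul_field] at h2
  rw [pow_succ', mul_smul] at h2
  exact (smul_right_injective _ ht.ne' h2).symm

/-- The Hamiltonian vector field of `H²`, normalized by `ω(V, ·) = -d(H²)`. -/
noncomputable def hamField (H : R4 → ℝ) (x : R4) : R4 :=
  quatIL ((InnerProductSpace.toDual ℝ R4).symm (fderiv ℝ (fun y => H y ^ 2) x))

theorem omega_hamField (H : R4 → ℝ) (x w : R4) :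
    omega (hamField H x) w = -fderiv ℝ (fun y => H y ^ 2) x w := by
  rw [omega_eq_inner, hamField, quatIL_quatIL, inner_neg_left,
    InnerProductSpace.toDual_symm_apply]

/-! ### The Hamiltonian flow of a squared gauge. -/

namespace IsSmoothGauge

variable {H : R4 → ℝ}

theorem map_zero (hH : IsSmoothGauge H) : H 0 = 0 := by
  have := hH.map_smul 2 two_pos 0
  rw [smul_zero] at this
  linarith

theorem ne_zero_of_eq_one (hH : IsSmoothGauge H) {x : R4} (hx : H x = 1) : x ≠ 0 := by
  rintro rfl
  rw [hH.map_zero] at hx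
  exact zero_ne_one hx

theorem contDiffAt_sq (hH : IsSmoothGauge H) {x : R4} (hx : x ≠ 0) :
    ContDiffAt ℝ ∞ (fun y => H y ^ 2) x := (hH.contDiffAt x hx).pow 2

theorem differentiableAt (hH : IsSmoothGauge H) {x : R4} (hx : x ≠ 0) : DifferentiableAt ℝ H x :=
  (hH.contDiffAt x hx).differentiableAt (by simp)

theorem fderiv_sq (hH : IsSmoothGauge H) {x : R4} (hx : x ≠ 0) (w : R4) :
    fderiv ℝ (fun y => H y ^ 2) x w = 2 * H x * fderiv ℝ H x w := by
  have := ((hH.differentiableAt hx).hasFDerivAt.pow 2).fderiv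
  rw [this]
  simp

/-- Euler's identity. -/
theorem fderiv_self (hH : IsSmoothGauge H) {x : R4} (hx : x ≠ 0) : fderiv ℝ H x x = H x := by
  have h1 : HasDerivAt (fun t : ℝ => t • x) x 1 := by
    simpa using (hasDerivAt_id (1 : ℝ)).smul_const x
  have h2 : HasDerivAt (fun t : ℝ => H (t • x)) (fderiv ℝ H x x) 1 := by
    have : HasFDerivAt H (fderiv ℝ H x) ((1 : ℝ) • x) := by
      simpa using (hH.differentiableAt hx).hasFDerivAt
    exact this.comp_hasDerivAt 1 h1
  have h3 : HasDerivAt (fun t : ℝ => t * H x) (H x) 1 := by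
    simpa using (hasDerivAt_id (1 : ℝ)).mul_const (H x)
  refine h2.unique (h3.congr_of_eventuallyEq ?_)
  filter_upwards [lt_mem_nhds (zero_lt_one (α := ℝ))] with t ht
  exact hH.map_smul t ht x

theorem hamField_smul (hH : IsSmoothGauge H) {t : ℝ} (ht : 0 < t) (x : R4) :
    hamField H (t • x) = t • hamField H x := by
  have := fderiv_homogeneous (f := fun y => H y ^ 2) 1
    (fun t ht x => by simp only [hH.map_smul t ht, smul_eq_mul]; ring) ht x
  rw [hamField, this, pow_one]
  simp [hamField]

theorem hamField_zero (hH : IsSmoothGauge H) : hamField H 0 = 0 := by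
  have := hH.hamField_smul two_pos 0
  rw [smul_zero, two_smul] at this
  simpa using this.symm

theorem contDiffAt_hamField (hH : IsSmoothGauge H) {x : R4} (hx : x ≠ 0) :
    ContDiffAt ℝ ∞ (hamField H) x := by
  have h1 : ContDiffAt ℝ ∞ (fderiv ℝ (fun y => H y ^ 2)) x :=
    (hH.contDiffAt_sq hx).fderiv_right (by simp)
  exact (quatIL.contDiff.comp
    (InnerProductSpace.toDual ℝ R4).symm.contDiff).contDiffAt.comp x h1

theorem contDiffOn_hamField (hH : IsSmoothGauge H) : ContDiffOn ℝ 1 (hamField H) {0}ᶜ :=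
  fun _ hx => ((hH.contDiffAt_hamField hx).of_le (by simp)).contDiffWithinAt

/-- The field is homogeneous of degree 1 and its derivative of degree 0, so bounds on the unit
sphere control both everywhere. The mean value inequality applies to segments that miss the origin.
-/
theorem exists_lipschitzWith_hamField (hH : IsSmoothGauge H) :
    ∃ K, LipschitzWith K (hamField H) := by
  set V := hamField H with hV
  have hVs : ∀ t : ℝ, 0 < t → ∀ x, V (t • x) = t ^ (0 + 1) • V x := fun t ht x => by
    rw [zero_add, pow_one]; exact hH.hamField_smul ht x
  have hcs : IsCompact (sphere (0 : R4) 1) := isCompact_sphere 0 1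
  have hne : ∀ x ∈ sphere (0 : R4) 1, x ≠ 0 := fun x hx => ne_of_mem_sphere hx one_ne_zero
  have hsub : sphere (0 : R4) 1 ⊆ {0}ᶜ := hne
  obtain ⟨A, hA⟩ := hcs.exists_bound_of_continuousOn
    (hH.contDiffOn_hamField.continuousOn.mono hsub)
  obtain ⟨B, hB⟩ := hcs.exists_bound_of_continuousOn
    ((hH.contDiffOn_hamField.continuousOn_fderiv_of_isOpen isOpen_compl_singleton le_rfl).mono hsub)
  have hunit : ∀ x : R4, x ≠ 0 → ‖x‖⁻¹ • x ∈ sphere (0 : R4) 1 := fun x hx => by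
    rw [mem_sphere_zero_iff_norm, norm_smul, norm_inv, norm_norm,
      inv_mul_cancel₀ (norm_ne_zero_iff.2 hx)]
  have hscale : ∀ x : R4, x ≠ 0 → ‖x‖ • (‖x‖⁻¹ • x) = x := fun x hx => by
    rw [smul_smul, mul_inv_cancel₀ (norm_ne_zero_iff.2 hx), one_smul]
  have hA' : ∀ x, ‖V x‖ ≤ A * ‖x‖ := fun x => by
    rcases eq_or_ne x 0 with rfl | hx
    · simp [hV, hH.hamField_zero]
    · rw [← hscale x hx, hVs _ (norm_pos_iff.2 hx), norm_smul, hscale x hx]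
      simp only [zero_add, pow_one, norm_norm]
      rw [mul_comm]
      gcongr
      exact hA _ (hunit x hx)
  have hB' : ∀ x, x ≠ 0 → ‖fderiv ℝ V x‖ ≤ B := fun x hx => by
    rw [← hscale x hx, fderiv_homogeneous 0 hVs (norm_pos_iff.2 hx)]
    simpa using hB _ (hunit x hx)
  refine ⟨Real.toNNReal (max A B), LipschitzWith.of_dist_le_mul fun x y => ?_⟩
  rw [dist_eq_norm, dist_eq_norm]
  have hmax : max A B ≤ (Real.toNNReal (max A B) : ℝ) := Real.le_coe_toNNReal _
  refine le_trans ?_ (mul_le_mul_of_nonneg_right hmax (norm_nonneg _))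
  -- On a segment through the origin the field need not be differentiable, but there `‖x - y‖ = ‖x‖
  -- + ‖y‖` and linear growth suffices.
  by_cases h0 : (0 : R4) ∈ segment ℝ y x
  · have hd := dist_add_dist_of_mem_segment h0
    rw [dist_zero_right, dist_zero_left, dist_comm, dist_eq_norm] at hd
    calc ‖V x - V y‖ ≤ ‖V x‖ + ‖V y‖ := norm_sub_le _ _
      _ ≤ max A B * ‖x‖ + max A B * ‖y‖ := by
        gcongr
        · exact (hA' x).trans (by gcongr; exact le_max_left _ _)
        · exact (hA' y).trans (by gcongr; exact le_max_left _ _)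
      _ = max A B * ‖x - y‖ := by rw [← hd]; ring
  · refine (convex_segment y x).norm_image_sub_le_of_norm_hasFDerivWithin_le
      (f' := fun z => fderiv ℝ V z) (fun z hz => ?_) (fun z hz => ?_)
      (left_mem_segment ℝ y x) (right_mem_segment ℝ y x)
    · have hz0 : z ≠ 0 := fun h => h0 (h ▸ hz)
      exact ((hH.contDiffAt_hamField hz0).differentiableAt
        (by simp)).hasFDerivAt.hasFDerivWithinAt
    · have hz0 : z ≠ 0 := fun h => h0 (h ▸ hz)
      exact (hB' z hz0).trans (le_max_right _ _)

/-- The Lipschitz constant of the Hamiltonian vector field. -/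
noncomputable def lipConst (hH : IsSmoothGauge H) : NNReal := hH.exists_lipschitzWith_hamField.choose

theorem lipschitzWith_hamField (hH : IsSmoothGauge H) : LipschitzWith hH.lipConst (hamField H) :=
  hH.exists_lipschitzWith_hamField.choose_spec

/-- The Hamiltonian flow of `H²`. -/
noncomputable def flow (hH : IsSmoothGauge H) : ℝ → R4 → R4 :=
  (exists_isFlowOf hH.lipschitzWith_hamField).choose

theorem isFlowOf (hH : IsSmoothGauge H) : IsFlowOf (hamField H) hH.flow :=
  (exists_isFlowOf hH.lipschitzWith_hamField).choose_spec

theorem flow_zero (hH : IsSmoothGauge H) (x : R4) : hH.flow 0 x = x := hH.isFlowOf.map_zero x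

theorem flow_map_zero (hH : IsSmoothGauge H) (t : ℝ) : hH.flow t 0 = 0 := by
  have := hH.isFlowOf.eq_of_hasDerivAt hH.lipschitzWith_hamField (γ := fun _ => 0)
    (fun t => by rw [hH.hamField_zero]; exact hasDerivAt_const t 0) t
  exact this.symm

theorem flow_ne_zero (hH : IsSmoothGauge H) (t : ℝ) {x : R4} (hx : x ≠ 0) : hH.flow t x ≠ 0 := by
  intro h
  have := hH.isFlowOf.map_neg_map hH.lipschitzWith_hamField t x
  rw [h, hH.flow_map_zero] at this
  exact hx this.symm

theorem flow_neg_flow (hH : IsSmoothGauge H) (t : ℝ) (x : R4) : hH.flow (-t) (hH.flow t x) = x :=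
  hH.isFlowOf.map_neg_map hH.lipschitzWith_hamField t x

theorem flow_flow_neg (hH : IsSmoothGauge H) (t : ℝ) (x : R4) : hH.flow t (hH.flow (-t) x) = x :=
  hH.isFlowOf.map_map_neg hH.lipschitzWith_hamField t x

theorem flow_smul (hH : IsSmoothGauge H) (t : ℝ) {c : ℝ} (hc : 0 < c) (x : R4) :
    hH.flow t (c • x) = c • hH.flow t x := by
  have := hH.isFlowOf.eq_of_hasDerivAt hH.lipschitzWith_hamField (γ := fun t => c • hH.flow t x)
    (fun t => by
      rw [hH.hamField_smul hc]
      exact (hH.isFlowOf.hasDerivAt x t).const_smul c) t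
  rw [hH.flow_zero] at this
  exact this.symm

theorem map_flow (hH : IsSmoothGauge H) (t : ℝ) (x : R4) : H (hH.flow t x) = H x := by
  rcases eq_or_ne x 0 with rfl | hx
  · rw [hH.flow_map_zero]
  have hd : ∀ s, HasDerivAt (fun s => H (hH.flow s x) ^ 2) 0 s := fun s => by
    have h1 := ((hH.contDiffAt_sq (hH.flow_ne_zero s hx)).differentiableAt
      (by simp)).hasFDerivAt.comp_hasDerivAt s (hH.isFlowOf.hasDerivAt x s)
    refine h1.congr_deriv ?_
    have := omega_hamField H (hH.flow s x) (hamField H (hH.flow s x))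
    rw [omega_self] at this
    linarith
  have hconst := is_const_of_deriv_eq_zero (fun s => (hd s).differentiableAt)
    (fun s => (hd s).deriv) t 0
  simp only [hH.flow_zero] at hconst
  exact (pow_left_inj₀ (hH.pos _ (hH.flow_ne_zero t hx)).le (hH.pos x hx).le two_ne_zero).1 hconst

theorem mapsTo_flow (hH : IsSmoothGauge H) : ∀ t, ∀ x ∈ ({0}ᶜ : Set R4), hH.flow t x ∈ ({0}ᶜ : Set R4) :=
  fun t _ hx => hH.flow_ne_zero t hx

theorem contDiffOn_flow (hH : IsSmoothGauge H) :
    ContDiffOn ℝ 1 (fun p : ℝ × R4 => hH.flow p.1 p.2) (univ ×ˢ {0}ᶜ) :=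
  hH.isFlowOf.contDiffOn hH.lipschitzWith_hamField isOpen_compl_singleton hH.contDiffOn_hamField
    hH.mapsTo_flow

theorem hasFDerivAt_uncurry_flow (hH : IsSmoothGauge H) (t : ℝ) {x : R4} (hx : x ≠ 0) :
    HasFDerivAt (fun p : ℝ × R4 => hH.flow p.1 p.2)
      ((ContinuousLinearMap.toSpanSingleton ℝ (hamField H (hH.flow t x))).coprod
        (fderiv ℝ (hH.flow t) x)) (t, x) :=
  (hH.isFlowOf.hasStrictFDerivAt hH.lipschitzWith_hamField isOpen_compl_singleton
    hH.contDiffOn_hamField hH.mapsTo_flow hx t).hasFDerivAt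

theorem hasFDerivAt_flow (hH : IsSmoothGauge H) (t : ℝ) {x : R4} (hx : x ≠ 0) :
    HasFDerivAt (hH.flow t) (fderiv ℝ (hH.flow t) x) x :=
  hH.isFlowOf.hasFDerivAt hH.lipschitzWith_hamField isOpen_compl_singleton hH.contDiffOn_hamField
    hH.mapsTo_flow hx t

theorem omega_fderiv_hamField (hH : IsSmoothGauge H) {x : R4} (hx : x ≠ 0) (u w : R4) :
    omega (fderiv ℝ (hamField H) x u) w = -fderiv ℝ (fderiv ℝ (fun y => H y ^ 2)) x u w := by
  have h1 : HasFDerivAt (fderiv ℝ (fun y => H y ^ 2)) (fderiv ℝ (fderiv ℝ (fun y => H y ^ 2)) x) x :=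
    (((hH.contDiffAt_sq hx).fderiv_right (m := ∞) (by simp)).differentiableAt (by simp)).hasFDerivAt
  have h2 : HasFDerivAt (fun y => fderiv ℝ (fun y => H y ^ 2) y w)
      ((ContinuousLinearMap.apply ℝ ℝ w).comp (fderiv ℝ (fderiv ℝ (fun y => H y ^ 2)) x)) x :=
    (ContinuousLinearMap.apply ℝ ℝ w).hasFDerivAt.comp x h1
  have h3 : HasFDerivAt (fun y => omegaL.flip w (hamField H y))
      ((omegaL.flip w).comp (fderiv ℝ (hamField H) x)) x :=
    (omegaL.flip w).hasFDerivAt.comp x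
      ((hH.contDiffAt_hamField hx).differentiableAt (by simp)).hasFDerivAt
  have h4 : (fun y => omegaL.flip w (hamField H y)) = fun y => -fderiv ℝ (fun y => H y ^ 2) y w := by
    funext y
    rw [ContinuousLinearMap.flip_apply, omegaL_apply, omega_hamField]
  rw [h4] at h3
  have := congrArg (fun L : R4 →L[ℝ] ℝ => L u) (h3.unique h2.neg)
  simpa [omegaL_apply] using this

/-- The Hamiltonian flow is symplectic. -/
theorem omega_fderiv_flow (hH : IsSmoothGauge H) (t : ℝ) {x : R4} (hx : x ≠ 0) (u w : R4) :
    omega (fderiv ℝ (hH.flow t) x u) (fderiv ℝ (hH.flow t) x w) = omega u w := by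
  have hD : ∀ s (a : R4), HasDerivAt (fun s => fderiv ℝ (hH.flow s) x a)
      (fderiv ℝ (hamField H) (hH.flow s x) (fderiv ℝ (hH.flow s) x a)) s := fun s a =>
    ((hH.isFlowOf.hasDerivAt_fderiv hH.lipschitzWith_hamField isOpen_compl_singleton
      hH.contDiffOn_hamField hH.mapsTo_flow hx s).clm_apply
        (hasDerivAt_const s a)).congr_deriv (by simp)
  have hd : ∀ s, HasDerivAt (fun s => omegaL (fderiv ℝ (hH.flow s) x u)
      (fderiv ℝ (hH.flow s) x w)) 0 s := fun s => by
    refine ((omegaL.hasFDerivAt.comp_hasDerivAt s (hD s u)).clm_apply (hD s w)).congr_deriv ?_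
    have hs := hH.flow_ne_zero s hx
    rw [omegaL_apply, Function.comp_apply, omegaL_apply, omega_fderiv_hamField hH hs,
      omega_swap _ (fderiv ℝ (hamField H) _ _), omega_fderiv_hamField hH hs, neg_neg]
    -- The derivative of `ω(DΦ u, DΦ w)` in time is the difference of two values of the Hessian of
    -- `H²` with exchanged arguments.
    have hsymm : IsSymmSndFDerivAt ℝ (fun y => H y ^ 2) (hH.flow s x) :=
      (hH.contDiffAt_sq hs).isSymmSndFDerivAt (by simpa using ENat.LEInfty.out)
    rw [hsymm.eq]
    ring
  have hconst := is_const_of_deriv_eq_zero (fun s => (hd s).differentiableAt)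
    (fun s => (hd s).deriv) t 0
  have h0 : fderiv ℝ (hH.flow 0) x = .id ℝ R4 := by
    have : hH.flow 0 = id := funext hH.flow_zero
    rw [this, fderiv_id]
  simpa [omegaL_apply, h0] using hconst

/-- Differentiate `Φ (t + s) = Φ t ∘ Φ s` at `s = 0` in both forms. -/
theorem fderiv_flow_hamField (hH : IsSmoothGauge H) (t : ℝ) {x : R4} (hx : x ≠ 0) :
    fderiv ℝ (hH.flow t) x (hamField H x) = hamField H (hH.flow t x) := by
  have h1 : HasDerivAt (fun s => hH.flow s x) (hamField H x) 0 := by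
    simpa [hH.flow_zero] using hH.isFlowOf.hasDerivAt x 0
  have h2 : HasDerivAt (fun s => hH.flow t (hH.flow s x))
      (fderiv ℝ (hH.flow t) x (hamField H x)) 0 := by
    have : HasFDerivAt (hH.flow t) (fderiv ℝ (hH.flow t) x) (hH.flow 0 x) := by
      rw [hH.flow_zero]; exact hH.hasFDerivAt_flow t hx
    exact this.comp_hasDerivAt 0 h1
  have h3 : HasDerivAt (fun s => hH.flow (t + s) x) (hamField H (hH.flow t x)) 0 := by
    have := hH.isFlowOf.hasDerivAt x (t + 0)
    rw [add_zero] at this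
    have h4 := HasDerivAt.comp_const_add (𝕜 := ℝ) (f := fun s => hH.flow s x) t 0 (by
      rw [add_zero]; exact this)
    exact h4
  have h5 : (fun s => hH.flow (t + s) x) = fun s => hH.flow t (hH.flow s x) :=
    funext fun s => hH.isFlowOf.map_add hH.lipschitzWith_hamField t s x
  rw [h5] at h3
  exact h2.unique h3

end IsSmoothGauge

end StarShaped

/-! ### The gauge of a star-shaped domain and its smoothness. -/

theorem IsPreconnected.inter_frontier_nonempty {α : Type*} [TopologicalSpace α] {C X : Set α}
    (hC : IsPreconnected C) (h₁ : (C ∩ X).Nonempty) (h₂ : (C ∩ Xᶜ).Nonempty) :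
    (C ∩ frontier X).Nonempty := by
  by_contra! h
  have hno : ∀ x ∈ C, x ∉ frontier X := fun x hx hf => (h ▸ ⟨hx, hf⟩ : x ∈ (∅ : Set α))
  have hint : ∀ x ∈ C, x ∈ X → x ∈ interior X := fun x hx hX => by
    by_contra hi
    exact hno x hx ⟨subset_closure hX, hi⟩
  have hext : ∀ x ∈ C, x ∉ X → x ∉ closure X := fun x hx hX hc =>
    hno x hx ⟨hc, fun hi => hX (interior_subset hi)⟩
  obtain ⟨a, haC, haX⟩ := h₁
  obtain ⟨b, hbC, hbX⟩ := h₂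
  obtain ⟨c, -, hc₁, hc₂⟩ := hC (interior X) (closure X)ᶜ isOpen_interior
    isClosed_closure.isOpen_compl (fun x hx => (em (x ∈ X)).imp (hint x hx) (hext x hx))
    ⟨a, haC, hint a haC haX⟩ ⟨b, hbC, hext b hbC hbX⟩
  exact hc₂ (subset_closure (interior_subset hc₁))

namespace StarShaped

theorem isInvertible_of_apply_one_ne_zero {L : ℝ →L[ℝ] ℝ} (h : L 1 ≠ 0) : L.IsInvertible :=
  ⟨ContinuousLinearEquiv.unitsEquivAut ℝ (Units.mk0 (L 1) h), by ext; simp⟩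

namespace IsStarShapedDomain

variable {X : Set R4}

theorem isClosed (hX : IsStarShapedDomain X) : IsClosed X := hX.isCompact.isClosed

theorem zero_notMem_frontier (hX : IsStarShapedDomain X) : (0 : R4) ∉ frontier X :=
  fun h => h.2 hX.zero_mem_interior

theorem zero_mem (hX : IsStarShapedDomain X) : (0 : R4) ∈ X := interior_subset hX.zero_mem_interior

/-- On each ray, `X` is the segment up to the boundary point. -/
theorem smul_mem_iff (hX : IsStarShapedDomain X) {v : R4} {t₀ : ℝ} (ht₀ : 0 < t₀)
    (h₀ : t₀ • v ∈ frontier X) {t : ℝ} (ht : 0 < t) : t • v ∈ X ↔ t ≤ t₀ := by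
  have hv : v ≠ 0 := by
    rintro rfl
    rw [smul_zero] at h₀
    exact hX.zero_notMem_frontier h₀
  have huniq : ∀ s : ℝ, 0 < s → s • v ∈ frontier X → s = t₀ := fun s hs h =>
    (hX.ray_meets_once v hv).unique ⟨hs, h⟩ ⟨ht₀, h₀⟩
  have hcont : Continuous fun s : ℝ => s • v := by fun_prop
  constructor
  · intro hmem
    by_contra! hlt
    obtain ⟨R, hR⟩ := hX.isCompact.isBounded.subset_closedBall 0
    -- The ray beyond a point of `X` leaves the bounded set `X`, hence meets the boundary; beyond
    -- `t₀` this would be a second boundary point.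
    have hpre : IsPreconnected ((fun s : ℝ => s • v) '' Ici t) :=
      isPreconnected_Ici.image _ hcont.continuousOn
    obtain ⟨q, ⟨s, hs, rfl⟩, hq⟩ := IsPreconnected.inter_frontier_nonempty (X := X) hpre
      ⟨t • v, ⟨t, self_mem_Ici, rfl⟩, hmem⟩
      (by
        refine ⟨(max t ((|R| + 1) / ‖v‖)) • v, ⟨_, mem_Ici.2 (le_max_left _ _), rfl⟩, fun h => ?_⟩
        have h1 := hR h
        rw [mem_closedBall_zero_iff, norm_smul, Real.norm_of_nonneg
          (le_max_of_le_left ht.le)] at h1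
        have h2 : (|R| + 1) / ‖v‖ * ‖v‖ ≤ max t ((|R| + 1) / ‖v‖) * ‖v‖ := by
          gcongr; exact le_max_right _ _
        rw [div_mul_cancel₀ _ (norm_ne_zero_iff.2 hv)] at h2
        linarith [le_abs_self R])
    have := huniq s (ht.trans_le hs) hq
    linarith [mem_Ici.1 hs]
  · intro hle
    rcases hle.eq_or_lt with rfl | hlt
    · exact hX.isClosed.frontier_subset h₀
    by_contra hmem
    have hpre : IsPreconnected ((fun s : ℝ => s • v) '' Icc 0 t) :=
      isPreconnected_Icc.image _ hcont.continuousOn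
    obtain ⟨q, ⟨s, hs, rfl⟩, hq⟩ := IsPreconnected.inter_frontier_nonempty (X := X) hpre
      ⟨0, ⟨0, left_mem_Icc.2 ht.le, zero_smul _ _⟩, hX.zero_mem⟩
      ⟨t • v, ⟨t, right_mem_Icc.2 ht.le, rfl⟩, hmem⟩
    rcases hs.1.eq_or_lt with h | h
    · subst h
      exact hX.zero_notMem_frontier (by simpa using hq)
    · have := huniq s h hq
      linarith [hs.2]

/-- Convexity is not needed: `X` meets each ray in the segment up to its boundary point, and the
gauge only looks along rays. -/
theorem gauge_eq_of_smul_mem_frontier (hX : IsStarShapedDomain X) {v : R4} {t₀ : ℝ} (ht₀ : 0 < t₀)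
    (h₀ : t₀ • v ∈ frontier X) : gauge X v = t₀⁻¹ := by
  rw [gauge_def']
  have : {r | r ∈ Ioi (0 : ℝ) ∧ r⁻¹ • v ∈ X} = Ici t₀⁻¹ := by
    ext r
    simp only [mem_Ioi, mem_ofPred_eq, mem_Ici]
    constructor
    · rintro ⟨hr, h⟩
      rw [hX.smul_mem_iff ht₀ h₀ (inv_pos.2 hr)] at h
      exact inv_le_of_inv_le₀ hr h
    · intro h
      have hr : 0 < r := (inv_pos.2 ht₀).trans_le h
      exact ⟨hr, (hX.smul_mem_iff ht₀ h₀ (inv_pos.2 hr)).2 (inv_le_of_inv_le₀ ht₀ h)⟩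
  rw [this, csInf_Ici]

theorem gauge_pos (hX : IsStarShapedDomain X) {v : R4} (hv : v ≠ 0) : 0 < gauge X v := by
  obtain ⟨t, ⟨ht, h⟩, -⟩ := hX.ray_meets_once v hv
  rw [hX.gauge_eq_of_smul_mem_frontier ht h]
  exact inv_pos.2 ht

theorem gauge_smul_pos {t : ℝ} (ht : 0 < t) (v : R4) :
    gauge X (t • v) = t * gauge X v := by
  rw [gauge_smul_of_nonneg ht.le, smul_eq_mul]

theorem mem_frontier_iff (hX : IsStarShapedDomain X) {x : R4} :
    x ∈ frontier X ↔ gauge X x = 1 := by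
  constructor
  · intro h
    simpa using hX.gauge_eq_of_smul_mem_frontier one_pos (by simpa using h)
  · intro h
    have hx : x ≠ 0 := by rintro rfl; simp at h
    obtain ⟨t, ⟨ht, h'⟩, -⟩ := hX.ray_meets_once x hx
    have := hX.gauge_eq_of_smul_mem_frontier ht h'
    rw [h] at this
    have ht1 : t = 1 := by rw [← inv_inv t, ← this, inv_one]
    simpa [ht1] using h'

theorem frontier_eq (hX : IsStarShapedDomain X) : frontier X = {x | gauge X x = 1} :=
  Set.ext fun _ => hX.mem_frontier_iff

theorem inv_gauge_smul_mem_frontier (hX : IsStarShapedDomain X) {x : R4} (hx : x ≠ 0) :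
    (gauge X x)⁻¹ • x ∈ frontier X := by
  rw [hX.mem_frontier_iff, gauge_smul_pos (inv_pos.2 (hX.gauge_pos hx)),
    inv_mul_cancel₀ (hX.gauge_pos hx).ne']

theorem mem_iff (hX : IsStarShapedDomain X) {x : R4} : x ∈ X ↔ gauge X x ≤ 1 := by
  rcases eq_or_ne x 0 with rfl | hx
  · simp [hX.zero_mem]
  have := hX.smul_mem_iff (inv_pos.2 (hX.gauge_pos hx)) (hX.inv_gauge_smul_mem_frontier hx) one_pos
  rw [one_smul] at this
  rw [this, one_le_inv₀ (hX.gauge_pos hx)]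

theorem mem_interior_iff (hX : IsStarShapedDomain X) {x : R4} :
    x ∈ interior X ↔ gauge X x < 1 := by
  rw [← self_sdiff_frontier, mem_sdiff, hX.mem_iff, hX.mem_frontier_iff, lt_iff_le_and_ne]

/-- A defining function whose level set is transverse to the radial direction. -/
theorem exists_defining (hX : IsStarShapedDomain X) {p : R4} (hp : p ∈ frontier X) :
    ∃ F : R4 → ℝ, ContDiffAt ℝ ∞ F p ∧ F p = 0 ∧ fderiv ℝ F p p ≠ 0 ∧
      ∀ᶠ q in 𝓝 p, F q = 0 → q ∈ frontier X := by
  obtain ⟨U, F, hU, hpU, hF, hdF, hXU⟩ := hX.smoothBoundary p hp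
  have hFp : ContDiffAt ℝ ∞ F p := hF.contDiffAt (hU.mem_nhds hpU)
  have hmem : ∀ q ∈ U, (q ∈ X ↔ F q ≤ 0) := fun q hq => by
    have : q ∈ X ∩ U ↔ q ∈ {x | x ∈ U ∧ F x ≤ 0} := by rw [hXU]
    simpa [hq] using this
  have hF0 : F p = 0 := by
    refine le_antisymm ((hmem p hpU).1 (hX.isClosed.frontier_subset hp)) ?_
    by_contra! hlt
    refine hp.2 (mem_interior_iff_mem_nhds.2 ?_)
    filter_upwards [hU.mem_nhds hpU, hFp.continuousAt.eventually_lt_const hlt] with q hq hq'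
    exact (hmem q hq).2 hq'.le
  have hfr : ∀ᶠ q in 𝓝 p, F q = 0 → q ∈ frontier X := by
    have hc : ContinuousAt (fderiv ℝ F) p :=
      ((hFp.fderiv_right (m := ∞) (by simp))).continuousAt
    filter_upwards [hU.mem_nhds hpU, hc.eventually_ne hdF] with q hq hdq hFq
    rw [frontier, hX.isClosed.closure_eq]
    refine ⟨(hmem q hq).2 hFq.le, fun hint => hdq ?_⟩
    -- A zero of `F` interior to `X = {F ≤ 0}` would be a local maximum, against `dF ≠ 0`.
    have : IsLocalMax F q := by
      filter_upwards [hU.mem_nhds hq, mem_interior_iff_mem_nhds.1 hint] with r hr hrX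
      rw [hFq]
      exact (hmem r hr).1 hrX
    exact this.fderiv_eq_zero
  -- If `dF_p(p) = 0`, choose `w` with `dF_p(w) ≠ 0`. The implicit function theorem in the plane of
  -- `p` and `w` gives a curve `p + s p + τ(s) w` in `{F = 0}` with `τ'(0) = 0`. Its velocity is
  -- `p`, which contradicts transversality.
  refine ⟨F, hFp, hF0, fun hLp => ?_, hfr⟩
  obtain ⟨w, hw⟩ : ∃ w, fderiv ℝ F p w ≠ 0 := by
    by_contra! h
    exact hdF (ContinuousLinearMap.ext h)
  set g : ℝ × ℝ → ℝ := fun z => F (p + z.1 • p + z.2 • w) with hg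
  have hFp' : ContDiffAt ℝ ∞ F (p + (0 : ℝ) • p + (0 : ℝ) • w) := by simpa using hFp
  have hgs : ContDiffAt ℝ ∞ g (0, 0) :=
    ContDiffAt.comp (f := fun z : ℝ × ℝ => p + z.1 • p + z.2 • w) (0, 0) hFp' (by fun_prop)
  have hpd : HasFDerivAt (fun z : ℝ × ℝ => p + z.1 • p + z.2 • w)
      ((ContinuousLinearMap.fst ℝ ℝ ℝ).smulRight p + (ContinuousLinearMap.snd ℝ ℝ ℝ).smulRight w)
      (0, 0) := by
    have h1 : HasFDerivAt (fun z : ℝ × ℝ => z.1 • p)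
      ((ContinuousLinearMap.fst ℝ ℝ ℝ).smulRight p) (0, 0) :=
      ((ContinuousLinearMap.fst ℝ ℝ ℝ).smulRight p).hasFDerivAt
    have h2 : HasFDerivAt (fun z : ℝ × ℝ => z.2 • w)
      ((ContinuousLinearMap.snd ℝ ℝ ℝ).smulRight w) (0, 0) :=
      ((ContinuousLinearMap.snd ℝ ℝ ℝ).smulRight w).hasFDerivAt
    exact (h1.const_add p).add h2
  have hgd : fderiv ℝ g (0, 0) = (fderiv ℝ F p).comp
      ((ContinuousLinearMap.fst ℝ ℝ ℝ).smulRight p +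
        (ContinuousLinearMap.snd ℝ ℝ ℝ).smulRight w) := by
    have : HasFDerivAt F (fderiv ℝ F p) (p + (0 : ℝ) • p + (0 : ℝ) • w) := by
      simpa using (hFp.differentiableAt (by simp)).hasFDerivAt
    exact (HasFDerivAt.comp (f := fun z : ℝ × ℝ => p + z.1 • p + z.2 • w) (0, 0) this hpd).fderiv
  have hinv : (fderiv ℝ g (0, 0) ∘L .inr ℝ ℝ ℝ).IsInvertible :=
    isInvertible_of_apply_one_ne_zero (by simpa [hgd] using hw)
  set τ := hgs.implicitFunction (by simp) hinv
  have hτ0 : τ 0 = 0 := hgs.implicitFunction_apply_self (by simp) hinv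
  have hτg : ∀ᶠ s in 𝓝 (0 : ℝ), g (s, τ s) = 0 := by
    have := hgs.eventually_apply_implicitFunction (by simp) hinv
    simpa [hg, hF0] using this
  have hτd : HasDerivAt τ 0 0 := by
    have h1 := (hgs.hasStrictFDerivAt_implicitFunction (by simp) hinv).hasFDerivAt.hasDerivAt
    refine h1.congr_deriv ?_
    simp [hgd, hLp]
  have hcd : HasDerivAt (fun s : ℝ => p + s • p + τ s • w) p 0 := by
    have h1 := ((hasDerivAt_id (0 : ℝ)).smul_const p).const_add p
    have h2 := hτd.smul_const w
    exact (h1.add h2).congr_deriv (by simp)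
  have hcont : Filter.Tendsto (fun s : ℝ => p + s • p + τ s • w) (𝓝 0) (𝓝 p) := by
    have := hcd.continuousAt.tendsto
    simpa [hτ0] using this
  have hev : ∀ᶠ s in 𝓝 (0 : ℝ), p + s • p + τ s • w ∈ frontier X := by
    filter_upwards [hτg, hcont.eventually hfr] with s hs h
    exact h hs
  classical
  -- `tangentVectors` asks for a curve that lies in the boundary at all times, so the curve is
  -- replaced by the constant `p` where it leaves the boundary.
  refine hX.radial_transverse p hp
    ⟨fun s => if p + s • p + τ s • w ∈ frontier X then p + s • p + τ s • w else p,
      fun s => ?_, ?_, ?_⟩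
  · dsimp only
    split_ifs with h
    exacts [h, hp]
  · simp [hτ0]
  · refine hcd.congr_of_eventuallyEq ?_
    filter_upwards [hev] with s hs
    rw [if_pos hs]

/-- Radial transversality lets the equation `F(τ x) = 0` be solved for `τ = τ(x)`, smooth near `p`
with `τ(p) = 1`, and the gauge is `1 / τ`. -/
theorem contDiffAt_gauge_of_mem_frontier (hX : IsStarShapedDomain X) {p : R4}
    (hp : p ∈ frontier X) : ContDiffAt ℝ ∞ (gauge X) p := by
  obtain ⟨F, hF, hF0, hFp, hfr⟩ := hX.exists_defining hp
  set g : R4 × ℝ → ℝ := fun z => F (z.2 • z.1) with hg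
  have hF' : ContDiffAt ℝ ∞ F ((1 : ℝ) • p) := by simpa using hF
  have hgs : ContDiffAt ℝ ∞ g (p, 1) :=
    ContDiffAt.comp (f := fun z : R4 × ℝ => z.2 • z.1) (p, 1) hF' (by fun_prop)
  have hinv : (fderiv ℝ g (p, 1) ∘L .inr ℝ R4 ℝ).IsInvertible := by
    refine isInvertible_of_apply_one_ne_zero ?_
    have h1 : HasDerivAt (fun t : ℝ => g (p, t)) (fderiv ℝ F p p) 1 := by
      have h2 : HasFDerivAt F (fderiv ℝ F p) ((1 : ℝ) • p) := by
        simpa using (hF.differentiableAt (by simp)).hasFDerivAt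
      have h3 : HasDerivAt (fun t : ℝ => t • p) p 1 := by
        simpa using (hasDerivAt_id (1 : ℝ)).smul_const p
      exact h2.comp_hasDerivAt 1 h3
    have h4 : HasDerivAt (fun t : ℝ => g (p, t)) ((fderiv ℝ g (p, 1) ∘L .inr ℝ R4 ℝ) 1) 1 := by
      have h5 : HasDerivAt (fun t : ℝ => (p, t)) ((0 : R4), (1 : ℝ)) 1 :=
        (hasDerivAt_const (1 : ℝ) p).prodMk (hasDerivAt_id (1 : ℝ))
      exact (hgs.differentiableAt (by simp)).hasFDerivAt.comp_hasDerivAt 1 h5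
    rw [h4.unique h1]
    exact hFp
  set τ := hgs.implicitFunction (by simp) hinv
  have hτ1 : τ p = 1 := hgs.implicitFunction_apply_self (by simp) hinv
  have hτs : ContDiffAt ℝ ∞ τ p := hgs.contDiffAt_implicitFunction (by simp) hinv
  have hτg : ∀ᶠ x in 𝓝 p, g (x, τ x) = 0 := by
    have := hgs.eventually_apply_implicitFunction (by simp) hinv
    simpa [hg, hF0] using this
  have hτpos : ∀ᶠ x in 𝓝 p, 0 < τ x :=
    hτs.continuousAt.eventually_const_lt (by rw [hτ1]; exact one_pos)
  have hcont : Filter.Tendsto (fun x => τ x • x) (𝓝 p) (𝓝 p) := by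
    have : ContinuousAt (fun x => τ x • x) p := hτs.continuousAt.smul continuousAt_id
    simpa [ContinuousAt, hτ1] using this
  refine (hτs.inv (by rw [hτ1]; exact one_ne_zero)).congr_of_eventuallyEq ?_
  filter_upwards [hτg, hτpos, hcont.eventually hfr] with x h1 h2 h3
  exact hX.gauge_eq_of_smul_mem_frontier h2 (h3 h1)

/-- The gauge of a star-shaped domain is a smooth gauge. -/
theorem isSmoothGauge (hX : IsStarShapedDomain X) : IsSmoothGauge (gauge X) where
  pos := fun _ hx => hX.gauge_pos hx
  map_smul := fun _ ht x => gauge_smul_pos ht x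
  contDiffAt := fun x hx => by
    have hc := hX.gauge_pos hx
    set c := gauge X x
    have h1 := hX.contDiffAt_gauge_of_mem_frontier (hX.inv_gauge_smul_mem_frontier hx)
    have h2 : gauge X = fun y => c * gauge X (c⁻¹ • y) := funext fun y => by
      rw [gauge_smul_pos (inv_pos.2 hc), mul_inv_cancel_left₀ hc.ne']
    rw [h2]
    exact contDiffAt_const.mul (ContDiffAt.comp (f := fun y : R4 => c⁻¹ • y) x h1 (by fun_prop))

end IsStarShapedDomain

/-! ### Reeb dynamics as Hamiltonian dynamics. -/

namespace IsSmoothGauge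

variable {H : R4 → ℝ}

theorem mem_tangentVectors_iff (hH : IsSmoothGauge H) {y : R4} (hy : H y = 1) (v : R4) :
    v ∈ tangentVectors {x | H x = 1} y ↔ fderiv ℝ H y v = 0 := by
  have hy0 := hH.ne_zero_of_eq_one hy
  constructor
  · rintro ⟨c, hc, rfl, hd⟩
    have h1 := (hH.differentiableAt hy0).hasFDerivAt.comp_hasDerivAt 0 hd
    have h2 : H ∘ c = fun _ => 1 := funext hc
    rw [h2] at h1
    exact h1.unique (hasDerivAt_const 0 1)
  · intro hv
    have hne : ∀ s : ℝ, y + s • v ≠ 0 := fun s h => by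
      have h1 := congrArg (fderiv ℝ H y) h
      rw [_root_.map_add, _root_.map_smul, hv, hH.fderiv_self hy0, hy, _root_.map_zero] at h1
      simp at h1
    have hlin : HasDerivAt (fun s : ℝ => y + s • v) v 0 := by
      simpa using ((hasDerivAt_id (0 : ℝ)).smul_const v).const_add y
    have hHd : HasDerivAt (fun s : ℝ => H (y + s • v)) 0 0 := by
      have : HasFDerivAt H (fderiv ℝ H y) (y + (0 : ℝ) • v) := by
        simpa using (hH.differentiableAt hy0).hasFDerivAt
      exact (this.comp_hasDerivAt 0 hlin).congr_deriv hv
    -- The straight line, projected radially to the level set. It avoids the origin because `dH_y(y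
    -- + s v) = 1`, and the rescaling is constant to first order because `dH_y(v) = 0`.
    refine ⟨fun s => (H (y + s • v))⁻¹ • (y + s • v), fun s => ?_, by simp [hy], ?_⟩
    · have := hH.pos _ (hne s)
      rw [mem_ofPred_eq, hH.map_smul _ (inv_pos.2 this), inv_mul_cancel₀ this.ne']
    · have := (hHd.inv (by simp [hy])).smul hlin
      exact this.congr_deriv (by simp [hy])

theorem fderiv_hamField_eq_zero (hH : IsSmoothGauge H) {y : R4} (hy : y ≠ 0) :
    fderiv ℝ H y (hamField H y) = 0 := by
  have h1 := omega_hamField H y (hamField H y)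
  rw [omega_self, hH.fderiv_sq hy] at h1
  have := (hH.pos y hy).ne'
  have h2 : 2 * H y * (fderiv ℝ H y) (hamField H y) = 0 := by linarith
  simpa [this] using h2

theorem lam_hamField (hH : IsSmoothGauge H) {y : R4} (hy : y ≠ 0) :
    lam y (hamField H y) = H y ^ 2 := by
  rw [lam_eq, omega_swap, omega_hamField, hH.fderiv_sq hy, hH.fderiv_self hy]; ring

end IsSmoothGauge

namespace IsStarShapedDomain

variable {X : Set R4}

theorem ne_zero_of_mem_frontier (hX : IsStarShapedDomain X) {y : R4} (hy : y ∈ frontier X) :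
    y ≠ 0 := fun h => hX.zero_notMem_frontier (h ▸ hy)

theorem mem_tangentVectors_iff (hX : IsStarShapedDomain X) {y : R4} (hy : y ∈ frontier X) {v : R4} :
    v ∈ tangentVectors (frontier X) y ↔ fderiv ℝ (gauge X) y v = 0 := by
  rw [hX.frontier_eq]
  exact hX.isSmoothGauge.mem_tangentVectors_iff (hX.mem_frontier_iff.1 hy) v

/-- The Reeb vector field is the Hamiltonian vector field of the squared gauge. -/
theorem isReebVector_iff (hX : IsStarShapedDomain X) {y : R4} (hy : y ∈ frontier X) {v : R4} :
    IsReebVector X y v ↔ v = hamField (gauge X) y := by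
  have hH := hX.isSmoothGauge
  have hy0 := hX.ne_zero_of_mem_frontier hy
  have hy1 := hX.mem_frontier_iff.1 hy
  have hker : ∀ w, fderiv ℝ (gauge X) y w = 0 → omega (hamField (gauge X) y) w = 0 := fun w hw => by
    rw [omega_hamField, hH.fderiv_sq hy0, hw, mul_zero, neg_zero]
  constructor
  · rintro ⟨-, hlam, hom⟩
    refine eq_of_omega_eq fun w => ?_
    -- Split `w` into a tangent part and a multiple of `y`. Pairing with tangent vectors is zero,
    -- and pairing with `y` is fixed by `λ(v) = 1`, so nondegeneracy determines `v`.
    set a := fderiv ℝ (gauge X) y w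
    have hw : fderiv ℝ (gauge X) y (w - a • y) = 0 := by
      rw [map_sub, map_smul, hH.fderiv_self hy0, hy1]; simp [a]
    have e : w = (w - a • y) + a • y := by abel
    have h1 := hom _ ((hX.mem_tangentVectors_iff hy).2 hw)
    have h2 := hker _ hw
    have h3 : omega v y = -2 := by
      rw [omega_swap]; rw [lam_eq] at hlam; linarith
    have h4 : omega (hamField (gauge X) y) y = -2 := by
      rw [omega_hamField, hH.fderiv_sq hy0, hH.fderiv_self hy0, hy1]; ring
    rw [e, omega_add_right, omega_add_right, h1, h2, omega_smul_right, omega_smul_right, h3, h4]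
  · rintro rfl
    refine ⟨(hX.mem_tangentVectors_iff hy).2 (hH.fderiv_hamField_eq_zero hy0), ?_, fun w hw => ?_⟩
    · rw [hH.lam_hamField hy0, hy1, one_pow]
    · exact hker w ((hX.mem_tangentVectors_iff hy).1 hw)

theorem flow_mem_frontier (hX : IsStarShapedDomain X) {y : R4} (hy : y ∈ frontier X) (t : ℝ) :
    hX.isSmoothGauge.flow t y ∈ frontier X := by
  rw [hX.mem_frontier_iff, hX.isSmoothGauge.map_flow, ← hX.mem_frontier_iff]
  exact hy

theorem isReebTrajectory_flow (hX : IsStarShapedDomain X) {y : R4} (hy : y ∈ frontier X) :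
    IsReebTrajectory X fun t => hX.isSmoothGauge.flow t y := fun t =>
  ⟨hX.flow_mem_frontier hy t, _, (hX.isReebVector_iff (hX.flow_mem_frontier hy t)).2 rfl,
    hX.isSmoothGauge.isFlowOf.hasDerivAt y t⟩

theorem eq_flow_of_isReebTrajectory (hX : IsStarShapedDomain X) {γ : ℝ → R4}
    (hγ : IsReebTrajectory X γ) (t : ℝ) : γ t = hX.isSmoothGauge.flow t (γ 0) :=
  hX.isSmoothGauge.isFlowOf.eq_of_hasDerivAt hX.isSmoothGauge.lipschitzWith_hamField (fun s => by
    obtain ⟨hs, v, hv, hd⟩ := hγ s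
    rwa [(hX.isReebVector_iff hs).1 hv] at hd) t

/-- The Reeb flow is the restriction of the Hamiltonian flow of the squared gauge. -/
theorem reebFlow_eq (hX : IsStarShapedDomain X) {y : R4} (hy : y ∈ frontier X) (t : ℝ) :
    reebFlow X t y = hX.isSmoothGauge.flow t y := by
  have h : ∃ γ, IsReebTrajectory X γ ∧ γ 0 = y :=
    ⟨_, hX.isReebTrajectory_flow hy, hX.isSmoothGauge.flow_zero y⟩
  rw [reebFlow, dif_pos h, hX.eq_flow_of_isReebTrajectory h.choose_spec.1, h.choose_spec.2]

/-- On vectors tangent to the boundary, the differential of the Reeb flow is that of the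
Hamiltonian flow. -/
theorem dReebFlow_eq (hX : IsStarShapedDomain X) {y : R4} (hy : y ∈ frontier X) (t : ℝ) {v : R4}
    (hv : v ∈ tangentVectors (frontier X) y) :
    dReebFlow X t y v = fderiv ℝ (hX.isSmoothGauge.flow t) y v := by
  have hd : HasFDerivWithinAt (reebFlow X t) (fderiv ℝ (hX.isSmoothGauge.flow t) y)
      (frontier X) y :=
    (hX.isSmoothGauge.hasFDerivAt_flow t (hX.ne_zero_of_mem_frontier hy)).hasFDerivWithinAt.congr
      (fun z hz => hX.reebFlow_eq hz t) (hX.reebFlow_eq hy t)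
  -- Derivatives within a hypersurface are not unique; composing with a curve of velocity `v` in the
  -- boundary shows that any two agree on `v`.
  have hd' := hd.differentiableWithinAt.hasFDerivWithinAt
  obtain ⟨c, hc, rfl, hcd⟩ := hv
  have h1 := hd.comp_hasDerivAt (x := (0 : ℝ)) hcd (.of_forall hc)
  have h2 := hd'.comp_hasDerivAt (x := (0 : ℝ)) hcd (.of_forall hc)
  exact h2.unique h1

end IsStarShapedDomain

end StarShaped

/-! ### Radial projection and the Poincaré lemma on a cone. -/

namespace StarShaped

namespace IsStarShapedDomain

variable {X : Set R4}

/-- At a boundary point every direction with `d(gauge) < 0` enters `X`, and these directions form a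
nonempty open set, which spans. This makes `fderivWithin` of `φ` meaningful up to the boundary. -/
theorem uniqueDiffOn (hX : IsStarShapedDomain X) : UniqueDiffOn ℝ X := by
  intro x hx
  by_cases hi : x ∈ interior X
  · exact uniqueDiffWithinAt_of_mem_nhds (mem_interior_iff_mem_nhds.1 hi)
  have hxf : x ∈ frontier X := ⟨subset_closure hx, hi⟩
  have hH := hX.isSmoothGauge
  have hx0 := hX.ne_zero_of_mem_frontier hxf
  set L := fderiv ℝ (gauge X) x
  have hsub : {v | L v < 0} ⊆ tangentConeAt ℝ X x := fun v hv => by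
    have hd : HasDerivAt (fun s : ℝ => gauge X (x + s • v)) (L v) 0 := by
      have h1 : HasFDerivAt (gauge X) L (x + (0 : ℝ) • v) := by
        simpa using (hH.differentiableAt hx0).hasFDerivAt
      have h2 : HasDerivAt (fun s : ℝ => x + s • v) v 0 := by
        simpa using ((hasDerivAt_id (0 : ℝ)).smul_const v).const_add x
      exact h1.comp_hasDerivAt 0 h2
    have hslope := (hasDerivAt_iff_tendsto_slope.1 hd).eventually_lt_const hv
    have hr : 𝓝[>] (0 : ℝ) ≤ 𝓝[≠] 0 := nhdsWithin_mono _ fun s hs => (mem_Ioi.1 hs).ne'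
    refine mem_tangentConeAt_of_add_smul_mem (l := 𝓝[>] (0 : ℝ)) (c := id)
      (Filter.tendsto_id.mono_left hr) ?_
    filter_upwards [hr hslope, self_mem_nhdsWithin] with s hs hs0
    rw [hX.mem_iff]
    have hs0' : 0 < s := hs0
    have e : slope (fun s : ℝ => gauge X (x + s • v)) 0 s = (gauge X (x + s • v) - 1) / s := by
      rw [slope_def_field]; simp [hX.mem_frontier_iff.1 hxf]
    have hs' : slope (fun s : ℝ => gauge X (x + s • v)) 0 s < 0 := hs
    rw [e, div_neg_iff] at hs'
    simp only [id]
    rcases hs' with h | h <;> linarith [h.1, h.2]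
  refine ⟨?_, subset_closure hx⟩
  have hopen : IsOpen {v | L v < 0} := isOpen_lt L.continuous continuous_const
  have hne : -x ∈ {v | L v < 0} := by
    have : L x = 1 := by rw [hH.fderiv_self hx0, hX.mem_frontier_iff.1 hxf]
    simp [this]
  have htop : Submodule.span ℝ (tangentConeAt ℝ X x) = ⊤ := by
    refine Submodule.eq_top_of_nonempty_interior' _
      ⟨-x, mem_interior.2 ⟨_, hsub.trans Submodule.subset_span, hopen, hne⟩⟩
  rw [htop]
  exact dense_univ

theorem radialProj_mem_frontier (hX : IsStarShapedDomain X) {x : R4} (hx : x ≠ 0) :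
    radialProj X x ∈ frontier X := hX.inv_gauge_smul_mem_frontier hx

theorem radialProj_mem (hX : IsStarShapedDomain X) {x : R4} (hx : x ≠ 0) :
    radialProj X x ∈ X := hX.isClosed.frontier_subset (hX.radialProj_mem_frontier hx)

theorem smul_radialProj_mem (hX : IsStarShapedDomain X) {x : R4} (hx : x ≠ 0) {t : ℝ}
    (ht : t ∈ Icc (0 : ℝ) 1) : t • radialProj X x ∈ X := by
  rw [hX.mem_iff, gauge_smul_of_nonneg ht.1, hX.mem_frontier_iff.1 (hX.radialProj_mem_frontier hx),
    smul_eq_mul, mul_one]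
  exact ht.2

theorem smul_radialProj_mem_interior (hX : IsStarShapedDomain X) {x : R4} (hx : x ≠ 0) {t : ℝ}
    (ht : t ∈ Ioo (0 : ℝ) 1) : t • radialProj X x ∈ interior X := by
  rw [hX.mem_interior_iff, gauge_smul_of_nonneg ht.1.le,
    hX.mem_frontier_iff.1 (hX.radialProj_mem_frontier hx), smul_eq_mul, mul_one]
  exact ht.2

theorem radialProj_eq_self (hX : IsStarShapedDomain X) {x : R4} (hx : x ∈ frontier X) :
    radialProj X x = x := by
  rw [radialProj, hX.mem_frontier_iff.1 hx, inv_one, one_smul]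

theorem gauge_smul_radialProj (hX : IsStarShapedDomain X) {x : R4} (hx : x ≠ 0) :
    gauge X x • radialProj X x = x := by
  rw [radialProj, smul_smul, mul_inv_cancel₀ (hX.gauge_pos hx).ne', one_smul]

theorem radialProj_smul {c : ℝ} (hc : 0 < c) (x : R4) :
    radialProj X (c • x) = radialProj X x := by
  rw [radialProj, radialProj, gauge_smul_pos hc, smul_smul, mul_inv, mul_comm c⁻¹, mul_assoc,
    inv_mul_cancel₀ hc.ne', mul_one]

theorem contDiffAt_radialProj (hX : IsStarShapedDomain X) {x : R4} (hx : x ≠ 0) :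
    ContDiffAt ℝ ∞ (radialProj X) x :=
  ((hX.isSmoothGauge.contDiffAt x hx).inv (hX.gauge_pos hx).ne').smul contDiffAt_id

theorem contDiffOn_radialProj (hX : IsStarShapedDomain X) :
    ContDiffOn ℝ ∞ (radialProj X) {0}ᶜ :=
  fun _ hx => (hX.contDiffAt_radialProj hx).contDiffWithinAt

theorem hasFDerivAt_radialProj (hX : IsStarShapedDomain X) {x : R4} (hx : x ≠ 0) :
    HasFDerivAt (radialProj X) (fderiv ℝ (radialProj X) x) x :=
  ((hX.contDiffAt_radialProj hx).differentiableAt (by simp)).hasFDerivAt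

theorem fderiv_radialProj_apply (hX : IsStarShapedDomain X) {x : R4} (hx : x ≠ 0) (u : R4) :
    fderiv ℝ (radialProj X) x u =
      (gauge X x)⁻¹ • (u - fderiv ℝ (gauge X) x u • radialProj X x) := by
  have hp := (hX.gauge_pos hx).ne'
  have h1 := (hX.isSmoothGauge.differentiableAt hx).hasFDerivAt
  have h2 : HasFDerivAt (fun y => (gauge X y)⁻¹) _ x := (hasFDerivAt_inv hp).comp x h1
  have h3 := h2.smul (hasFDerivAt_id x)
  have h4 : fderiv ℝ (radialProj X) x = _ := h3.fderiv
  rw [h4]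
  simp only [radialProj, id, add_apply, smul_apply, ContinuousLinearMap.smulRight_apply,
    ContinuousLinearMap.comp_apply, ContinuousLinearMap.id_apply, smul_sub, smul_smul]
  rw [sub_eq_add_neg, ← neg_smul]
  congr 2
  simp
  field_simp

end IsStarShapedDomain

/-- Differentiation under the integral sign for a jointly continuous derivative. -/
theorem hasFDerivAt_intervalIntegral_of_continuousOn {E : Type*} [NormedAddCommGroup E]
    [NormedSpace ℝ E] [ProperSpace E] {U : Set E} (hU : IsOpen U)
    {F : E → ℝ → ℝ} {F' : E → ℝ → E →L[ℝ] ℝ}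
    (hF : ∀ x ∈ U, ContinuousOn (F x) (Icc 0 1))
    (hF' : ContinuousOn (fun q : E × ℝ => F' q.1 q.2) (U ×ˢ Icc 0 1))
    (hd : ∀ x ∈ U, ∀ t ∈ Icc (0 : ℝ) 1, HasFDerivAt (fun y => F y t) (F' x t) x)
    {x : E} (hx : x ∈ U) :
    HasFDerivAt (fun y => ∫ t in (0 : ℝ)..1, F y t) (∫ t in (0 : ℝ)..1, F' x t) x := by
  obtain ⟨r, hr, hrU⟩ := Metric.isOpen_iff.1 hU x hx
  have hball : closedBall x (r / 2) ⊆ U := (closedBall_subset_ball (by linarith)).trans hrU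
  obtain ⟨C, hC⟩ := ((isCompact_closedBall x (r / 2)).prod
    (isCompact_Icc (a := (0 : ℝ)) (b := 1))).exists_bound_of_continuousOn
    (hF'.mono (prod_mono hball Subset.rfl))
  have h01 : (uIoc (0 : ℝ) 1) ⊆ Icc 0 1 := by
    rw [uIoc_of_le zero_le_one]; exact Ioc_subset_Icc_self
  have hF'x : ContinuousOn (F' x) (Icc 0 1) :=
    hF'.comp (f := fun t => (x, t)) (by fun_prop) fun t ht => ⟨hx, ht⟩
  refine intervalIntegral.hasFDerivAt_integral_of_dominated_of_fderiv_le
    (s := closedBall x (r / 2)) (bound := fun _ => C) (closedBall_mem_nhds x (by linarith)) ?_ ?_ ?_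
    (.of_forall fun t ht y hy => hC (y, t) ⟨hy, h01 ht⟩) intervalIntegrable_const
    (.of_forall fun t ht y hy => hd y (hball hy) t (h01 ht))
  · filter_upwards [hU.mem_nhds hx] with y hy
    exact ((hF y hy).mono h01).aestronglyMeasurable measurableSet_uIoc
  · exact (hF x hx).intervalIntegrable_of_Icc zero_le_one
  · exact (hF'x.mono h01).aestronglyMeasurable measurableSet_uIoc

end StarShaped

namespace StarShaped

/-- The derivative in `x` of `α_{t p(x)} (p x)`, where `p` is the radial projection. -/
noncomputable def coneDeriv (X : Set R4) (α : R4 → R4 →L[ℝ] ℝ) (x : R4) (t : ℝ) : R4 →L[ℝ] ℝ :=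
  ((fderivWithin ℝ α X (t • radialProj X x)).flip (radialProj X x)).comp
      (t • fderiv ℝ (radialProj X) x) +
    (α (t • radialProj X x)).comp (fderiv ℝ (radialProj X) x)

namespace IsStarShapedDomain

variable {X : Set R4} {α : R4 → R4 →L[ℝ] ℝ}

theorem hasFDerivAt_coneDeriv (hX : IsStarShapedDomain X) (hα : ContDiffOn ℝ 1 α X) {y : R4}
    (hy : y ≠ 0) {t : ℝ} (ht : t ∈ Icc (0 : ℝ) 1) :
    HasFDerivAt (fun z => α (t • radialProj X z) (radialProj X z)) (coneDeriv X α y t) y := by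
  have h1 : HasFDerivAt (fun z => t • radialProj X z) (t • fderiv ℝ (radialProj X) y) y :=
    (hX.hasFDerivAt_radialProj hy).const_smul t
  have h2 : HasFDerivWithinAt α (fderivWithin ℝ α X (t • radialProj X y)) X (t • radialProj X y) :=
    (hα.differentiableOn one_ne_zero _ (hX.smul_radialProj_mem hy ht)).hasFDerivWithinAt
  have h3 : HasFDerivAt (fun z => α (t • radialProj X z))
      ((fderivWithin ℝ α X (t • radialProj X y)).comp (t • fderiv ℝ (radialProj X) y)) y := by
    have h4 : HasFDerivWithinAt (fun z => t • radialProj X z) (t • fderiv ℝ (radialProj X) y)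
      {0}ᶜ y := h1.hasFDerivWithinAt
    exact (h2.comp y h4 (fun z hz => hX.smul_radialProj_mem hz ht)).hasFDerivAt
      (isOpen_compl_singleton.mem_nhds hy)
  refine (h3.clm_apply (hX.hasFDerivAt_radialProj hy)).congr_fderiv ?_
  ext u
  simp only [coneDeriv, add_apply, ContinuousLinearMap.comp_apply, ContinuousLinearMap.flip_apply]
  rw [add_comm]

theorem mapsTo_smul_radialProj (hX : IsStarShapedDomain X) :
    MapsTo (fun q : R4 × ℝ => q.2 • radialProj X q.1) ({0}ᶜ ×ˢ Icc (0 : ℝ) 1) X :=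
  fun _ hq => hX.smul_radialProj_mem hq.1 hq.2

theorem continuousOn_smul_radialProj (hX : IsStarShapedDomain X) :
    ContinuousOn (fun q : R4 × ℝ => q.2 • radialProj X q.1) ({0}ᶜ ×ˢ Icc (0 : ℝ) 1) :=
  continuousOn_snd.smul (hX.contDiffOn_radialProj.continuousOn.comp continuousOn_fst
    fun _ hq => hq.1)

theorem continuousOn_coneDeriv (hX : IsStarShapedDomain X) (hα : ContDiffOn ℝ 1 α X) :
    ContinuousOn (fun q : R4 × ℝ => coneDeriv X α q.1 q.2) ({0}ᶜ ×ˢ Icc 0 1) := by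
  have hp1 : ContinuousOn (fun q : R4 × ℝ => radialProj X q.1) ({0}ᶜ ×ˢ Icc (0 : ℝ) 1) :=
    hX.contDiffOn_radialProj.continuousOn.comp continuousOn_fst fun q hq => hq.1
  have hp2 : ContinuousOn (fun q : R4 × ℝ => fderiv ℝ (radialProj X) q.1)
      ({0}ᶜ ×ˢ Icc (0 : ℝ) 1) :=
    (hX.contDiffOn_radialProj.continuousOn_fderiv_of_isOpen isOpen_compl_singleton
      (by simp)).comp continuousOn_fst fun q hq => hq.1
  have h1 := hα.continuousOn.comp hX.continuousOn_smul_radialProj hX.mapsTo_smul_radialProj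
  have h2 := (hα.continuousOn_fderivWithin hX.uniqueDiffOn le_rfl).comp
    hX.continuousOn_smul_radialProj hX.mapsTo_smul_radialProj
  have h3 : ContinuousOn (fun q : R4 × ℝ => (fderivWithin ℝ α X (q.2 • radialProj X q.1)).flip)
      ({0}ᶜ ×ˢ Icc (0 : ℝ) 1) :=
    (ContinuousLinearMap.flipₗᵢ ℝ R4 R4 ℝ).continuous.comp_continuousOn h2
  exact ((h3.clm_apply hp1).clm_comp (continuousOn_snd.smul hp2)).add (h1.clm_comp hp2)

/-- The core of the Poincaré lemma: closedness exchanges the arguments of `Dα` and turns the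
derivative in `x` of `α_{tp}(p)` into the derivative in `t` of `t α_{tp}(dp)`. -/
theorem hasDerivAt_mul_coneDeriv (hX : IsStarShapedDomain X) (hα : ContDiffOn ℝ 1 α X)
    (hsymm : ∀ z ∈ interior X, ∀ u v, fderiv ℝ α z u v = fderiv ℝ α z v u) {x : R4} (hx : x ≠ 0)
    (u : R4) {t : ℝ} (ht : t ∈ Ioo (0 : ℝ) 1) :
    HasDerivAt (fun t : ℝ => t * α (t • radialProj X x) (fderiv ℝ (radialProj X) x u))
      (coneDeriv X α x t u) t := by
  have hint := hX.smul_radialProj_mem_interior hx ht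
  have hnhds := mem_interior_iff_mem_nhds.1 hint
  have h1 : HasFDerivAt α (fderiv ℝ α (t • radialProj X x)) (t • radialProj X x) :=
    ((hα.contDiffAt hnhds).differentiableAt one_ne_zero).hasFDerivAt
  have h2 : HasDerivAt (fun s : ℝ => s • radialProj X x) (radialProj X x) t := by
    simpa using (hasDerivAt_id t).smul_const (radialProj X x)
  have h3 : HasDerivAt (fun s : ℝ => α (s • radialProj X x))
      (fderiv ℝ α (t • radialProj X x) (radialProj X x)) t :=
    h1.comp_hasDerivAt t h2
  have h4 := h3.clm_apply (hasDerivAt_const t (fderiv ℝ (radialProj X) x u))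
  refine ((hasDerivAt_id t).mul h4).congr_deriv ?_
  have h5 := hsymm _ hint (radialProj X x) (fderiv ℝ (radialProj X) x u)
  simp only [coneDeriv, fderivWithin_of_mem_nhds hnhds, add_apply, ContinuousLinearMap.comp_apply,
    ContinuousLinearMap.flip_apply, smul_apply, _root_.map_smul, h5, id, _root_.map_zero, add_zero,
    one_mul, smul_eq_mul]
  ring

end IsStarShapedDomain

end StarShaped

namespace StarShaped
namespace IsStarShapedDomain
variable {X : Set R4} {α : R4 → R4 →L[ℝ] ℝ}

theorem continuousOn_coneDeriv_slice (hX : IsStarShapedDomain X) (hα : ContDiffOn ℝ 1 α X) {x : R4}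
    (hx : x ≠ 0) : ContinuousOn (fun t => coneDeriv X α x t) (Icc 0 1) :=
  (hX.continuousOn_coneDeriv hα).comp (f := fun t : ℝ => (x, t)) (by fun_prop)
    (fun _ ht => ⟨hx, ht⟩)

theorem continuousOn_smul_radialProj_slice (hX : IsStarShapedDomain X) (hα : ContDiffOn ℝ 1 α X)
    {x : R4} (hx : x ≠ 0) : ContinuousOn (fun t : ℝ => α (t • radialProj X x)) (Icc 0 1) :=
  hα.continuousOn.comp (f := fun t : ℝ => t • radialProj X x) (by fun_prop)
    (fun _ ht => hX.smul_radialProj_mem hx ht)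

/-- Integrate the preceding identity over `t`: the factor `t` kills the lower endpoint. Closedness
is only known in the interior, which suffices because `t p(x)` is interior for `0 < t < 1` and
everything is continuous up to the ends. -/
theorem integral_coneDeriv (hX : IsStarShapedDomain X) (hα : ContDiffOn ℝ 1 α X)
    (hsymm : ∀ z ∈ interior X, ∀ u v, fderiv ℝ α z u v = fderiv ℝ α z v u) {x : R4} (hx : x ≠ 0) :
    ∫ t in (0 : ℝ)..1, coneDeriv X α x t =
      (α (radialProj X x)).comp (fderiv ℝ (radialProj X) x) := by
  refine ContinuousLinearMap.ext fun u => ?_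
  have hc := hX.continuousOn_coneDeriv_slice hα hx
  have happ : (∫ t in (0 : ℝ)..1, coneDeriv X α x t) u = ∫ t in (0 : ℝ)..1, coneDeriv X α x t u :=
    ContinuousLinearMap.intervalIntegral_apply (hc.intervalIntegrable_of_Icc zero_le_one) u
  have hFTC := intervalIntegral.integral_eq_sub_of_hasDerivAt_of_le zero_le_one
    (continuousOn_id.mul ((hX.continuousOn_smul_radialProj_slice hα hx).clm_apply
      (continuousOn_const (c := fderiv ℝ (radialProj X) x u))))
    (fun t ht => hX.hasDerivAt_mul_coneDeriv hα hsymm hx u ht)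
    ((hc.clm_apply continuousOn_const).intervalIntegrable_of_Icc zero_le_one)
  rw [happ, hFTC]
  simp

/-- A closed 1-form on a star-shaped domain has a primitive along the boundary, here pulled back to
`ℝ⁴ ∖ 0` by the radial projection. -/
theorem exists_primitive (hX : IsStarShapedDomain X) (hα : ContDiffOn ℝ 1 α X)
    (hsymm : ∀ z ∈ interior X, ∀ u v, fderiv ℝ α z u v = fderiv ℝ α z v u) :
    ∃ f : R4 → ℝ, (∀ c : ℝ, 0 < c → ∀ x, f (c • x) = f x) ∧ ∀ x, x ≠ 0 →
      HasFDerivAt f ((α (radialProj X x)).comp (fderiv ℝ (radialProj X) x)) x := by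
  -- The integral of `α` along the segment from the origin to `p(x)`.
  refine ⟨fun x => ∫ t in (0 : ℝ)..1, α (t • radialProj X x) (radialProj X x),
    fun c hc x => ?_, fun x hx => ?_⟩
  · simp only [radialProj_smul hc]
  rw [← hX.integral_coneDeriv hα hsymm hx]
  exact hasFDerivAt_intervalIntegral_of_continuousOn (E := R4)
    (F := fun y t => α (t • radialProj X y) (radialProj X y)) (F' := coneDeriv X α)
    isOpen_compl_singleton
    (fun y hy => (hX.continuousOn_smul_radialProj_slice hα hy).clm_apply continuousOn_const)
    (hX.continuousOn_coneDeriv hα)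
    (fun y hy t ht => hX.hasFDerivAt_coneDeriv hα hy ht) hx

end IsStarShapedDomain

end StarShaped

/-! ### Homogeneous symplectic maps and removal of the twist. -/

namespace StarShaped

/-- A `C¹` positively homogeneous symplectic map of `ℝ⁴ ∖ 0` that carries the gauge `H` to `H'`;
it restricts to a strict contactomorphism `{H = 1} → {H' = 1}`. -/
structure IsHomSympl (H H' : R4 → ℝ) (Ψ : R4 → R4) : Prop where
  contDiffOn : ContDiffOn ℝ 1 Ψ {0}ᶜ
  map_smul : ∀ c : ℝ, 0 < c → ∀ x, x ≠ 0 → Ψ (c • x) = c • Ψ x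
  gauge_map : ∀ x, x ≠ 0 → H' (Ψ x) = H x
  omega_fderiv : ∀ x, x ≠ 0 → ∀ u v, omega (fderiv ℝ Ψ x u) (fderiv ℝ Ψ x v) = omega u v

/-- A `C¹` positively homogeneous map `a` with `H' ∘ a = H` such that
`a^* ω + df ∧ d(H²) = ω` for the function `f`, which is homogeneous of degree `0`. -/
structure IsTwistedSympl (H H' : R4 → ℝ) (a : R4 → R4) (f : R4 → ℝ) : Prop where
  contDiffOn : ContDiffOn ℝ 1 a {0}ᶜ
  map_smul : ∀ c : ℝ, 0 < c → ∀ x, x ≠ 0 → a (c • x) = c • a x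
  gauge_map : ∀ x, x ≠ 0 → H' (a x) = H x
  contDiffOn_twist : ContDiffOn ℝ 1 f {0}ᶜ
  twist_smul : ∀ c : ℝ, 0 < c → ∀ x, x ≠ 0 → f (c • x) = f x
  omega_fderiv : ∀ x, x ≠ 0 → ∀ u v, omega (fderiv ℝ a x u) (fderiv ℝ a x v) +
    fderiv ℝ f x u * fderiv ℝ (fun y => H y ^ 2) x v -
    fderiv ℝ f x v * fderiv ℝ (fun y => H y ^ 2) x u = omega u v

theorem ContDiffOn.hasFDerivAt_of_ne_zero {F : Type*} [NormedAddCommGroup F] [NormedSpace ℝ F]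
    {g : R4 → F} (hg : ContDiffOn ℝ 1 g {0}ᶜ) {x : R4} (hx : x ≠ 0) :
    HasFDerivAt g (fderiv ℝ g x) x :=
  ((hg.contDiffAt (isOpen_compl_singleton.mem_nhds hx)).differentiableAt one_ne_zero).hasFDerivAt

theorem ne_zero_of_gauge_map {H H' : R4 → ℝ} (hH : IsSmoothGauge H) (hH' : IsSmoothGauge H')
    {a : R4 → R4} (ha : ∀ x, x ≠ 0 → H' (a x) = H x) {x : R4} (hx : x ≠ 0) : a x ≠ 0 := by
  intro h
  have := ha x hx
  rw [h, hH'.map_zero] at this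
  exact (hH.pos x hx).ne this

variable {H H' : R4 → ℝ} {a b Ψ : R4 → R4} {f : R4 → ℝ}

namespace IsTwistedSympl

theorem hasFDerivAt_flow_comp (hH : IsSmoothGauge H) (hH' : IsSmoothGauge H')
    (h : IsTwistedSympl H H' a f) {x : R4} (hx : x ≠ 0) :
    HasFDerivAt (fun y => hH'.flow (-f y) (a y))
      (((ContinuousLinearMap.toSpanSingleton ℝ (hamField H' (hH'.flow (-f x) (a x)))).coprod
        (fderiv ℝ (hH'.flow (-f x)) (a x))).comp ((-fderiv ℝ f x).prod (fderiv ℝ a x))) x := by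
  have h1 := hH'.hasFDerivAt_uncurry_flow (-f x) (ne_zero_of_gauge_map hH hH' h.gauge_map hx)
  have h2 : HasFDerivAt (fun y => (-f y, a y)) ((-fderiv ℝ f x).prod (fderiv ℝ a x)) x :=
    (ContDiffOn.hasFDerivAt_of_ne_zero h.contDiffOn_twist hx).neg.prodMk
      (ContDiffOn.hasFDerivAt_of_ne_zero h.contDiffOn hx)
  exact HasFDerivAt.comp (f := fun y => (-f y, a y)) x h1 h2

/-- Following the Hamiltonian flow for the time `-f` removes the twist. -/
theorem isHomSympl (hH : IsSmoothGauge H) (hH' : IsSmoothGauge H')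
    (h : IsTwistedSympl H H' a f) :
    IsHomSympl H H' fun x => hH'.flow (-f x) (a x) where
  contDiffOn := by
    have h1 : ContDiffOn ℝ 1 (fun y => (-f y, a y)) {0}ᶜ :=
      h.contDiffOn_twist.neg.prodMk h.contDiffOn
    exact hH'.contDiffOn_flow.comp h1 fun x hx =>
      ⟨mem_univ _, ne_zero_of_gauge_map hH hH' h.gauge_map hx⟩
  map_smul c hc x hx := by
    rw [h.map_smul c hc x hx, h.twist_smul c hc x hx, hH'.flow_smul _ hc]
  gauge_map x hx := by rw [hH'.map_flow, h.gauge_map x hx]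
  omega_fderiv x hx u v := by
    have ha := ne_zero_of_gauge_map hH hH' h.gauge_map hx
    rw [(h.hasFDerivAt_flow_comp hH hH' hx).fderiv]
    simp only [ContinuousLinearMap.comp_apply, ContinuousLinearMap.prod_apply,
      ContinuousLinearMap.coprod_apply, ContinuousLinearMap.toSpanSingleton_apply,
      ← hH'.fderiv_flow_hamField (-f x) ha, neg_apply]
    have hG : ∀ w, fderiv ℝ (fun y => H y ^ 2) x w =
        fderiv ℝ (fun y => H' y ^ 2) (a x) (fderiv ℝ a x w) := fun w => by
      have h1 : HasFDerivAt (fun y => H' (a y) ^ 2)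
          ((fderiv ℝ (fun y => H' y ^ 2) (a x)).comp (fderiv ℝ a x)) x :=
        HasFDerivAt.comp (g := fun y => H' y ^ 2) x
          ((hH'.contDiffAt_sq ha).differentiableAt (by simp)).hasFDerivAt
          (ContDiffOn.hasFDerivAt_of_ne_zero h.contDiffOn hx)
      have h2 : (fun y => H' (a y) ^ 2) =ᶠ[𝓝 x] fun y => H y ^ 2 := by
        filter_upwards [isOpen_compl_singleton.mem_nhds hx] with y hy
        rw [h.gauge_map y hy]
      rw [← h2.fderiv_eq, h1.fderiv]
      rfl
    -- The field at the endpoint is `DΦ` of the field at `a(x)`, so the whole derivative is `DΦ`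
    -- applied to `Da(u) - df(u) V`. As `DΦ` is symplectic it drops out, and the cross terms with
    -- `V` are the twist.
    rw [← _root_.map_smul, ← _root_.map_smul, ← _root_.map_add, ← _root_.map_add,
      hH'.omega_fderiv_flow _ ha]
    simp only [omega_add_left, omega_add_right, omega_smul_left, omega_smul_right, omega_self,
      omega_hamField, omega_swap _ (hamField H' (a x)), ← hG]
    rw [← h.omega_fderiv x hx u v]
    ring

/-- Pull the identity `a^*ω + df ∧ d(H²) = ω` back by `b = a⁻¹`; moving the twist to the other side
changes its sign. -/
theorem inverse (hH : IsSmoothGauge H) (h : IsTwistedSympl H H' a f)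
    (hb : ContDiffOn ℝ 1 b {0}ᶜ) (hb0 : ∀ x, x ≠ 0 → b x ≠ 0)
    (hab : ∀ x, x ≠ 0 → a (b x) = x) (hba : ∀ x, x ≠ 0 → b (a x) = x) :
    IsTwistedSympl H' H b fun x => -f (b x) where
  contDiffOn := hb
  map_smul c hc x hx := by
    have h1 := h.map_smul c hc (b x) (hb0 x hx)
    rw [hab x hx] at h1
    rw [← h1, hba _ (smul_ne_zero hc.ne' (hb0 x hx))]
  gauge_map x hx := by rw [← h.gauge_map _ (hb0 x hx), hab x hx]
  contDiffOn_twist := (h.contDiffOn_twist.comp hb hb0).neg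
  twist_smul c hc x hx := by
    have h1 := h.map_smul c hc (b x) (hb0 x hx)
    rw [hab x hx] at h1
    rw [← h1, hba _ (smul_ne_zero hc.ne' (hb0 x hx)), h.twist_smul c hc _ (hb0 x hx)]
  omega_fderiv x hx u v := by
    have hbx := hb0 x hx
    have hDb := ContDiffOn.hasFDerivAt_of_ne_zero hb hx
    have hDa := ContDiffOn.hasFDerivAt_of_ne_zero h.contDiffOn hbx
    have hDf := ContDiffOn.hasFDerivAt_of_ne_zero h.contDiffOn_twist hbx
    have hid : ∀ w, fderiv ℝ a (b x) (fderiv ℝ b x w) = w := fun w => by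
      have h1 : HasFDerivAt (fun y => a (b y)) ((fderiv ℝ a (b x)).comp (fderiv ℝ b x)) x :=
        hDa.comp x hDb
      have h2 : (fun y => a (b y)) =ᶠ[𝓝 x] id := by
        filter_upwards [isOpen_compl_singleton.mem_nhds hx] with y hy
        exact hab y hy
      have h3 := h2.fderiv_eq (𝕜 := ℝ)
      rw [h1.fderiv, fderiv_id] at h3
      exact congrArg (fun L : R4 →L[ℝ] R4 => L w) h3
    have hf : ∀ w, fderiv ℝ (fun y => -f (b y)) x w = -fderiv ℝ f (b x) (fderiv ℝ b x w) :=
      fun w => by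
        have h1 : HasFDerivAt (fun y => -f (b y)) (-((fderiv ℝ f (b x)).comp (fderiv ℝ b x))) x :=
          (hDf.comp x hDb).neg
        rw [h1.fderiv]
        rfl
    have hG : ∀ w, fderiv ℝ (fun y => H' y ^ 2) x w =
        fderiv ℝ (fun y => H y ^ 2) (b x) (fderiv ℝ b x w) := fun w => by
      have h1 : HasFDerivAt (fun y => H (b y) ^ 2)
          ((fderiv ℝ (fun y => H y ^ 2) (b x)).comp (fderiv ℝ b x)) x :=
        HasFDerivAt.comp (g := fun y => H y ^ 2) x
          ((hH.contDiffAt_sq hbx).differentiableAt (by simp)).hasFDerivAt hDb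
      have h2 : (fun y => H (b y) ^ 2) =ᶠ[𝓝 x] fun y => H' y ^ 2 := by
        filter_upwards [isOpen_compl_singleton.mem_nhds hx] with y hy
        rw [← h.gauge_map _ (hb0 y hy), hab y hy]
      rw [← h2.fderiv_eq, h1.fderiv]
      rfl
    have key := h.omega_fderiv (b x) hbx (fderiv ℝ b x u) (fderiv ℝ b x v)
    rw [hid, hid] at key
    rw [hf, hf, hG, hG, ← key]
    ring

end IsTwistedSympl

namespace IsHomSympl

theorem ne_zero (hH : IsSmoothGauge H) (hH' : IsSmoothGauge H') (h : IsHomSympl H H' Ψ) {x : R4}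
    (hx : x ≠ 0) : Ψ x ≠ 0 := ne_zero_of_gauge_map hH hH' h.gauge_map hx

theorem hasFDerivAt (h : IsHomSympl H H' Ψ) {x : R4} (hx : x ≠ 0) :
    HasFDerivAt Ψ (fderiv ℝ Ψ x) x :=
  ContDiffOn.hasFDerivAt_of_ne_zero h.contDiffOn hx

theorem fderiv_surjective (h : IsHomSympl H H' Ψ) {x : R4} (hx : x ≠ 0) :
    Function.Surjective (fderiv ℝ Ψ x) := by
  have hinj : Function.Injective (fderiv ℝ Ψ x : R4 →ₗ[ℝ] R4) := by
    refine (injective_iff_map_eq_zero _).2 fun u hu => eq_zero_of_omega_eq_zero fun w => ?_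
    have hu' : fderiv ℝ Ψ x u = 0 := hu
    rw [← h.omega_fderiv x hx, hu', ← omegaL_apply]
    simp
  exact LinearMap.injective_iff_surjective.1 hinj

theorem fderiv_gauge (hH : IsSmoothGauge H) (hH' : IsSmoothGauge H') (h : IsHomSympl H H' Ψ)
    {x : R4} (hx : x ≠ 0) (w : R4) :
    fderiv ℝ H' (Ψ x) (fderiv ℝ Ψ x w) = fderiv ℝ H x w := by
  have h1 : HasFDerivAt (fun y => H' (Ψ y)) ((fderiv ℝ H' (Ψ x)).comp (fderiv ℝ Ψ x)) x :=
    (hH'.differentiableAt (h.ne_zero hH hH' hx)).hasFDerivAt.comp x (h.hasFDerivAt hx)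
  have h2 : (fun y => H' (Ψ y)) =ᶠ[𝓝 x] H := by
    filter_upwards [isOpen_compl_singleton.mem_nhds hx] with y hy
    exact h.gauge_map y hy
  rw [← h2.fderiv_eq, h1.fderiv]
  rfl

/-- The Hamiltonian field is determined by `ω` and `H²`, both of which `Ψ` preserves. -/
theorem fderiv_hamField (hH : IsSmoothGauge H) (hH' : IsSmoothGauge H') (h : IsHomSympl H H' Ψ)
    {x : R4} (hx : x ≠ 0) : fderiv ℝ Ψ x (hamField H x) = hamField H' (Ψ x) := by
  refine eq_of_omega_eq fun w' => ?_
  obtain ⟨w, rfl⟩ := h.fderiv_surjective hx w'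
  rw [h.omega_fderiv x hx, omega_hamField, omega_hamField, hH.fderiv_sq hx,
    hH'.fderiv_sq (h.ne_zero hH hH' hx), h.fderiv_gauge hH hH' hx, h.gauge_map x hx]

theorem map_flow (hH : IsSmoothGauge H) (hH' : IsSmoothGauge H') (h : IsHomSympl H H' Ψ)
    {x : R4} (hx : x ≠ 0) (t : ℝ) : Ψ (hH.flow t x) = hH'.flow t (Ψ x) := by
  have := hH'.isFlowOf.eq_of_hasDerivAt hH'.lipschitzWith_hamField
    (γ := fun t => Ψ (hH.flow t x)) (fun s => by
      have hs := hH.flow_ne_zero s hx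
      rw [← h.fderiv_hamField hH hH' hs]
      exact (h.hasFDerivAt hs).comp_hasDerivAt s (hH.isFlowOf.hasDerivAt x s)) t
  rwa [hH.flow_zero] at this

/-- Euler's identity. -/
theorem fderiv_self (h : IsHomSympl H H' Ψ) {x : R4} (hx : x ≠ 0) : fderiv ℝ Ψ x x = Ψ x := by
  have h1 : HasDerivAt (fun t : ℝ => t • x) x 1 := by
    simpa using (hasDerivAt_id (1 : ℝ)).smul_const x
  have h2 : HasDerivAt (fun t : ℝ => Ψ (t • x)) (fderiv ℝ Ψ x x) 1 := by
    have : HasFDerivAt Ψ (fderiv ℝ Ψ x) ((1 : ℝ) • x) := by simpa using h.hasFDerivAt hx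
    exact this.comp_hasDerivAt 1 h1
  have h3 : HasDerivAt (fun t : ℝ => t • Ψ x) (Ψ x) 1 := by
    simpa using (hasDerivAt_id (1 : ℝ)).smul_const (Ψ x)
  refine h2.unique (h3.congr_of_eventuallyEq ?_)
  filter_upwards [lt_mem_nhds (zero_lt_one (α := ℝ))] with t ht
  exact h.map_smul t ht x hx

/-- By Euler's identity `DΨ` sends the radial field to the radial field, and `λ` is half the
contraction of `ω` with it. So homogeneous symplectic maps preserve `λ` itself. -/
theorem lam_fderiv (h : IsHomSympl H H' Ψ) {x : R4} (hx : x ≠ 0) (v : R4) :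
    lam (Ψ x) (fderiv ℝ Ψ x v) = lam x v := by
  rw [lam_eq, lam_eq]
  nth_rewrite 1 [← h.fderiv_self hx]
  rw [h.omega_fderiv x hx]

end IsHomSympl

/-- A twisted symplectic map with an inverse yields mutually inverse symplectic maps. -/
theorem IsTwistedSympl.exists_isHomSympl (hH : IsSmoothGauge H) (hH' : IsSmoothGauge H')
    (h : IsTwistedSympl H H' a f)
    (hb : ContDiffOn ℝ 1 b {0}ᶜ) (hb0 : ∀ x, x ≠ 0 → b x ≠ 0)
    (hab : ∀ x, x ≠ 0 → a (b x) = x) (hba : ∀ x, x ≠ 0 → b (a x) = x) :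
    ∃ Ψ Χ, IsHomSympl H H' Ψ ∧ IsHomSympl H' H Χ ∧ (∀ x, x ≠ 0 → Χ (Ψ x) = x) ∧
      ∀ x, x ≠ 0 → Ψ (Χ x) = x := by
  have h' := h.inverse hH hb hb0 hab hba
  have hΨ := h.isHomSympl hH hH'
  have hΧ := h'.isHomSympl hH' hH
  -- Each corrected map intertwines the two flows, so the flow times `-f` and `f` can be brought
  -- together and cancel.
  refine ⟨_, _, hΨ, hΧ, fun x hx => ?_, fun x hx => ?_⟩
  · have ha := ne_zero_of_gauge_map hH hH' h.gauge_map hx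
    have := hΧ.map_flow hH' hH ha (-f x)
    rw [this, neg_neg, hba x hx, hH.flow_neg_flow]
  · have := hΨ.map_flow hH hH' (hb0 x hx) (f (b x))
    rw [neg_neg, this, hab x hx, hH'.flow_flow_neg]

end StarShaped

/-! ### From a symplectomorphism of domains to a homogeneous symplectic map. -/

namespace StarShaped

variable {X X' : Set R4} {φ ψ : R4 → R4}

/-- `φ` is a symplectomorphism `X → X'` of manifolds with boundary, with inverse `ψ`. -/
structure IsSymplecto (X X' : Set R4) (φ ψ : R4 → R4) : Prop where
  mapsTo : MapsTo φ X X'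
  mapsTo_inv : MapsTo ψ X' X
  invOn : InvOn ψ φ X X'
  contDiffOn : ContDiffOn ℝ ∞ φ X
  contDiffOn_inv : ContDiffOn ℝ ∞ ψ X'
  omega_fderivWithin : ∀ x ∈ X, ∀ u v : R4,
    omega (fderivWithin ℝ φ X x u) (fderivWithin ℝ φ X x v) = omega u v

/-- The 1-form `φ^*λ - λ`. -/
noncomputable def lamDefect (X : Set R4) (φ : R4 → R4) (x : R4) : R4 →L[ℝ] ℝ :=
  (1 / 2 : ℝ) • ((omegaL (φ x)).comp (fderivWithin ℝ φ X x) - omegaL x)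

/-- The positively homogeneous extension of the restriction of `φ` to the boundary of `X`. -/
noncomputable def homExt (X : Set R4) (φ : R4 → R4) (x : R4) : R4 :=
  gauge X x • φ (radialProj X x)

namespace IsSymplecto

theorem hasFDerivWithinAt (h : IsSymplecto X X' φ ψ) {x : R4} (hx : x ∈ X) :
    HasFDerivWithinAt φ (fderivWithin ℝ φ X x) X x :=
  (h.contDiffOn.differentiableOn (by simp) x hx).hasFDerivWithinAt

theorem symm (hX' : IsStarShapedDomain X')
    (h : IsSymplecto X X' φ ψ) : IsSymplecto X' X ψ φ where
  mapsTo := h.mapsTo_inv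
  mapsTo_inv := h.mapsTo
  invOn := h.invOn.symm
  contDiffOn := h.contDiffOn_inv
  contDiffOn_inv := h.contDiffOn
  omega_fderivWithin y hy u v := by
    have hψy := h.mapsTo_inv hy
    have h1 : HasFDerivWithinAt ψ (fderivWithin ℝ ψ X' y) X' y :=
      (h.contDiffOn_inv.differentiableOn (by simp) y hy).hasFDerivWithinAt
    have h2 := (h.hasFDerivWithinAt hψy).comp y h1 h.mapsTo_inv
    have h3 : HasFDerivWithinAt (φ ∘ ψ) (.id ℝ R4) X' y :=
      (hasFDerivWithinAt_id y X').congr (fun z hz => h.invOn.2 hz) (h.invOn.2 hy)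
    have h4 := (hX'.uniqueDiffOn y hy).eq h2 h3
    have h5 : ∀ w, fderivWithin ℝ φ X (ψ y) (fderivWithin ℝ ψ X' y w) = w := fun w =>
      congrArg (fun L : R4 →L[ℝ] R4 => L w) h4
    rw [← h.omega_fderivWithin _ hψy, h5, h5]

/-- `Dφ` preserves `ω`, so it is invertible and `φ` is open at interior points. Applied to `φ` and
its inverse, this shows that boundaries correspond. -/
theorem map_mem_interior (h : IsSymplecto X X' φ ψ) {x : R4} (hx : x ∈ interior X) :
    φ x ∈ interior X' := by
  have hnhds := mem_interior_iff_mem_nhds.1 hx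
  have hs : HasStrictFDerivAt φ (fderiv ℝ φ x) x :=
    (h.contDiffOn.contDiffAt hnhds).hasStrictFDerivAt (by simp)
  have hinj : Function.Injective (fderiv ℝ φ x : R4 →ₗ[ℝ] R4) := by
    refine (injective_iff_map_eq_zero _).2 fun u hu => eq_zero_of_omega_eq_zero fun w => ?_
    have hu' : fderiv ℝ φ x u = 0 := hu
    rw [← h.omega_fderivWithin x (interior_subset hx), fderivWithin_of_mem_nhds hnhds, hu',
      ← omegaL_apply]
    simp
  have hsurj : Function.Surjective (fderiv ℝ φ x) := LinearMap.injective_iff_surjective.1 hinj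
  have hmap := hs.map_nhds_eq_of_surj (LinearMap.range_eq_top.2 hsurj)
  rw [mem_interior_iff_mem_nhds, ← hmap]
  exact Filter.mem_map.2 (Filter.mem_of_superset hnhds h.mapsTo)

theorem map_mem_frontier (hX : IsStarShapedDomain X) (hX' : IsStarShapedDomain X')
    (h : IsSymplecto X X' φ ψ) {x : R4} (hx : x ∈ frontier X) : φ x ∈ frontier X' := by
  have hxX := hX.isClosed.frontier_subset hx
  refine ⟨subset_closure (h.mapsTo hxX), fun hi => hx.2 ?_⟩
  have := (h.symm hX').map_mem_interior hi
  rwa [h.invOn.1 hxX] at this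

theorem contDiffOn_lamDefect (hX : IsStarShapedDomain X) (h : IsSymplecto X X' φ ψ) :
    ContDiffOn ℝ 1 (lamDefect X φ) X := by
  have h1 : ContDiffOn ℝ 1 (fderivWithin ℝ φ X) X :=
    h.contDiffOn.fderivWithin hX.uniqueDiffOn (by rw [one_add_one_eq_two]; exact ENat.LEInfty.out)
  have h2 : ContDiffOn ℝ 1 (fun x => omegaL (φ x)) X :=
    omegaL.contDiff.comp_contDiffOn (h.contDiffOn.of_le (by simp))
  exact ((h2.clm_comp h1).sub omegaL.contDiff.contDiffOn).const_smul _

/-- This is `d(φ^*λ - λ) = φ^*ω - ω = 0`. In the derivative of the form, the second-derivative term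
of `φ` is symmetric and the antisymmetric remainder cancels. -/
theorem fderiv_lamDefect_symm (h : IsSymplecto X X' φ ψ)
    {z : R4} (hz : z ∈ interior X) (u v : R4) :
    fderiv ℝ (lamDefect X φ) z u v = fderiv ℝ (lamDefect X φ) z v u := by
  have hnhds := mem_interior_iff_mem_nhds.1 hz
  have hφ := h.contDiffOn.contDiffAt hnhds
  have hD := (hφ.differentiableAt (by simp)).hasFDerivAt
  have hD2 : HasFDerivAt (fderiv ℝ φ) (fderiv ℝ (fderiv ℝ φ) z) z :=
    ((hφ.fderiv_right (m := ∞) (by simp)).differentiableAt (by simp)).hasFDerivAt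
  have heq : lamDefect X φ =ᶠ[𝓝 z] fun x =>
      (1 / 2 : ℝ) • ((omegaL (φ x)).comp (fderiv ℝ φ x) - omegaL x) := by
    filter_upwards [isOpen_interior.mem_nhds hz] with x hx
    rw [lamDefect, fderivWithin_of_mem_nhds (mem_interior_iff_mem_nhds.1 hx)]
  have hform : ∀ a b, fderiv ℝ (lamDefect X φ) z a b =
      (1 / 2 : ℝ) * (omega (φ z) (fderiv ℝ (fderiv ℝ φ) z a b) +
        omega (fderiv ℝ φ z a) (fderiv ℝ φ z b) - omega a b) := fun a b => by
    have h1 : HasFDerivAt (fun x => omegaL (φ x)) (omegaL.comp (fderiv ℝ φ z)) z :=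
      omegaL.hasFDerivAt.comp z hD
    have h2 := ((h1.clm_comp hD2).sub omegaL.hasFDerivAt).const_smul (1 / 2 : ℝ)
    have h3 : fderiv ℝ (fun x => (1 / 2 : ℝ) • ((omegaL (φ x)).comp (fderiv ℝ φ x) - omegaL x)) z =
      _ := h2.fderiv
    rw [heq.fderiv_eq, h3]
    simp [omegaL_apply]
  have hsymm : IsSymmSndFDerivAt ℝ φ z := hφ.isSymmSndFDerivAt (by simpa using ENat.LEInfty.out)
  have hω := h.omega_fderivWithin z (interior_subset hz)
  simp only [fderivWithin_of_mem_nhds hnhds] at hω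
  rw [hform, hform, hω, hω, hsymm.eq]
  ring

theorem hasFDerivAt_homExt (hX : IsStarShapedDomain X) (h : IsSymplecto X X' φ ψ) {x : R4}
    (hx : x ≠ 0) :
    HasFDerivAt (homExt X φ) (gauge X x • ((fderivWithin ℝ φ X (radialProj X x)).comp
      (fderiv ℝ (radialProj X) x)) + (fderiv ℝ (gauge X) x).smulRight (φ (radialProj X x))) x := by
  have h1 : HasFDerivAt (fun y => φ (radialProj X y))
      ((fderivWithin ℝ φ X (radialProj X x)).comp (fderiv ℝ (radialProj X) x)) x := by
    have h2 : HasFDerivWithinAt (radialProj X) (fderiv ℝ (radialProj X) x) {0}ᶜ x :=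
      (hX.hasFDerivAt_radialProj hx).hasFDerivWithinAt
    exact ((h.hasFDerivWithinAt (hX.radialProj_mem hx)).comp x h2
      (fun z hz => hX.radialProj_mem hz)).hasFDerivAt (isOpen_compl_singleton.mem_nhds hx)
  exact (hX.isSmoothGauge.differentiableAt hx).hasFDerivAt.smul h1

theorem contDiffOn_homExt (hX : IsStarShapedDomain X) (h : IsSymplecto X X' φ ψ) :
    ContDiffOn ℝ 1 (homExt X φ) {0}ᶜ := by
  have h1 : ContDiffOn ℝ ∞ (fun y => φ (radialProj X y)) {0}ᶜ :=
    h.contDiffOn.comp hX.contDiffOn_radialProj fun x hx => hX.radialProj_mem hx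
  have h2 : ContDiffOn ℝ ∞ (gauge X) {0}ᶜ := fun x hx =>
    (hX.isSmoothGauge.contDiffAt x hx).contDiffWithinAt
  exact (h2.smul h1).of_le (by simp)

theorem gauge_homExt (hX : IsStarShapedDomain X) (hX' : IsStarShapedDomain X')
    (h : IsSymplecto X X' φ ψ) {x : R4} (hx : x ≠ 0) : gauge X' (homExt X φ x) = gauge X x := by
  rw [homExt, hX'.isSmoothGauge.map_smul _ (hX.gauge_pos hx),
    hX'.mem_frontier_iff.1 (h.map_mem_frontier hX hX' (hX.radialProj_mem_frontier hx)), mul_one]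

theorem homExt_homExt (hX : IsStarShapedDomain X) (hX' : IsStarShapedDomain X')
    (h : IsSymplecto X X' φ ψ) {x : R4} (hx : x ≠ 0) : homExt X' ψ (homExt X φ x) = x := by
  have hf := h.map_mem_frontier hX hX' (hX.radialProj_mem_frontier hx)
  have h1 : radialProj X' (homExt X φ x) = φ (radialProj X x) := by
    rw [homExt, IsStarShapedDomain.radialProj_smul (hX.gauge_pos hx), hX'.radialProj_eq_self hf]
  rw [homExt, h1, h.gauge_homExt hX hX' hx, h.invOn.1 (hX.radialProj_mem hx),
    hX.gauge_smul_radialProj hx]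

/-- With `f` the primitive of `φ^*λ - λ` along the boundary, `a^*λ = H² (φ ∘ p)^*λ = λ + H² df`, and
the twisted identity is its exterior derivative. It is verified pointwise below. -/
theorem exists_isTwistedSympl (hX : IsStarShapedDomain X) (hX' : IsStarShapedDomain X')
    (h : IsSymplecto X X' φ ψ) :
    ∃ f, IsTwistedSympl (gauge X) (gauge X') (homExt X φ) f := by
  obtain ⟨f, hfc, hfd⟩ := hX.exists_primitive (h.contDiffOn_lamDefect hX)
    (fun z hz => h.fderiv_lamDefect_symm hz)
  refine ⟨f, h.contDiffOn_homExt hX, fun c hc x _ => ?_, fun x hx => h.gauge_homExt hX hX' hx, ?_,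
    fun c hc x _ => hfc c hc x, fun x hx u v => ?_⟩
  · rw [homExt, homExt, IsStarShapedDomain.gauge_smul_pos hc,
      IsStarShapedDomain.radialProj_smul hc, mul_smul]
  · rw [show (1 : WithTop ℕ∞) = 0 + 1 by norm_num,
      contDiffOn_succ_iff_fderiv_of_isOpen isOpen_compl_singleton]
    refine ⟨fun x hx => (hfd x hx).differentiableAt.differentiableWithinAt, by simp, ?_⟩
    rw [contDiffOn_zero]
    refine ContinuousOn.congr (f := fun x => (lamDefect X φ (radialProj X x)).comp
      (fderiv ℝ (radialProj X) x)) ?_ (fun x hx => (hfd x hx).fderiv)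
    exact ((h.contDiffOn_lamDefect hX).continuousOn.comp hX.contDiffOn_radialProj.continuousOn
      fun x hx => hX.radialProj_mem hx).clm_comp
        (hX.contDiffOn_radialProj.continuousOn_fderiv_of_isOpen isOpen_compl_singleton (by simp))
  · have hr := (hX.gauge_pos hx).ne'
    rw [(h.hasFDerivAt_homExt hX hx).fderiv, (hfd x hx).fderiv, hX.isSmoothGauge.fderiv_sq hx,
      hX.isSmoothGauge.fderiv_sq hx]
    set r := gauge X x
    set y := radialProj X x
    set D := fderivWithin ℝ φ X y
    have hD : ∀ u v, omega (D u) (D v) = omega u v :=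
      h.omega_fderivWithin y (hX.radialProj_mem hx)
    have happ : ∀ w, (r • (D.comp (fderiv ℝ (radialProj X) x)) +
        (fderiv ℝ (gauge X) x).smulRight (φ y)) w =
        D (w - fderiv ℝ (gauge X) x w • y) + fderiv ℝ (gauge X) x w • φ y := fun w => by
      simp only [add_apply, smul_apply, ContinuousLinearMap.comp_apply,
        ContinuousLinearMap.smulRight_apply, hX.fderiv_radialProj_apply hx]
      rw [_root_.map_smul, smul_smul, mul_inv_cancel₀ hr, one_smul]
    have hα : ∀ w, ((lamDefect X φ y).comp (fderiv ℝ (radialProj X) x)) w =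
        r⁻¹ * (1 / 2 * (omega (φ y) (D (w - fderiv ℝ (gauge X) x w • y)) -
          omega y (w - fderiv ℝ (gauge X) x w • y))) := fun w => by
      rw [ContinuousLinearMap.comp_apply, hX.fderiv_radialProj_apply hx, _root_.map_smul]
      simp [lamDefect, omegaL_apply, y, r, D]
    rw [happ, happ, hα, hα]
    set hu := fderiv ℝ (gauge X) x u
    set hv := fderiv ℝ (gauge X) x v
    -- In the splitting of a vector into `u'` and a multiple of `y`, the map `Da` acts by `Dφ` on
    -- the first part and sends `y` to `φ(y)`. The mixed terms `ω(φ y, Dφ u') - ω(y, u')` are those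
    -- produced by `df`.
    set u' := u - hu • y with hu'
    set v' := v - hv • y with hv'
    have eu : u = u' + hu • y := by rw [hu']; abel
    have ev : v = v' + hv • y := by rw [hv']; abel
    clear_value u' v'
    rw [eu, ev]
    simp only [omega_add_left, omega_add_right, omega_smul_left, omega_smul_right, omega_self, hD,
      omega_swap (D u') (φ y), omega_swap u' y]
    field_simp
    ring

/-- Symplectomorphic star-shaped domains have strictly contactomorphic boundaries, by a map that is
the restriction of a homogeneous symplectic map of `ℝ⁴ ∖ 0`. -/
theorem exists_isHomSympl (hX : IsStarShapedDomain X) (hX' : IsStarShapedDomain X')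
    (h : IsSymplecto X X' φ ψ) :
    ∃ Ψ Χ, IsHomSympl (gauge X) (gauge X') Ψ ∧ IsHomSympl (gauge X') (gauge X) Χ ∧
      (∀ x, x ≠ 0 → Χ (Ψ x) = x) ∧ ∀ x, x ≠ 0 → Ψ (Χ x) = x := by
  obtain ⟨f, hf⟩ := h.exists_isTwistedSympl hX hX'
  have h' := h.symm hX'
  exact hf.exists_isHomSympl hX.isSmoothGauge hX'.isSmoothGauge (h'.contDiffOn_homExt hX')
    (fun x hx => ne_zero_of_gauge_map hX'.isSmoothGauge hX.isSmoothGauge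
      (fun y hy => h'.gauge_homExt hX' hX hy) hx)
    (fun x hx => h'.homExt_homExt hX' hX hx) (fun x hx => h.homExt_homExt hX hX' hx)

end IsSymplecto

end StarShaped

/-! ### Invariance of periods and of the rotation number. -/

namespace StarShaped

variable {X X' : Set R4} {Ψ Χ : R4 → R4}

namespace IsHomSympl

theorem map_mem_frontier (hX : IsStarShapedDomain X) (hX' : IsStarShapedDomain X')
    (h : IsHomSympl (gauge X) (gauge X') Ψ) {y : R4} (hy : y ∈ frontier X) :
    Ψ y ∈ frontier X' := by
  rw [hX'.mem_frontier_iff, h.gauge_map y (hX.ne_zero_of_mem_frontier hy), ← hX.mem_frontier_iff]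
  exact hy

theorem fderiv_mem_tangentVectors (hX : IsStarShapedDomain X) (hX' : IsStarShapedDomain X')
    (h : IsHomSympl (gauge X) (gauge X') Ψ) {y v : R4} (hy : y ∈ frontier X)
    (hv : v ∈ tangentVectors (frontier X) y) :
    fderiv ℝ Ψ y v ∈ tangentVectors (frontier X') (Ψ y) := by
  rw [hX'.mem_tangentVectors_iff (h.map_mem_frontier hX hX' hy),
    h.fderiv_gauge hX.isSmoothGauge hX'.isSmoothGauge (hX.ne_zero_of_mem_frontier hy)]
  exact (hX.mem_tangentVectors_iff hy).1 hv

theorem fderiv_mem_contactPlane (hX : IsStarShapedDomain X) (hX' : IsStarShapedDomain X')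
    (h : IsHomSympl (gauge X) (gauge X') Ψ) {y v : R4} (hy : y ∈ frontier X)
    (hv : v ∈ contactPlane X y) : fderiv ℝ Ψ y v ∈ contactPlane X' (Ψ y) :=
  ⟨h.fderiv_mem_tangentVectors hX hX' hy hv.1, by
    rw [h.lam_fderiv (hX.ne_zero_of_mem_frontier hy), hv.2]⟩

theorem isReebTrajectory_comp (hX : IsStarShapedDomain X) (hX' : IsStarShapedDomain X')
    (h : IsHomSympl (gauge X) (gauge X') Ψ) {γ : ℝ → R4} (hγ : IsReebTrajectory X γ) :
    IsReebTrajectory X' (Ψ ∘ γ) := by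
  have hy := (hγ 0).1
  have : Ψ ∘ γ = fun t => hX'.isSmoothGauge.flow t (Ψ (γ 0)) := funext fun t => by
    rw [Function.comp_apply, hX.eq_flow_of_isReebTrajectory hγ,
      h.map_flow hX.isSmoothGauge hX'.isSmoothGauge (hX.ne_zero_of_mem_frontier hy)]
  rw [this]
  exact hX'.isReebTrajectory_flow (h.map_mem_frontier hX hX' hy)

/-- The two sets of periods coincide, so their infima do, whether or not closed orbits exist. -/
theorem minPeriod_eq (hX : IsStarShapedDomain X) (hX' : IsStarShapedDomain X')
    (h : IsHomSympl (gauge X) (gauge X') Ψ) (h' : IsHomSympl (gauge X') (gauge X) Χ) :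
    minPeriod X = minPeriod X' := by
  unfold minPeriod
  congr 1
  ext T
  constructor
  · rintro ⟨hT, γ, hγ, hp⟩
    exact ⟨hT, Ψ ∘ γ, h.isReebTrajectory_comp hX hX' hγ, hp.comp Ψ⟩
  · rintro ⟨hT, γ, hγ, hp⟩
    exact ⟨hT, Χ ∘ γ, h'.isReebTrajectory_comp hX' hX hγ, hp.comp Χ⟩

theorem fderiv_flow_comm {H H' : R4 → ℝ} (hH : IsSmoothGauge H) (hH' : IsSmoothGauge H')
    (h : IsHomSympl H H' Ψ) {y : R4} (hy : y ≠ 0) (t : ℝ) (v : R4) :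
    fderiv ℝ (hH'.flow t) (Ψ y) (fderiv ℝ Ψ y v) =
      fderiv ℝ Ψ (hH.flow t y) (fderiv ℝ (hH.flow t) y v) := by
  have h1 : HasFDerivAt (fun z => hH'.flow t (Ψ z))
      ((fderiv ℝ (hH'.flow t) (Ψ y)).comp (fderiv ℝ Ψ y)) y :=
    (hH'.hasFDerivAt_flow t (h.ne_zero hH hH' hy)).comp y (h.hasFDerivAt hy)
  have h2 : HasFDerivAt (fun z => Ψ (hH.flow t z))
      ((fderiv ℝ Ψ (hH.flow t y)).comp (fderiv ℝ (hH.flow t) y)) y :=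
    (h.hasFDerivAt (hH.flow_ne_zero t hy)).comp y (hH.hasFDerivAt_flow t hy)
  have h3 : (fun z => Ψ (hH.flow t z)) =ᶠ[𝓝 y] fun z => hH'.flow t (Ψ z) := by
    filter_upwards [isOpen_compl_singleton.mem_nhds hy] with z hz
    exact h.map_flow hH hH' hz t
  have h4 := h3.fderiv_eq (𝕜 := ℝ)
  rw [h1.fderiv, h2.fderiv] at h4
  exact congrArg (fun L : R4 →L[ℝ] R4 => L v) h4.symm

/-- All vectors in the matrix entries are transported by `DΨ`, which preserves `ω`. The matrices are
equal, not merely conjugate, so their rotation numbers agree without any study of lifts. -/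
theorem linearizedFlow_eq (hX : IsStarShapedDomain X) (hX' : IsStarShapedDomain X')
    (h : IsHomSympl (gauge X) (gauge X') Ψ) {e₁ e₂ e₁' e₂' : R4 → R4}
    (he : IsTrivialization X e₁ e₂)
    (h₁ : ∀ y ∈ frontier X, e₁' (Ψ y) = fderiv ℝ Ψ y (e₁ y))
    (h₂ : ∀ y ∈ frontier X, e₂' (Ψ y) = fderiv ℝ Ψ y (e₂ y)) {y : R4} (hy : y ∈ frontier X)
    (t : ℝ) : linearizedFlow X' e₁' e₂' (Ψ y) t = linearizedFlow X e₁ e₂ y t := by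
  have hy0 := hX.ne_zero_of_mem_frontier hy
  have hyt := hX.flow_mem_frontier hy t
  have hΨy := h.map_mem_frontier hX hX' hy
  have hflow : reebFlow X' t (Ψ y) = Ψ (hX.isSmoothGauge.flow t y) := by
    rw [hX'.reebFlow_eq hΨy, h.map_flow hX.isSmoothGauge hX'.isSmoothGauge hy0]
  have hd : ∀ v ∈ tangentVectors (frontier X) y, dReebFlow X' t (Ψ y) (fderiv ℝ Ψ y v) =
      fderiv ℝ Ψ (hX.isSmoothGauge.flow t y) (dReebFlow X t y v) := fun v hv => by
    rw [hX'.dReebFlow_eq hΨy t (h.fderiv_mem_tangentVectors hX hX' hy hv),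
      hX.dReebFlow_eq hy t hv, h.fderiv_flow_comm hX.isSmoothGauge hX'.isSmoothGauge hy0]
  have hω := h.omega_fderiv _ (hX.ne_zero_of_mem_frontier hyt)
  simp only [linearizedFlow, hflow, h₁ y hy, h₂ y hy, h₁ _ hyt, h₂ _ hyt,
    hd _ (he.fst_mem y hy).1, hd _ (he.snd_mem y hy).1, hω, hX.reebFlow_eq hy t]

theorem fderiv_fderiv_inv {H H' : R4 → ℝ} (hH : IsSmoothGauge H) (hH' : IsSmoothGauge H')
    (h : IsHomSympl H H' Ψ) (h' : IsHomSympl H' H Χ)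
    (hΨΧ : ∀ x, x ≠ 0 → Ψ (Χ x) = x) {x : R4} (hx : x ≠ 0) (v : R4) :
    fderiv ℝ Ψ (Χ x) (fderiv ℝ Χ x v) = v := by
  have h1 : HasFDerivAt (fun z => Ψ (Χ z)) ((fderiv ℝ Ψ (Χ x)).comp (fderiv ℝ Χ x)) x :=
    (h.hasFDerivAt (h'.ne_zero hH' hH hx)).comp x (h'.hasFDerivAt hx)
  have h2 : (fun z => Ψ (Χ z)) =ᶠ[𝓝 x] id := by
    filter_upwards [isOpen_compl_singleton.mem_nhds hx] with z hz
    exact hΨΧ z hz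
  have h3 := h2.fderiv_eq (𝕜 := ℝ)
  rw [h1.fderiv, fderiv_id] at h3
  exact congrArg (fun L : R4 →L[ℝ] R4 => L v) h3

/-- Pulling back a trivialization. -/
theorem isTrivialization_pullback (hX : IsStarShapedDomain X) (hX' : IsStarShapedDomain X')
    (h : IsHomSympl (gauge X) (gauge X') Ψ) (h' : IsHomSympl (gauge X') (gauge X) Χ)
    (hΧΨ : ∀ x, x ≠ 0 → Χ (Ψ x) = x) {e₁ e₂ : R4 → R4}
    (he : IsTrivialization X' e₁ e₂) :
    IsTrivialization X (fun y => fderiv ℝ Χ (Ψ y) (e₁ (Ψ y)))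
      (fun y => fderiv ℝ Χ (Ψ y) (e₂ (Ψ y))) := by
  have hfr : MapsTo Ψ (frontier X) (frontier X') := fun y hy => h.map_mem_frontier hX hX' hy
  have hsub : frontier X ⊆ {0}ᶜ := fun y hy => hX.ne_zero_of_mem_frontier hy
  have hsub' : frontier X' ⊆ {0}ᶜ := fun y hy => hX'.ne_zero_of_mem_frontier hy
  have hΨc : ContinuousOn Ψ (frontier X) := h.contDiffOn.continuousOn.mono hsub
  have hDc : ContinuousOn (fun y => fderiv ℝ Χ (Ψ y)) (frontier X) :=
    ((h'.contDiffOn.continuousOn_fderiv_of_isOpen isOpen_compl_singleton le_rfl).mono hsub').comp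
      hΨc hfr
  have hmem : ∀ y ∈ frontier X, ∀ v ∈ contactPlane X' (Ψ y),
      fderiv ℝ Χ (Ψ y) v ∈ contactPlane X y := fun y hy v hv => by
    have := h'.fderiv_mem_contactPlane hX' hX (hfr hy) hv
    rwa [hΧΨ y (hsub hy)] at this
  exact ⟨hDc.clm_apply (he.continuousOn_fst.comp hΨc hfr),
    hDc.clm_apply (he.continuousOn_snd.comp hΨc hfr),
    fun y hy => hmem y hy _ (he.fst_mem _ (hfr hy)),
    fun y hy => hmem y hy _ (he.snd_mem _ (hfr hy)),
    fun y hy => by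
      rw [h'.omega_fderiv _ (hsub' (hfr hy)), he.omega_eq_one _ (hfr hy)]⟩

/-- Every frame on `∂X'` is the pushforward of its own pullback, so a limit that holds for all
frames on `∂X` holds for all frames on `∂X'`; the existence of a frame is transported as well. -/
theorem hasRot_map (hX : IsStarShapedDomain X) (hX' : IsStarShapedDomain X')
    (h : IsHomSympl (gauge X) (gauge X') Ψ) (h' : IsHomSympl (gauge X') (gauge X) Χ)
    (hΧΨ : ∀ x, x ≠ 0 → Χ (Ψ x) = x) (hΨΧ : ∀ x, x ≠ 0 → Ψ (Χ x) = x) {y : R4}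
    (hy : y ∈ frontier X) {r : ℝ} (hr : HasRot X y r) : HasRot X' (Ψ y) r := by
  obtain ⟨⟨e₁, e₂, he⟩, hlim⟩ := hr
  refine ⟨⟨_, _, h'.isTrivialization_pullback hX' hX h hΨΧ he⟩, fun e₁' e₂' he' => ?_⟩
  have hpb := h.isTrivialization_pullback hX hX' h' hΧΨ he'
  have hback : ∀ (e : R4 → R4), ∀ z ∈ frontier X,
      e (Ψ z) = fderiv ℝ Ψ z (fderiv ℝ Χ (Ψ z) (e (Ψ z))) := fun e z hz => by
    have hz0 := hX.ne_zero_of_mem_frontier hz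
    have := h.fderiv_fderiv_inv hX.isSmoothGauge hX'.isSmoothGauge h' hΨΧ
      (h.ne_zero hX.isSmoothGauge hX'.isSmoothGauge hz0) (e (Ψ z))
    rw [hΧΨ z hz0] at this
    exact this.symm
  have heq : linearizedFlow X' e₁' e₂' (Ψ y) = linearizedFlow X _ _ y :=
    funext fun t => h.linearizedFlow_eq hX hX' hpb (hback e₁') (hback e₂') hy t
  rw [heq]
  exact hlim _ _ hpb

/-- The function `rot` is invariant under strict contactomorphisms. -/
theorem rot_map (hX : IsStarShapedDomain X) (hX' : IsStarShapedDomain X')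
    (h : IsHomSympl (gauge X) (gauge X') Ψ) (h' : IsHomSympl (gauge X') (gauge X) Χ)
    (hΧΨ : ∀ x, x ≠ 0 → Χ (Ψ x) = x) (hΨΧ : ∀ x, x ≠ 0 → Ψ (Χ x) = x) {y : R4}
    (hy : y ∈ frontier X) : rot X' (Ψ y) = rot X y := by
  classical
  -- Equal predicates have equal chosen witnesses and equal default values, so neither existence nor
  -- uniqueness of the limit is needed.
  have heq : HasRot X' (Ψ y) = HasRot X y := funext fun r => propext ⟨fun hr => by
    have := h'.hasRot_map hX' hX h hΨΧ hΧΨ (h.map_mem_frontier hX hX' hy) hr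
    rwa [hΧΨ y (hX.ne_zero_of_mem_frontier hy)] at this,
    fun hr => h.hasRot_map hX hX' h' hΧΨ hΨΧ hy hr⟩
  have key : ∀ P Q : ℝ → Prop, P = Q →
      (if h : ∃ r, P r then h.choose else (0 : ℝ)) = if h : ∃ r, Q r then h.choose else 0 := by
    rintro P _ rfl
    rfl
  exact key _ _ heq

end IsHomSympl

end StarShaped

/-! ### Invariance of integrals over the boundary. -/

namespace StarShaped

open MeasureTheory

/-- Symplectic linear maps have determinant `±1`. -/
theorem abs_det_eq_one_of_omega {L : R4 →L[ℝ] R4} (h : ∀ u v, omega (L u) (L v) = omega u v) :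
    |L.det| = 1 := by
  -- In matrix terms `Lᵀ J L = J`, so `det(L)² = 1` once `det J ≠ 0`, which follows from `J² = -1`.
  -- Only the absolute value is needed for volumes.
  have h1 : (LinearMap.adjoint (L : R4 →ₗ[ℝ] R4)) ∘ₗ (quatIL : R4 →ₗ[ℝ] R4) ∘ₗ
      (L : R4 →ₗ[ℝ] R4) = (quatIL : R4 →ₗ[ℝ] R4) := by
    refine LinearMap.ext fun u => ext_inner_right ℝ fun v => ?_
    simp only [LinearMap.comp_apply, LinearMap.adjoint_inner_left, ContinuousLinearMap.coe_coe]
    rw [← omega_eq_inner, ← omega_eq_inner, h]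
  have h2 : LinearMap.det (LinearMap.adjoint (L : R4 →ₗ[ℝ] R4)) = L.det := by
    let b := EuclideanSpace.basisFun (Fin 4) ℝ
    rw [← LinearMap.det_toMatrix b.toBasis, LinearMap.toMatrix_adjoint, Matrix.det_conjTranspose,
      LinearMap.det_toMatrix]
    rfl
  have h3 : (quatIL : R4 →ₗ[ℝ] R4) ∘ₗ (quatIL : R4 →ₗ[ℝ] R4) = -LinearMap.id :=
    LinearMap.ext fun u => quatIL_quatIL u
  have h4 : LinearMap.det (quatIL : R4 →ₗ[ℝ] R4) ≠ 0 := fun h0 => by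
    have := congrArg LinearMap.det h3
    rw [LinearMap.det_comp, h0, zero_mul, ← neg_one_smul ℝ, LinearMap.det_smul] at this
    norm_num at this
  have h5 := congrArg LinearMap.det h1
  rw [LinearMap.det_comp, LinearMap.det_comp, h2] at h5
  have h6 : L.det * L.det = 1 := by
    refine mul_right_cancel₀ h4 ?_
    rw [one_mul]
    refine Eq.trans ?_ h5
    change L.det * L.det * _ = L.det * (_ * L.det)
    ring
  rcases mul_self_eq_one_iff.1 h6 with h | h <;> simp [h]

/-- The density of `λ ∧ dλ` with respect to the round sphere, in radial coordinates. -/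
theorem IsStarShapedDomain.lamWedgeDLam_radialProj {X : Set R4} (hX : IsStarShapedDomain X)
    {u : R4} (hu : ‖u‖ = 1) :
    lamWedgeDLam (radialProj X u) (fderiv ℝ (radialProj X) u (quatI u))
      (fderiv ℝ (radialProj X) u (quatJ u)) (fderiv ℝ (radialProj X) u (quatK u)) =
      (gauge X u)⁻¹ ^ 4 / 2 := by
  have hu0 : u ≠ 0 := fun h => by simp [h] at hu
  have hsq : u 0 ^ 2 + u 1 ^ 2 + u 2 ^ 2 + u 3 ^ 2 = 1 := by
    have := EuclideanSpace.real_norm_sq_eq u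
    rw [hu, Fin.sum_univ_four] at this
    linarith
  -- Since `ju` and `ku` are `ω`-orthogonal to `u`, only the term `λ(iu) ω(ju, ku)` of the wedge
  -- product survives; the radial corrections in the derivative of the projection drop out.
  have hI : omega u (quatI u) = 1 := by
    rw [← hsq]; simp [omega, quatI]; ring
  have hJ : omega u (quatJ u) = 0 := by simp [omega, quatJ]; ring
  have hK : omega u (quatK u) = 0 := by simp [omega, quatK]; ring
  have hJK : omega (quatJ u) (quatK u) = 1 := by
    rw [← hsq]; simp [omega, quatJ, quatK]; ring
  rw [hX.fderiv_radialProj_apply hu0, hX.fderiv_radialProj_apply hu0,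
    hX.fderiv_radialProj_apply hu0]
  simp only [lamWedgeDLam, lam_eq, radialProj, omega_smul_left, omega_smul_right, omega_sub_left,
    omega_sub_right, omega_self, hI, hJ, hK, hJK, omega_swap (quatJ u) u, omega_swap (quatK u) u,
    omega_swap (quatI u) u]
  ring

/-- The measure `λ ∧ dλ` of the boundary of `{H ≤ 1}`, on the sphere of directions. -/
noncomputable def dirMeasure (H : R4 → ℝ) : Measure (sphere (0 : R4) 1) :=
  (volume : Measure R4).toSphere.withDensity fun u => ENNReal.ofReal ((H u)⁻¹ ^ 4 / 2)

/-- The part of `{H < 1}` with directions in `A`. -/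
def sector (H : R4 → ℝ) (A : Set (sphere (0 : R4) 1)) : Set R4 :=
  {x | x ≠ 0 ∧ H x < 1 ∧ ∃ u ∈ A, ‖x‖ • (u : R4) = x}

theorem IsSmoothGauge.continuous_sphere {H : R4 → ℝ} (hH : IsSmoothGauge H) :
    Continuous fun u : sphere (0 : R4) 1 => H u :=
  continuous_iff_continuousAt.2 fun u =>
    (hH.contDiffAt u (ne_zero_of_mem_unit_sphere u)).continuousAt.comp
      continuous_subtype_val.continuousAt

theorem IsSmoothGauge.measurable_density {H : R4 → ℝ} (hH : IsSmoothGauge H) :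
    Measurable fun u : sphere (0 : R4) 1 => ENNReal.ofReal ((H u)⁻¹ ^ 4 / 2) :=
  ((hH.continuous_sphere.measurable.inv.pow_const 4).div_const 2).ennreal_ofReal

theorem IsStarShapedDomain.integralBoundary_eq {X : Set R4} (hX : IsStarShapedDomain X)
    (f : R4 → ℝ) :
    integralBoundary X f = ∫ u, f (radialProj X u) ∂(dirMeasure (gauge X)) := by
  rw [dirMeasure, integral_withDensity_eq_integral_toReal_smul₀
    hX.isSmoothGauge.measurable_density.aemeasurable (by simp), integralBoundary]
  refine integral_congr_ae (Filter.Eventually.of_forall fun u => ?_)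
  have hu : ‖(u : R4)‖ = 1 := by simp
  have hpos := hX.gauge_pos (ne_zero_of_mem_unit_sphere u)
  simp only
  rw [hX.lamWedgeDLam_radialProj hu, ENNReal.toReal_ofReal (by positivity), smul_eq_mul, mul_comm]

theorem sector_eq_image {H : R4 → ℝ} (hH : IsSmoothGauge H) (A : Set (sphere (0 : R4) 1)) :
    sector H A = Subtype.val '' (homeomorphUnitSphereProd R4 ⁻¹'
      {p | p.1 ∈ A ∧ p.2.1 * H p.1 < 1}) := by
  ext x
  constructor
  · rintro ⟨hx, hx1, u, hu, hux⟩
    have hn : 0 < ‖x‖ := norm_pos_iff.2 hx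
    have hfst : (homeomorphUnitSphereProd R4 ⟨x, hx⟩).1 = u := by
      apply Subtype.ext
      rw [homeomorphUnitSphereProd_apply_fst_coe]
      simp only
      nth_rw 2 [← hux]
      rw [smul_smul, inv_mul_cancel₀ hn.ne', one_smul]
    refine ⟨⟨x, hx⟩, ⟨by rw [hfst]; exact hu, ?_⟩, rfl⟩
    rw [hfst, homeomorphUnitSphereProd_apply_snd_coe]
    simp only
    rwa [← hH.map_smul _ hn, hux]
  · rintro ⟨⟨x, hx⟩, ⟨hA, hlt⟩, rfl⟩
    have hn : 0 < ‖x‖ := norm_pos_iff.2 hx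
    have key : ‖x‖ • ((homeomorphUnitSphereProd R4 ⟨x, hx⟩).1 : R4) = x := by
      rw [homeomorphUnitSphereProd_apply_fst_coe]
      simp only
      rw [smul_smul, mul_inv_cancel₀ hn.ne', one_smul]
    refine ⟨hx, ?_, _, hA, key⟩
    rw [homeomorphUnitSphereProd_apply_snd_coe] at hlt
    simp only at hlt
    rwa [← hH.map_smul _ hn, key] at hlt

theorem measurableSet_sectorProd {H : R4 → ℝ} (hH : IsSmoothGauge H)
    {A : Set (sphere (0 : R4) 1)} (hA : MeasurableSet A) :
    MeasurableSet {p : sphere (0 : R4) 1 × Ioi (0 : ℝ) | p.1 ∈ A ∧ p.2.1 * H p.1 < 1} :=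
  (measurable_fst hA).inter (measurableSet_lt
    (((continuous_subtype_val.comp continuous_snd).mul
      (hH.continuous_sphere.comp continuous_fst)).measurable) measurable_const)

theorem measurableSet_sector {H : R4 → ℝ} (hH : IsSmoothGauge H)
    {A : Set (sphere (0 : R4) 1)} (hA : MeasurableSet A) : MeasurableSet (sector H A) := by
  rw [sector_eq_image hH]
  exact (MeasurableEmbedding.subtype_coe (measurableSet_singleton _).compl).measurableSet_image.2
    ((homeomorphUnitSphereProd R4).measurable (measurableSet_sectorProd hH hA))

/-- In polar coordinates the ray in direction `u` has length `1 / H(u)` and contributes `∫ r³ dr =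
H(u)⁻⁴ / 4`, half of the density `H(u)⁻⁴ / 2`. Invariance of the contact volume thus reduces to that
of Lebesgue measure. -/
theorem dirMeasure_apply {H : R4 → ℝ} (hH : IsSmoothGauge H) {A : Set (sphere (0 : R4) 1)}
    (hA : MeasurableSet A) : dirMeasure H A = 2 * volume (sector H A) := by
  have hS := measurableSet_sectorProd hH hA
  have h1 : volume (sector H A) = ((volume : Measure R4).toSphere.prod
      (Measure.volumeIoiPow 3)) {p | p.1 ∈ A ∧ p.2.1 * H p.1 < 1} := by
    have hmp := (volume : Measure R4).measurePreserving_homeomorphUnitSphereProd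
    rw [finrank_euclideanSpace, Fintype.card_fin] at hmp
    rw [← hmp.measure_preimage hS.nullMeasurableSet, sector_eq_image hH,
      (MeasurableEmbedding.subtype_coe (measurableSet_singleton _).compl).comap_apply]
  rw [h1, Measure.prod_apply hS, dirMeasure, withDensity_apply _ hA, ← lintegral_indicator hA,
    ← lintegral_const_mul _ (measurable_measure_prodMk_left hS)]
  refine lintegral_congr fun u => ?_
  by_cases hu : u ∈ A
  · have hpos := hH.pos u (ne_zero_of_mem_unit_sphere u)
    have h2 : (Prod.mk u ⁻¹' {p : sphere (0 : R4) 1 × Ioi (0 : ℝ) | p.1 ∈ A ∧ p.2.1 * H p.1 < 1}) =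
        Iio (⟨(H u)⁻¹, inv_pos.2 hpos⟩ : Ioi (0 : ℝ)) := by
      ext r
      simp only [mem_preimage, mem_ofPred_eq, hu, true_and, mem_Iio, ← Subtype.coe_lt_coe]
      rw [← lt_div_iff₀ hpos, one_div]
    have h3 : ∀ a : ℝ, ENNReal.ofReal (a ^ 4 / 2) =
        2 * ENNReal.ofReal (a ^ (3 + 1) / ((3 : ℕ) + 1)) := fun a => by
      rw [← ENNReal.ofReal_ofNat 2, ← ENNReal.ofReal_mul two_pos.le]
      congr 1
      push_cast
      ring
    rw [indicator_of_mem hu, h2, Measure.volumeIoiPow_apply_Iio]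
    exact h3 _
  · rw [indicator_of_notMem hu]
    have h2 : (Prod.mk u ⁻¹' {p : sphere (0 : R4) 1 × Ioi (0 : ℝ) |
        p.1 ∈ A ∧ p.2.1 * H p.1 < 1}) = ∅ := by
      ext r
      simp [hu]
    rw [h2, measure_empty, mul_zero]

namespace IsHomSympl

variable {H H' : R4 → ℝ} {Ψ Χ : R4 → R4}

/-- The homeomorphism of the sphere of directions induced by a homogeneous map. -/
noncomputable def dirHomeomorph (hH : IsSmoothGauge H) (hH' : IsSmoothGauge H')
    (h : IsHomSympl H H' Ψ) (h' : IsHomSympl H' H Χ) (hΧΨ : ∀ x, x ≠ 0 → Χ (Ψ x) = x)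
    (hΨΧ : ∀ x, x ≠ 0 → Ψ (Χ x) = x) : sphere (0 : R4) 1 ≃ₜ sphere (0 : R4) 1 where
  toFun u := ⟨‖Ψ u‖⁻¹ • Ψ u, by
    have := h.ne_zero hH hH' (ne_zero_of_mem_unit_sphere u)
    simp [norm_smul, this]⟩
  invFun u := ⟨‖Χ u‖⁻¹ • Χ u, by
    have := h'.ne_zero hH' hH (ne_zero_of_mem_unit_sphere u)
    simp [norm_smul, this]⟩
  left_inv u := by
    have hu := ne_zero_of_mem_unit_sphere u
    have hn : 0 < ‖Ψ u‖⁻¹ := inv_pos.2 (norm_pos_iff.2 (h.ne_zero hH hH' hu))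
    ext1
    simp only
    rw [h'.map_smul _ hn _ (h.ne_zero hH hH' hu), hΧΨ _ hu, norm_smul, norm_eq_of_mem_sphere,
      mul_one, smul_smul, Real.norm_of_nonneg hn.le, inv_mul_cancel₀ hn.ne', one_smul]
  right_inv u := by
    have hu := ne_zero_of_mem_unit_sphere u
    have hn : 0 < ‖Χ u‖⁻¹ := inv_pos.2 (norm_pos_iff.2 (h'.ne_zero hH' hH hu))
    ext1
    simp only
    rw [h.map_smul _ hn _ (h'.ne_zero hH' hH hu), hΨΧ _ hu, norm_smul, norm_eq_of_mem_sphere,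
      mul_one, smul_smul, Real.norm_of_nonneg hn.le, inv_mul_cancel₀ hn.ne', one_smul]
  continuous_toFun := by
    have hc : Continuous fun u : sphere (0 : R4) 1 => Ψ u :=
      h.contDiffOn.continuousOn.comp_continuous continuous_subtype_val ne_zero_of_mem_unit_sphere
    exact ((hc.norm.inv₀ fun u => norm_ne_zero_iff.2
      (h.ne_zero hH hH' (ne_zero_of_mem_unit_sphere u))).smul hc).subtype_mk _
  continuous_invFun := by
    have hc : Continuous fun u : sphere (0 : R4) 1 => Χ u :=
      h'.contDiffOn.continuousOn.comp_continuous continuous_subtype_val ne_zero_of_mem_unit_sphere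
    exact ((hc.norm.inv₀ fun u => norm_ne_zero_iff.2
      (h'.ne_zero hH' hH (ne_zero_of_mem_unit_sphere u))).smul hc).subtype_mk _

theorem image_sector (hH : IsSmoothGauge H) (hH' : IsSmoothGauge H')
    (h : IsHomSympl H H' Ψ) (h' : IsHomSympl H' H Χ) (hΧΨ : ∀ x, x ≠ 0 → Χ (Ψ x) = x)
    (hΨΧ : ∀ x, x ≠ 0 → Ψ (Χ x) = x) (A : Set (sphere (0 : R4) 1)) :
    Ψ '' sector H (dirHomeomorph hH hH' h h' hΧΨ hΨΧ ⁻¹' A) = sector H' A := by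
  ext y
  constructor
  · rintro ⟨x, ⟨hx, hx1, u, hu, hux⟩, rfl⟩
    refine ⟨h.ne_zero hH hH' hx, (h.gauge_map x hx).trans_lt hx1, _, hu, ?_⟩
    have hn : 0 < ‖x‖ := norm_pos_iff.2 hx
    have hu0 := ne_zero_of_mem_unit_sphere u
    have hΨu : 0 < ‖Ψ u‖ := norm_pos_iff.2 (h.ne_zero hH hH' hu0)
    change ‖Ψ x‖ • ‖Ψ u‖⁻¹ • Ψ u = Ψ x
    rw [← hux, h.map_smul _ hn _ hu0, norm_smul, norm_norm, smul_smul, mul_assoc,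
      mul_inv_cancel₀ hΨu.ne', mul_one]
  · rintro ⟨hy, hy1, u, hu, huy⟩
    refine ⟨Χ y, ⟨h'.ne_zero hH' hH hy, (h'.gauge_map y hy).trans_lt hy1,
      (dirHomeomorph hH hH' h h' hΧΨ hΨΧ).symm u, ?_, ?_⟩, hΨΧ y hy⟩
    · rw [mem_preimage, Homeomorph.apply_symm_apply]
      exact hu
    · have hn : 0 < ‖y‖ := norm_pos_iff.2 hy
      have hu0 := ne_zero_of_mem_unit_sphere u
      have hΧu : 0 < ‖Χ u‖ := norm_pos_iff.2 (h'.ne_zero hH' hH hu0)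
      change ‖Χ y‖ • ‖Χ u‖⁻¹ • Χ u = Χ y
      rw [← huy, h'.map_smul _ hn _ hu0, norm_smul, norm_norm, smul_smul, mul_assoc,
        mul_inv_cancel₀ hΧu.ne', mul_one]

/-- Homogeneous symplectic maps preserve volume. -/
theorem volume_image (h : IsHomSympl H H' Ψ) (hΧΨ : ∀ x, x ≠ 0 → Χ (Ψ x) = x) {S : Set R4}
    (hS : MeasurableSet S) (hS0 : S ⊆ {0}ᶜ) : volume (Ψ '' S) = volume S := by
  rw [← lintegral_abs_det_fderiv_eq_addHaar_image volume hS
    (fun x hx => (h.hasFDerivAt (hS0 hx)).hasFDerivWithinAt)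
    (fun x hx y hy hxy => by rw [← hΧΨ x (hS0 hx), hxy, hΧΨ y (hS0 hy)])]
  rw [setLIntegral_congr_fun (g := fun _ => 1) hS fun x hx => by
    simp only [abs_det_eq_one_of_omega (h.omega_fderiv x (hS0 hx)), ENNReal.ofReal_one]]
  simp

/-- `Ψ` maps the sector over a set of directions onto the sector over its image, by homogeneity and
`H' ∘ Ψ = H`, and it preserves volume. -/
theorem map_dirMeasure (hH : IsSmoothGauge H) (hH' : IsSmoothGauge H')
    (h : IsHomSympl H H' Ψ) (h' : IsHomSympl H' H Χ) (hΧΨ : ∀ x, x ≠ 0 → Χ (Ψ x) = x)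
    (hΨΧ : ∀ x, x ≠ 0 → Ψ (Χ x) = x) :
    (dirMeasure H).map (dirHomeomorph hH hH' h h' hΧΨ hΨΧ) = dirMeasure H' := by
  refine Measure.ext fun A hA => ?_
  have hA' := (dirHomeomorph hH hH' h h' hΧΨ hΨΧ).measurable hA
  rw [Measure.map_apply (Homeomorph.measurable _) hA, dirMeasure_apply hH hA',
    dirMeasure_apply hH' hA, ← image_sector hH hH' h h' hΧΨ hΨΧ,
    h.volume_image hΧΨ (measurableSet_sector hH hA') fun x hx => hx.1]

variable {X X' : Set R4}

/-- Integrals over the boundary are invariant under strict contactomorphisms. -/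
theorem integralBoundary_eq (hX : IsStarShapedDomain X) (hX' : IsStarShapedDomain X')
    (h : IsHomSympl (gauge X) (gauge X') Ψ) (h' : IsHomSympl (gauge X') (gauge X) Χ)
    (hΧΨ : ∀ x, x ≠ 0 → Χ (Ψ x) = x) (hΨΧ : ∀ x, x ≠ 0 → Ψ (Χ x) = x) {f f' : R4 → ℝ}
    (hf : ∀ y ∈ frontier X, f' (Ψ y) = f y) : integralBoundary X f = integralBoundary X' f' := by
  have hH := hX.isSmoothGauge
  have hH' := hX'.isSmoothGauge
  -- A homeomorphism is a measurable embedding, so the change of variables holds for arbitrary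
  -- functions; no measurability or integrability of `rot` is required.
  rw [hX.integralBoundary_eq, hX'.integralBoundary_eq,
    ← map_dirMeasure hH hH' h h' hΧΨ hΨΧ, (Homeomorph.measurableEmbedding _).integral_map]
  refine integral_congr_ae (Filter.Eventually.of_forall fun u => ?_)
  have hu := ne_zero_of_mem_unit_sphere u
  have hn : 0 < ‖Ψ u‖⁻¹ := inv_pos.2 (norm_pos_iff.2 (h.ne_zero hH hH' hu))
  have key : radialProj X' (dirHomeomorph hH hH' h h' hΧΨ hΨΧ u) = Ψ (radialProj X u) := by
    change radialProj X' (‖Ψ u‖⁻¹ • Ψ u) = _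
    rw [IsStarShapedDomain.radialProj_smul hn, radialProj, radialProj, h.gauge_map _ hu,
      h.map_smul _ (inv_pos.2 (hX.gauge_pos hu)) _ hu]
  simp only [key]
  exact (hf _ (hX.radialProj_mem_frontier hu)).symm

end IsHomSympl

end StarShaped

/-! ### Conclusion. -/

theorem proposition3p1 (X X' : Set StarShaped.R4)
    (hX : StarShaped.IsStarShapedDomain X) (hX' : StarShaped.IsStarShapedDomain X')
    (h : StarShaped.Symplectomorphic X X') :
    StarShaped.ruelleRatio X = StarShaped.ruelleRatio X' ∧
      StarShaped.systolicRatio X = StarShaped.systolicRatio X' := by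
  obtain ⟨φ, ψ, h1, h2, h3, h4, h5, h6⟩ := h
  obtain ⟨Ψ, Χ, hΨ, hΧ, hΧΨ, hΨΧ⟩ := StarShaped.IsSymplecto.exists_isHomSympl hX hX'
    (φ := φ) (ψ := ψ) ⟨h1, h2, h3, h4, h5, h6⟩
  have hvol : StarShaped.contactVolume X = StarShaped.contactVolume X' :=
    hΨ.integralBoundary_eq hX hX' hΧ hΧΨ hΨΧ fun _ _ => rfl
  have hru : StarShaped.ruelleInvariant X = StarShaped.ruelleInvariant X' :=
    hΨ.integralBoundary_eq hX hX' hΧ hΧΨ hΨΧ fun y hy => hΨ.rot_map hX hX' hΧ hΧΨ hΨΧ hy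
  have hper : StarShaped.minPeriod X = StarShaped.minPeriod X' :=
    hΨ.minPeriod_eq hX hX' hΧ
  simp only [StarShaped.ruelleRatio, StarShaped.systolicRatio, hvol, hru, hper, and_self]
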